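/- Let $F$ be a field of characteristic $0$, let $E$ be the infinite dimensional (unital) Grassmann algebra over $F$, generated by a vector space with countable basis, and let $R=UT_2(E)$ be the algebra of upper triangular $2\times 2$ matrices with entries in $E$. For $d\ge 0$ let $B_d=B(x_1,\dots,x_d)$ be the algebra of proper polynomials, i.e. the unital subalgebra of the free unital associative algebra $F\langle x_1,\dots,x_d\rangle$ generated by all left-normed commutators $[x_{i_1},\dots,x_{i_r}]$, $r\ge 2$. For a unital $F$-algebra $A$ let $T(A)$ be the ideal of polynomial identities of $A$, and let the proper Hilbert series $$H^B(A)=H^B(A,t_1,\dots,t_d)=\sum_{n\in\mathbb N^d}\dim_F\bigl(B_d/(B_d\cap T(A))\bigr)^{(n)}\,t_1^{n_1}\cdots t_d^{n_d}$$ be the Hilbert series of $B_d/(B_d\cap T(A))$ with respect to multidegree. For a partition $\lambda$ let $S_\lambda=S_\lambda(t_1,\dots,t_d)$ be the Schur function, i.e. the sum of $t^T$ over all semistandard tableaux $T$ of shape $\lambda$ with entries in $\{1,\dots,d\}$. Then for every $d\ge 0$ $$H^B(R)=2H^B(E)+\frac{S_{(1)}-1}{\prod_{i=1}^d(1-t_i)}\,\bigl(H^B(E)\bigr)^2=\sum_\lambda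 m_\lambda S_\lambda ,$$ where the non-negative integers $m_\lambda$ do not depend on $d$, and $m_\lambda=0$ unless $\lambda$ is of one of the following forms, with $m,l\ge 0$: * $\lambda=(k,2^m,1^l)$ with $k\ge 3$: then $m_\lambda=2(l+1)$ if $m\ge1$, and $m_\lambda=l$ if $m=0$; * $\lambda=(2^m,1^l)$ with $m\ge 2$: then $m_\lambda=l+1$; * $\lambda=(2,1^l)$: then $m_\lambda=\frac l2$ if $l$ is even, and $m_\lambda=\frac{l+1}2$ if $l$ is odd; * $\lambda=(1^l)$: then $m_\lambda=1$ if $l$ is even, and $m_\lambda=0$ if $l$ is odd; * $\lambda=(k,3,2^m,1^l)$ with $k\ge3$: then $m_\lambda=l+1$. -/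

import Mathlib

open scoped MvPowerSeries.WithPiTopology

noncomputable section

namespace PropPI

/-- `T(A)` in the variables `σ`: the elements of the free unital associative algebra `F⟨σ⟩` killed
by every homomorphism of unital algebras `F⟨σ⟩ → A`. -/
def identities (F : Type*) [Field F] (A : Type*) [Ring A] [Algebra F A] (σ : Type*) :
    Submodule F (FreeAlgebra F σ) :=
  ⨅ φ : FreeAlgebra F σ →ₐ[F] A, LinearMap.ker φ.toLinearMap

/-- The left-normed commutator `[[…[x_i, x_{j₁}], …], x_{jᵣ}]` of variables. -/
def leftNormed (F : Type*) [Field F] {σ : Type*} (i : σ) (js : List σ) : FreeAlgebra F σ :=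
  js.foldl (fun u j => u * FreeAlgebra.ι F j - FreeAlgebra.ι F j * u) (FreeAlgebra.ι F i)

/-- The algebra `B(σ)` of proper polynomials: the unital subalgebra of `F⟨σ⟩` generated by the
left-normed commutators, of length at least two, of variables. -/
def properPolys (F : Type*) [Field F] (σ : Type*) : Subalgebra F (FreeAlgebra F σ) :=
  Algebra.adjoin F {u | ∃ (i : σ) (js : List σ), js ≠ [] ∧ u = leftNormed F i js}

/-- The multihomogeneous component of `F⟨x_1, …, x_d⟩` of multidegree `n`: the span of the words in
which each variable `x_i` occurs exactly `n i` times. -/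
def multiHom (F : Type*) [Field F] (d : ℕ) (n : Fin d →₀ ℕ) :
    Submodule F (FreeAlgebra F (Fin d)) :=
  Submodule.span F
    {u | ∃ w : List (Fin d), (∀ i, w.count i = n i) ∧ u = (w.map (FreeAlgebra.ι F)).prod}

/-- The relatively free algebra of proper polynomials `B(x_1, …, x_d) / (B(x_1, …, x_d) ∩ T(A))`,
as a vector space. -/
abbrev RelProper (F : Type*) [Field F] (A : Type*) [Ring A] [Algebra F A] (d : ℕ) : Type _ :=
  ↥(Subalgebra.toSubmodule (properPolys F (Fin d))) ⧸
    (identities F A (Fin d)).comap (Subalgebra.toSubmodule (properPolys F (Fin d))).subtype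

/-- The component of multidegree `n` of `B(x_1, …, x_d) / (B(x_1, …, x_d) ∩ T(A))`. -/
def relProperComponent (F : Type*) [Field F] (A : Type*) [Ring A] [Algebra F A] (d : ℕ)
    (n : Fin d →₀ ℕ) : Submodule F (RelProper F A d) :=
  ((multiHom F d n).comap (Subalgebra.toSubmodule (properPolys F (Fin d))).subtype).map
    (Submodule.mkQ _)

/-- The proper Hilbert series `H^B(A, t_1, …, t_d)`. -/
def properHilbert (F : Type*) [Field F] (A : Type*) [Ring A] [Algebra F A] (d : ℕ) :
    MvPowerSeries (Fin d) ℤ :=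
  fun n => (Module.finrank F (relProperComponent F A d n) : ℤ)

/-- The Schur function `S_μ(t_1, …, t_d)`: the coefficient of `t^n` is the number of semistandard
tableaux of shape `μ` with entries in `{0, …, d - 1}` and with `n a` entries equal to `a`, for
every `a`. -/
def schur (d : ℕ) (μ : YoungDiagram) : MvPowerSeries (Fin d) ℤ :=
  fun n => (Nat.card {T : SemistandardYoungTableau μ //
    (∀ c ∈ μ.cells, T c.1 c.2 < d) ∧
    ∀ a : Fin d, (μ.cells.filter fun c => T c.1 c.2 = (a : ℕ)).card = n a} : ℤ)

/-- The partition `(1)`. -/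
def oneBox : YoungDiagram := YoungDiagram.ofRowLens [1] (by decide)

/-- The power series `1 / ∏ (1 - t_i)`, the inverse of `∏ (1 - t_i)`. -/
def invProd (d : ℕ) : MvPowerSeries (Fin d) ℤ :=
  MvPowerSeries.invOfUnit (∏ i : Fin d, (1 - MvPowerSeries.X i)) 1

/-- The infinite dimensional Grassmann algebra with unit: the exterior algebra of a vector space
with countable basis. -/
abbrev Grassmann (F : Type*) [Field F] : Type _ := ExteriorAlgebra F (ℕ →₀ F)

/-- The algebra `UT_2(A)` of upper triangular `2 × 2` matrices with entries in `A`. -/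
def UT2 (F : Type*) [Field F] (A : Type*) [Ring A] [Algebra F A] :
    Subalgebra F (Matrix (Fin 2) (Fin 2) A) where
  carrier := {M | M 1 0 = 0}
  mul_mem' := by
    intro M N hM hN
    simp only [Set.mem_ofPred_eq] at *
    simp [Matrix.mul_apply, Fin.sum_univ_two, hM, hN]
  add_mem' := by
    intro M N hM hN
    simp only [Set.mem_ofPred_eq] at *
    simp [hM, hN]
  algebraMap_mem' := by
    intro r
    simp [Matrix.algebraMap_matrix_apply]

end PropPI

end

/-!
Let `T(A)` be the identities of an algebra `A` in `d` variables. In characteristic zero the free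
algebra modulo `T(A)` has a basis of products `x_1^{k_1} ⋯ x_d^{k_d} b`, where `b` runs over a
basis of the proper polynomials modulo `T(A)`: the difference operators for `x_i ↦ x_i + 1` kill
the proper polynomials and preserve `T(A)`, and so separate the powers of the variables. Hence
`∏ (1 - t_i)` times the Hilbert series `H(A)` of the relatively free algebra is the proper Hilbert
series `H^B(A)` (`prod_one_sub_X_mul_hilbSeries`).

The off-diagonal entry of the value of a word `w` on upper triangular matrices is a sum over the
factorizations `w = u x_i v` of products `u(a) c_i v(b)`, with generic `a`, `b`, `c`. The
Grassmann algebra `E` contains two copies `E₀`, `E₁` of itself, generated by the even and by the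
odd generators, and the multiplication embeds the space `E₀ ⊗ E₁` into `E`
(`exists_grassmann_tensor`). Evaluating `u` and `v` there shows that a polynomial is an identity
of `UT_2(E)` if and only if all the maps `u x_i v ↦ u ⊗ v`, with `u` of a given multidegree and
values in the tensor square of the relatively free algebra of `E`, kill it (`mem_identities_ut2`).
The intersection of their kernels is counted by inclusion and exclusion over the length `p` of
`u`: the common kernel for lengths below `p` and the kernel for length `p` have as sum the kernel
of the maps `u v ↦ u ⊗ v` with `u` of length `p` (`markKerLT_sup_markKer`). This gives
`H(UT_2(E)) = 2 H(E) + (S_(1) - 1) H(E)^2` (`hilbSeries_ut2`), which becomes the first formula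
after multiplication by `∏ (1 - t_i)`.

A proper polynomial is an identity of `E` if and only if it vanishes at the generators, so
`H^B(E)` is the sum of the elementary symmetric polynomials of even degree, one half of
`∏ (1 + t_i) + ∏ (1 - t_i)` (`coeff_properHilbert_grassmann`). Therefore
`4 H^B(E)^2 / ∏ (1 - t_i)` is the sum of `∏ (1 + t_i)^2 / (1 - t_i)`, of `2 ∏ (1 + t_i)` and of
`∏ (1 - t_i)`. These three series are products over the variables of a series in one variable,
with coefficients `1, 3, 4, 4, …` and `1, 1, 0, …` and `1, -1, 0, …`.

For the Schur expansions, semistandard tableaux are built by adding horizontal strips. If a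
function `a` on diagrams is an eigenfunction, with eigenvalues `γ r`, of all the operators
`skew r` that sum over the horizontal strips of size `r`, and if `a ⊥ = 1`, then `∑ a(μ) S_μ` is
the product over the variables of `∑ γ r t_i^r` (`schurSeries_of_eigen`). The required
eigenfunctions are supported on the fat hooks `(k, 2^m, 1^l)` and depend only on the lengths of
the first two columns. The remaining factor `S_(1)` adds a box (`schurSeries_lower`), and
collecting terms gives the multiplicities (`four_mul_mult`).
-/

noncomputable section

namespace PropPI

/-! ### Words in the free algebra -/

section Words

variable {F : Type*} [Field F] {σ : Type*}

/-- The monomial of `F⟨σ⟩` given by a word. -/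
def word (F : Type*) [Field F] {σ : Type*} (w : List σ) : FreeAlgebra F σ :=
  (w.map (FreeAlgebra.ι F)).prod

@[simp] lemma word_nil : word F ([] : List σ) = 1 := rfl

@[simp] lemma word_cons (i : σ) (w : List σ) : word F (i :: w) = FreeAlgebra.ι F i * word F w := by
  simp [word]

lemma word_append (u v : List σ) : word F (u ++ v) = word F u * word F v := by
  simp [word]

lemma basisFreeMonoid_apply (w : List σ) :
    FreeAlgebra.basisFreeMonoid F σ (FreeMonoid.ofList w) = word F w := by
  have h : FreeAlgebra.basisFreeMonoid F σ (FreeMonoid.ofList w) =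
      FreeAlgebra.equivMonoidAlgebraFreeMonoid.symm
        (MonoidAlgebra.of F _ (FreeMonoid.ofList w)) := rfl
  rw [h]
  clear h
  induction w with
  | nil => exact map_one _
  | cons i w ih =>
    rw [FreeMonoid.ofList_cons, map_mul, map_mul, ih, word_cons]
    congr 1
    rw [AlgEquiv.symm_apply_eq]
    simp [FreeAlgebra.equivMonoidAlgebraFreeMonoid]

/-- The linear map on `F⟨σ⟩` with prescribed values on words. -/
def onWords {M : Type*} [AddCommGroup M] [Module F M] (f : List σ → M) :
    FreeAlgebra F σ →ₗ[F] M :=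
  (FreeAlgebra.basisFreeMonoid F σ).constr F fun w => f w.toList

@[simp] lemma onWords_word {M : Type*} [AddCommGroup M] [Module F M] (f : List σ → M)
    (w : List σ) : onWords f (word F w) = f w := by
  rw [← basisFreeMonoid_apply, onWords, Module.Basis.constr_basis]
  rfl

lemma word_ext {M : Type*} [AddCommGroup M] [Module F M] {f g : FreeAlgebra F σ →ₗ[F] M}
    (h : ∀ w, f (word F w) = g (word F w)) : f = g := by
  apply (FreeAlgebra.basisFreeMonoid F σ).ext
  intro w
  simpa [← basisFreeMonoid_apply] using h w.toList

end Words

/-! ### Multihomogeneous components -/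

section MultiHom

variable {F : Type*} [Field F] {d : ℕ}

/-- The multidegree of a word. -/
def content (w : List (Fin d)) : Fin d →₀ ℕ := Finsupp.equivFunOnFinite.symm fun i => w.count i

@[simp] lemma content_apply (w : List (Fin d)) (i : Fin d) : content w i = w.count i := rfl

@[simp] lemma content_nil : content ([] : List (Fin d)) = 0 := by ext; simp

lemma content_append (u v : List (Fin d)) : content (u ++ v) = content u + content v := by
  ext; simp

lemma content_cons (i : Fin d) (v : List (Fin d)) :
    content (i :: v) = Finsupp.single i 1 + content v := by
  ext j
  simp [List.count_cons, Finsupp.single_apply, add_comm]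

lemma sum_content (w : List (Fin d)) : ∑ i, content w i = w.length := by
  induction w with
  | nil => simp
  | cons i w ih => simp [content_cons, Finset.sum_add_distrib, Finsupp.single_apply,
      ← ih, add_comm]

lemma multiHom_eq (n : Fin d →₀ ℕ) :
    multiHom F d n = Submodule.span F (word F '' {w | content w = n}) := by
  unfold multiHom
  congr 1
  ext u
  simp only [Set.mem_ofPred_eq, Set.mem_image, word, eq_comm]
  refine exists_congr fun w => and_congr_left fun _ => ?_
  constructor
  · intro h
    ext i
    simp [h i]
  · rintro rfl i
    simp

lemma word_mem_multiHom (w : List (Fin d)) : word F w ∈ multiHom F d (content w) := by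
  rw [multiHom_eq]
  exact Submodule.subset_span ⟨w, rfl, rfl⟩

lemma word_mem_multiHom_of_eq {w : List (Fin d)} {n : Fin d →₀ ℕ} (h : content w = n) :
    word F w ∈ multiHom F d n := h ▸ word_mem_multiHom w

/-- To compare two linear maps on a multihomogeneous component it suffices to compare them on
words. -/
lemma multiHom_eqOn {M : Type*} [AddCommGroup M] [Module F M] {n : Fin d →₀ ℕ}
    {f g : FreeAlgebra F (Fin d) →ₗ[F] M}
    (h : ∀ w, content w = n → f (word F w) = g (word F w)) {u : FreeAlgebra F (Fin d)}
    (hu : u ∈ multiHom F d n) : f u = g u := by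
  rw [multiHom_eq] at hu
  refine LinearMap.eqOn_span (s := word F '' {w | content w = n}) ?_ hu
  rintro _ ⟨w, hw, rfl⟩
  exact h w hw

lemma map_multiHom_le {M : Type*} [AddCommGroup M] [Module F M] {n : Fin d →₀ ℕ}
    {f : FreeAlgebra F (Fin d) →ₗ[F] M} {S : Submodule F M}
    (h : ∀ w, content w = n → f (word F w) ∈ S) {u : FreeAlgebra F (Fin d)}
    (hu : u ∈ multiHom F d n) : f u ∈ S := by
  have : multiHom F d n ≤ S.comap f := by
    rw [multiHom_eq, Submodule.span_le]
    rintro _ ⟨w, hw, rfl⟩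
    exact h w hw
  exact this hu

lemma one_mem_multiHom : (1 : FreeAlgebra F (Fin d)) ∈ multiHom F d 0 :=
  word_mem_multiHom_of_eq (w := []) (by simp)

lemma ι_mem_multiHom (i : Fin d) :
    FreeAlgebra.ι F i ∈ multiHom F d (Finsupp.single i 1) := by
  simpa using word_mem_multiHom_of_eq (F := F) (w := [i]) (by simp [content_cons])

lemma mul_mem_multiHom {m n : Fin d →₀ ℕ} {u v : FreeAlgebra F (Fin d)}
    (hu : u ∈ multiHom F d m) (hv : v ∈ multiHom F d n) : u * v ∈ multiHom F d (m + n) := by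
  refine map_multiHom_le (f := LinearMap.mulRight F v) (S := multiHom F d (m + n)) ?_ hu
  intro w hw
  refine map_multiHom_le (f := LinearMap.mulLeft F (word F w)) ?_ hv
  intro w' hw'
  rw [LinearMap.mulLeft_apply, ← word_append]
  exact word_mem_multiHom_of_eq (by rw [content_append, hw, hw'])

lemma finite_content (n : Fin d →₀ ℕ) : {w : List (Fin d) | content w = n}.Finite := by
  refine (List.finite_length_eq (Fin d) (∑ i, n i)).subset ?_
  rintro w rfl
  exact (sum_content w).symm

instance finite_multiHom (n : Fin d →₀ ℕ) : Module.Finite F (multiHom F d n) := by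
  rw [multiHom_eq]
  exact Module.Finite.span_of_finite F ((finite_content n).image _)

end MultiHom

/-! ### Ranks -/

section Ranks

variable {F : Type*} [Field F]

/-- Two linear maps with the same kernel have the same rank. -/
lemma finrank_range_eq_of_ker_eq {M N N' : Type*} [AddCommGroup M] [Module F M] [AddCommGroup N]
    [Module F N] [AddCommGroup N'] [Module F N'] (f : M →ₗ[F] N) (g : M →ₗ[F] N')
    (h : ∀ x, f x = 0 ↔ g x = 0) :
    Module.finrank F (LinearMap.range f) = Module.finrank F (LinearMap.range g) := by
  have hk : LinearMap.ker f = LinearMap.ker g := by ext x; simpa using h x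
  exact LinearEquiv.finrank_eq
    (f.quotKerEquivRange.symm.trans
      ((Submodule.quotEquivOfEq _ _ hk).trans g.quotKerEquivRange))

lemma finrank_map_eq_of_ker_eq {M N N' : Type*} [AddCommGroup M] [Module F M] [AddCommGroup N]
    [Module F N] [AddCommGroup N'] [Module F N'] (S : Submodule F M) (f : M →ₗ[F] N)
    (g : M →ₗ[F] N') (h : ∀ x ∈ S, f x = 0 ↔ g x = 0) :
    Module.finrank F (S.map f) = Module.finrank F (S.map g) := by
  rw [← LinearMap.range_domRestrict, ← LinearMap.range_domRestrict]
  exact finrank_range_eq_of_ker_eq _ _ fun x => h x x.2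

end Ranks

/-! ### The free algebra over its proper polynomials -/

section Proper

variable {F : Type*} [Field F] {d : ℕ} (A : Type*) [Ring A] [Algebra F A]

/-- The dimension of the component of multidegree `n` of `F⟨x_1, …, x_d⟩ / T(A)`. -/
def hilb (F : Type*) [Field F] {d : ℕ} (A : Type*) [Ring A] [Algebra F A] (n : Fin d →₀ ℕ) : ℕ :=
  Module.finrank F ((multiHom F d n).map (identities F A (Fin d)).mkQ)

/-- The Hilbert series of `F⟨x_1, …, x_d⟩ / T(A)`. -/
def hilbSeries (F : Type*) [Field F] (d : ℕ) (A : Type*) [Ring A] [Algebra F A] :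
    MvPowerSeries (Fin d) ℤ :=
  fun n => (hilb F A n : ℤ)

variable {A}

lemma mem_identities {σ : Type*} {f : FreeAlgebra F σ} :
    f ∈ identities F A σ ↔ ∀ φ : FreeAlgebra F σ →ₐ[F] A, φ f = 0 := by
  simp [identities, Submodule.mem_iInf]

lemma map_mem_identities {σ : Type*} {f : FreeAlgebra F σ} (hf : f ∈ identities F A σ)
    (g : FreeAlgebra F σ →ₐ[F] FreeAlgebra F σ) : g f ∈ identities F A σ := by
  rw [mem_identities] at *
  exact fun φ => hf (φ.comp g)

lemma mul_mem_identities_left {σ : Type*} {f : FreeAlgebra F σ} (hf : f ∈ identities F A σ)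
    (u : FreeAlgebra F σ) : u * f ∈ identities F A σ := by
  rw [mem_identities] at *
  intro φ
  simp [hf φ]

lemma coeff_properHilbert (n : Fin d →₀ ℕ) :
    MvPowerSeries.coeff n (properHilbert F A d) =
      (Module.finrank F ((Subalgebra.toSubmodule (properPolys F (Fin d)) ⊓ multiHom F d n).map
        (identities F A (Fin d)).mkQ) : ℤ) := by
  change ((Module.finrank F (relProperComponent F A d n) : ℕ) : ℤ) = _
  congr 1
  unfold relProperComponent
  rw [finrank_map_eq_of_ker_eq _ _
    ((identities F A (Fin d)).mkQ ∘ₗ (Subalgebra.toSubmodule (properPolys F (Fin d))).subtype)]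
  · rw [Submodule.map_comp, Submodule.map_comap_subtype]
  · intro x _
    simp

/-- The commutator of a proper polynomial with a variable is proper. -/
lemma commutator_mem_properPolys {σ : Type*} {b : FreeAlgebra F σ} (hb : b ∈ properPolys F σ)
    (i : σ) : b * FreeAlgebra.ι F i - FreeAlgebra.ι F i * b ∈ properPolys F σ := by
  unfold properPolys at *
  induction hb using Algebra.adjoin_induction with
  | mem x hx =>
    obtain ⟨j, js, -, rfl⟩ := hx
    refine Algebra.subset_adjoin ⟨j, js ++ [i], by simp, ?_⟩
    simp [leftNormed]
  | algebraMap r =>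
    rw [Algebra.commutes r, sub_self]
    exact zero_mem _
  | add x y _ _ hx hy =>
    convert add_mem hx hy using 1
    noncomm_ring
  | mul x y hx' hy' hx hy =>
    convert add_mem (mul_mem hx' hy) (mul_mem hx hy') using 1
    noncomm_ring

/-- The span, in multidegree `n`, of the products `x_{i₁}^{k₁} ⋯ x_{iᵣ}^{kᵣ} b` with `b` proper,
for the list `[i₁, …, iᵣ]` of variables. -/
def ordSub (F : Type*) [Field F] {d : ℕ} :
    List (Fin d) → (Fin d →₀ ℕ) → Submodule F (FreeAlgebra F (Fin d))
  | [], n => Subalgebra.toSubmodule (properPolys F (Fin d)) ⊓ multiHom F d n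
  | i :: l, n => Submodule.span F {f | ∃ (k : ℕ) (m : Fin d →₀ ℕ) (y : FreeAlgebra F (Fin d)),
      y ∈ ordSub F l m ∧ m + Finsupp.single i k = n ∧ f = FreeAlgebra.ι F i ^ k * y}

lemma ordSub_tail (i : Fin d) (l : List (Fin d)) (n : Fin d →₀ ℕ) :
    ordSub F l n ≤ ordSub F (i :: l) n := by
  intro y hy
  exact Submodule.subset_span ⟨0, n, y, hy, by simp, by simp⟩

lemma ι_mul_mem_ordSub_cons {i : Fin d} {l : List (Fin d)} {n : Fin d →₀ ℕ}
    {y : FreeAlgebra F (Fin d)} (hy : y ∈ ordSub F (i :: l) n) :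
    FreeAlgebra.ι F i * y ∈ ordSub F (i :: l) (n + Finsupp.single i 1) := by
  suffices h : ordSub F (i :: l) n ≤ (ordSub F (i :: l) (n + Finsupp.single i 1)).comap
      (LinearMap.mulLeft F (FreeAlgebra.ι F i)) from h hy
  conv_lhs => rw [ordSub]
  rw [Submodule.span_le]
  rintro _ ⟨k, m, z, hz, rfl, rfl⟩
  refine Submodule.subset_span ⟨k + 1, m, z, hz, ?_, ?_⟩
  · rw [Finsupp.single_add, add_assoc]
  · simp [pow_succ', mul_assoc]

lemma ordSub_cons_of_eq_zero {i : Fin d} (l : List (Fin d)) {n : Fin d →₀ ℕ} (h : n i = 0) :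
    ordSub F (i :: l) n = ordSub F l n := by
  refine le_antisymm ?_ (ordSub_tail i l n)
  rw [ordSub, Submodule.span_le]
  rintro _ ⟨k, m, y, hy, rfl, rfl⟩
  obtain rfl : k = 0 := by simp at h; exact h.2
  simpa using hy

lemma ordSub_cons_add_single (i : Fin d) (l : List (Fin d)) (n : Fin d →₀ ℕ) :
    ordSub F (i :: l) (n + Finsupp.single i 1) =
      (ordSub F (i :: l) n).map (LinearMap.mulLeft F (FreeAlgebra.ι F i)) ⊔
        ordSub F l (n + Finsupp.single i 1) := by
  apply le_antisymm
  · conv_lhs => rw [ordSub]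
    rw [Submodule.span_le]
    rintro _ ⟨k, m, y, hy, hm, rfl⟩
    cases k with
    | zero =>
      refine Submodule.mem_sup_right ?_
      simpa [← hm] using hy
    | succ k =>
      refine Submodule.mem_sup_left ⟨FreeAlgebra.ι F i ^ k * y, ?_, ?_⟩
      · refine Submodule.subset_span ⟨k, m, y, hy, ?_, rfl⟩
        rwa [Finsupp.single_add, ← add_assoc, add_left_inj] at hm
      · simp [pow_succ', mul_assoc]
  · refine sup_le ?_ (ordSub_tail _ _ _)
    rintro _ ⟨y, hy, rfl⟩
    exact ι_mul_mem_ordSub_cons hy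

lemma mul_mem_ordSub {b : FreeAlgebra F (Fin d)} {m : Fin d →₀ ℕ} (hb : b ∈ properPolys F (Fin d))
    (hbm : b ∈ multiHom F d m) {l : List (Fin d)} {n : Fin d →₀ ℕ} {y : FreeAlgebra F (Fin d)}
    (hy : y ∈ ordSub F l n) : b * y ∈ ordSub F l (m + n) := by
  induction l generalizing b m n y with
  | nil => exact ⟨Subalgebra.mul_mem _ hb hy.1, mul_mem_multiHom hbm hy.2⟩
  | cons i l ih =>
    have key : ∀ (k : ℕ) (b : FreeAlgebra F (Fin d)) (m n : Fin d →₀ ℕ),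
        b ∈ properPolys F (Fin d) → b ∈ multiHom F d m → ∀ y ∈ ordSub F l n,
        b * (FreeAlgebra.ι F i ^ k * y) ∈ ordSub F (i :: l) (m + n + Finsupp.single i k) := by
      intro k
      induction k with
      | zero =>
        intro b m n hb hbm y hy
        simpa using ordSub_tail i l _ (ih hb hbm hy)
      | succ k ihk =>
        intro b m n hb hbm y hy
        have h1 := ι_mul_mem_ordSub_cons (ihk b m n hb hbm y hy)
        have hc : b * FreeAlgebra.ι F i - FreeAlgebra.ι F i * b ∈
            multiHom F d (m + Finsupp.single i 1) := by
          refine sub_mem (mul_mem_multiHom hbm (ι_mem_multiHom i)) ?_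
          rw [add_comm]
          exact mul_mem_multiHom (ι_mem_multiHom i) hbm
        have h2 := ihk _ _ n (commutator_mem_properPolys hb i) hc y hy
        have e1 : m + n + Finsupp.single i k + Finsupp.single i 1 =
          m + n + Finsupp.single i (k + 1) := by rw [Finsupp.single_add, add_assoc]
        have e2 : m + Finsupp.single i 1 + n + Finsupp.single i k =
          m + n + Finsupp.single i (k + 1) := by rw [Finsupp.single_add]; abel
        rw [e1] at h1
        rw [e2] at h2
        convert add_mem h1 h2 using 1
        rw [pow_succ']
        noncomm_ring
    suffices h : ordSub F (i :: l) n ≤ (ordSub F (i :: l) (m + n)).comap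
        (LinearMap.mulLeft F b) from h hy
    conv_lhs => rw [ordSub]
    rw [Submodule.span_le]
    rintro _ ⟨k, n', z, hz, rfl, rfl⟩
    simpa [add_assoc] using key k b m n' hb hbm z hz

lemma leftNormed_pair_mem (k i : Fin d) :
    FreeAlgebra.ι F k * FreeAlgebra.ι F i - FreeAlgebra.ι F i * FreeAlgebra.ι F k ∈
      properPolys F (Fin d) :=
  Algebra.subset_adjoin ⟨k, [i], by simp, by simp [leftNormed]⟩

/-- Moving `x_k` to its place past the earlier variables costs commutators, which are proper. -/
lemma ι_mul_mem_ordSub {k : Fin d} {l : List (Fin d)} (hk : k ∈ l) {n : Fin d →₀ ℕ}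
    {y : FreeAlgebra F (Fin d)} (hy : y ∈ ordSub F l n) :
    FreeAlgebra.ι F k * y ∈ ordSub F l (n + Finsupp.single k 1) := by
  induction l generalizing n y with
  | nil => simp at hk
  | cons i l ih =>
    by_cases hki : k = i
    · subst hki
      exact ι_mul_mem_ordSub_cons hy
    have hkl : k ∈ l := by simpa [hki] using hk
    have key : ∀ (r : ℕ) (n : Fin d →₀ ℕ), ∀ y ∈ ordSub F l n,
        FreeAlgebra.ι F k * (FreeAlgebra.ι F i ^ r * y) ∈
          ordSub F (i :: l) (n + Finsupp.single i r + Finsupp.single k 1) := by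
      intro r
      induction r with
      | zero =>
        intro n y hy
        simpa using ordSub_tail i l _ (ih hkl hy)
      | succ r ihr =>
        intro n y hy
        have h1 := ι_mul_mem_ordSub_cons (ihr n y hy)
        have hc : FreeAlgebra.ι F k * FreeAlgebra.ι F i - FreeAlgebra.ι F i * FreeAlgebra.ι F k ∈
            multiHom F d (Finsupp.single k 1 + Finsupp.single i 1) := by
          refine sub_mem (mul_mem_multiHom (ι_mem_multiHom k) (ι_mem_multiHom i)) ?_
          rw [add_comm]
          exact mul_mem_multiHom (ι_mem_multiHom i) (ι_mem_multiHom k)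
        have h3 : FreeAlgebra.ι F i ^ r * y ∈ ordSub F (i :: l) (n + Finsupp.single i r) :=
          Submodule.subset_span ⟨r, n, y, hy, rfl, rfl⟩
        have h2 := mul_mem_ordSub (leftNormed_pair_mem k i) hc h3
        have e1 : n + Finsupp.single i r + Finsupp.single k 1 + Finsupp.single i 1 =
          n + Finsupp.single i (r + 1) + Finsupp.single k 1 := by rw [Finsupp.single_add]; abel
        have e2 : Finsupp.single k 1 + Finsupp.single i 1 + (n + Finsupp.single i r) =
          n + Finsupp.single i (r + 1) + Finsupp.single k 1 := by rw [Finsupp.single_add]; abel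
        rw [e1] at h1
        rw [e2] at h2
        convert add_mem h1 h2 using 1
        rw [pow_succ']
        noncomm_ring
    suffices h : ordSub F (i :: l) n ≤ (ordSub F (i :: l) (n + Finsupp.single k 1)).comap
        (LinearMap.mulLeft F (FreeAlgebra.ι F k)) from h hy
    conv_lhs => rw [ordSub]
    rw [Submodule.span_le]
    rintro _ ⟨r, n', z, hz, rfl, rfl⟩
    exact key r n' z hz

lemma ordSub_le_multiHom (l : List (Fin d)) (n : Fin d →₀ ℕ) :
    ordSub F l n ≤ multiHom F d n := by
  induction l generalizing n with
  | nil => exact inf_le_right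
  | cons i l ih =>
    rw [ordSub, Submodule.span_le]
    rintro _ ⟨k, m, y, hy, rfl, rfl⟩
    rw [add_comm]
    refine mul_mem_multiHom ?_ (ih m hy)
    clear hy
    induction k with
    | zero => simpa using one_mem_multiHom
    | succ k ihk =>
      rw [pow_succ, Finsupp.single_add]
      exact mul_mem_multiHom ihk (ι_mem_multiHom i)

lemma ordSub_finRange (n : Fin d →₀ ℕ) : ordSub F (List.finRange d) n = multiHom F d n := by
  refine le_antisymm (ordSub_le_multiHom _ _) ?_
  rw [multiHom_eq, Submodule.span_le]
  rintro _ ⟨w, rfl, rfl⟩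
  induction w with
  | nil =>
    have h : ∀ l : List (Fin d), (1 : FreeAlgebra F (Fin d)) ∈ ordSub F l 0 := by
      intro l
      induction l with
      | nil => exact ⟨Subalgebra.one_mem _, one_mem_multiHom⟩
      | cons i l ih => exact ordSub_tail _ _ _ ih
    simpa using h _
  | cons i w ih =>
    rw [word_cons, content_cons, add_comm]
    exact ι_mul_mem_ordSub (List.mem_finRange i) ih

/-- The automorphism `x_i ↦ x_i + 1` of the free algebra, fixing the other variables. -/
def shift (F : Type*) [Field F] {d : ℕ} (i : Fin d) :
    FreeAlgebra F (Fin d) →ₐ[F] FreeAlgebra F (Fin d) :=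
  FreeAlgebra.lift F fun j => FreeAlgebra.ι F j + if j = i then 1 else 0

/-- The difference operator `f ↦ f(…, x_i + 1, …) - f`. -/
def diff (F : Type*) [Field F] {d : ℕ} (i : Fin d) :
    FreeAlgebra F (Fin d) →ₗ[F] FreeAlgebra F (Fin d) :=
  (shift F i).toLinearMap - LinearMap.id

lemma diff_apply (i : Fin d) (f : FreeAlgebra F (Fin d)) : diff F i f = shift F i f - f := rfl

lemma shift_ι_of_ne {i j : Fin d} (h : j ≠ i) :
    shift F i (FreeAlgebra.ι F j) = FreeAlgebra.ι F j := by
  simp [shift, h]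

lemma shift_ι_self (i : Fin d) :
    shift F i (FreeAlgebra.ι F i) = FreeAlgebra.ι F i + 1 := by
  simp [shift]

lemma shift_properPolys (i : Fin d) {b : FreeAlgebra F (Fin d)}
    (hb : b ∈ properPolys F (Fin d)) : shift F i b = b := by
  unfold properPolys at hb
  have hs : ∀ j, shift F i (FreeAlgebra.ι F j) =
      FreeAlgebra.ι F j + algebraMap F _ (if j = i then 1 else 0) := by
    intro j
    by_cases h : j = i <;> simp [shift, h]
  induction hb using Algebra.adjoin_induction with
  | mem x hx =>
    obtain ⟨j, js, hjs, rfl⟩ := hx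
    induction js using List.reverseRecOn with
    | nil => exact absurd rfl hjs
    | append_singleton js k ih =>
      have hstep : ∀ u : FreeAlgebra F (Fin d), (∃ r : F, shift F i u = u + algebraMap F _ r) →
          shift F i (u * FreeAlgebra.ι F k - FreeAlgebra.ι F k * u) =
            u * FreeAlgebra.ι F k - FreeAlgebra.ι F k * u := by
        rintro u ⟨r, hr⟩
        have c1 := Algebra.commutes (R := F) r (FreeAlgebra.ι F k : FreeAlgebra F (Fin d))
        have c2 := Algebra.commutes (R := F) (if k = i then 1 else 0 : F) u
        have c3 := Algebra.commutes (R := F) r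
          (algebraMap F (FreeAlgebra F (Fin d)) (if k = i then 1 else 0))
        rw [map_sub, map_mul, map_mul, hs, hr]
        simp only [add_mul, mul_add, c1, c2, c3]
        abel
      have e : leftNormed F j (js ++ [k]) = leftNormed F j js * FreeAlgebra.ι F k -
          FreeAlgebra.ι F k * leftNormed F j js := by simp [leftNormed]
      rw [e]
      apply hstep
      by_cases hjs' : js = []
      · subst hjs'
        exact ⟨_, hs j⟩
      · exact ⟨0, by simpa using ih hjs'⟩
  | algebraMap r => simp
  | add x y _ _ hx hy => rw [map_add, hx, hy]
  | mul x y _ _ hx hy => rw [map_mul, hx, hy]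

lemma shift_ordSub {i : Fin d} {l : List (Fin d)} (hi : i ∉ l) {n : Fin d →₀ ℕ}
    {y : FreeAlgebra F (Fin d)} (hy : y ∈ ordSub F l n) : shift F i y = y := by
  induction l generalizing n y with
  | nil => exact shift_properPolys i hy.1
  | cons j l ih =>
    simp only [List.mem_cons, not_or] at hi
    rw [ordSub] at hy
    refine LinearMap.eqOn_span (f := (shift F i).toLinearMap) (g := LinearMap.id) ?_ hy
    rintro _ ⟨k, m, z, hz, rfl, rfl⟩
    simp [ih hi.2 hz, shift_ι_of_ne (Ne.symm hi.1)]

lemma diff_iterate_ι_mul (i : Fin d) (y : FreeAlgebra F (Fin d)) (k : ℕ) :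
    (diff F i ^ (k + 1)) (FreeAlgebra.ι F i * y) =
      FreeAlgebra.ι F i * (diff F i ^ (k + 1)) y + (k + 1) • shift F i ((diff F i ^ k) y) := by
  induction k with
  | zero =>
    simp only [zero_add, pow_one, pow_zero, Module.End.one_apply, one_smul, diff_apply, map_mul,
      shift_ι_self]
    noncomm_ring
  | succ k ih =>
    rw [pow_succ', Module.End.mul_apply, ih, map_add, map_nsmul]
    have hc : diff F i (shift F i ((diff F i ^ k) y)) = shift F i ((diff F i ^ (k + 1)) y) := by
      rw [pow_succ', Module.End.mul_apply, diff_apply, diff_apply, map_sub]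
    have hx : ∀ z : FreeAlgebra F (Fin d), diff F i (FreeAlgebra.ι F i * z) =
        FreeAlgebra.ι F i * diff F i z + shift F i z := by
      intro z
      simp only [diff_apply, map_mul, shift_ι_self]
      noncomm_ring
    rw [hc, hx, ← Module.End.mul_apply, ← pow_succ', add_assoc, succ_nsmul' _ (k + 1)]

/-- Difference operators are locally nilpotent. -/
lemma exists_diff_pow_eq_zero (i : Fin d) (y : FreeAlgebra F (Fin d)) :
    ∃ N, (diff F i ^ N) y = 0 := by
  have mono : ∀ (y : FreeAlgebra F (Fin d)) (N M : ℕ), N ≤ M → (diff F i ^ N) y = 0 →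
      (diff F i ^ M) y = 0 := by
    intro y N M h hN
    obtain ⟨k, rfl⟩ := Nat.exists_eq_add_of_le' h
    rw [pow_add, Module.End.mul_apply, hN, map_zero]
  have hw : ∀ w : List (Fin d), ∃ N, (diff F i ^ N) (word F w) = 0 := by
    intro w
    induction w with
    | nil => exact ⟨1, by simp [diff_apply]⟩
    | cons j w ih =>
      obtain ⟨N, hN⟩ := ih
      by_cases h : j = i
      · subst h
        refine ⟨N + 1, ?_⟩
        rw [word_cons, diff_iterate_ι_mul, mono _ N (N + 1) (by omega) hN, hN]
        simp
      · refine ⟨N, ?_⟩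
        have hc : ∀ k : ℕ, (diff F i ^ k) (FreeAlgebra.ι F j * word F w) =
            FreeAlgebra.ι F j * (diff F i ^ k) (word F w) := by
          intro k
          induction k with
          | zero => simp
          | succ k ih =>
            rw [pow_succ', Module.End.mul_apply, ih, Module.End.mul_apply, diff_apply, diff_apply,
              map_mul, shift_ι_of_ne h, mul_sub]
        rw [word_cons, hc, hN, mul_zero]
  have hmem : y ∈ Submodule.span F (Set.range (word F (σ := Fin d))) := by
    have := (FreeAlgebra.basisFreeMonoid F (Fin d)).mem_span y
    refine Submodule.span_mono ?_ this
    rintro _ ⟨w, rfl⟩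
    exact ⟨w.toList, (basisFreeMonoid_apply w.toList).symm⟩
  induction hmem using Submodule.span_induction with
  | mem x hx =>
    obtain ⟨w, rfl⟩ := hx
    exact hw w
  | zero => exact ⟨0, by simp⟩
  | add x y _ _ hx hy =>
    obtain ⟨N, hN⟩ := hx
    obtain ⟨M, hM⟩ := hy
    exact ⟨max N M, by rw [map_add, mono x N _ (le_max_left _ _) hN,
      mono y M _ (le_max_right _ _) hM, add_zero]⟩
  | smul r x _ hx =>
    obtain ⟨N, hN⟩ := hx
    exact ⟨N, by rw [map_smul, hN, smul_zero]⟩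

/-- The freeness over the proper polynomials, one variable at a time: an identity `x_i y + z`, with
`z` invariant under `x_i ↦ x_i + 1`, splits. The difference operator is locally nilpotent, so some
power of it turns `x_i y + z` into a non-zero multiple of a shift of the last non-zero difference
of `y`;
descending from there, all the differences of `y` are identities, and finally `y` itself. -/
lemma mem_identities_of_ι_mul_add [CharZero F] (i : Fin d) {y z : FreeAlgebra F (Fin d)}
    (hz : shift F i z = z)
    (h : FreeAlgebra.ι F i * y + z ∈ identities F A (Fin d)) : y ∈ identities F A (Fin d) := by
  set T := identities F A (Fin d) with hT
  have hdiff : ∀ u ∈ T, diff F i u ∈ T := fun u hu => sub_mem (map_mem_identities hu _) hu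
  have hpow : ∀ (k : ℕ) (u), u ∈ T → (diff F i ^ k) u ∈ T := by
    intro k
    induction k with
    | zero => intro u hu; simpa using hu
    | succ k ih =>
      intro u hu
      rw [pow_succ', Module.End.mul_apply]
      exact hdiff _ (ih u hu)
  obtain ⟨N, hN⟩ := exists_diff_pow_eq_zero i y
  -- descend from `Δ^N y = 0` to `y` itself
  have key : ∀ k ≤ N, (diff F i ^ (N - k)) y ∈ T := by
    intro k
    induction k with
    | zero => intro _; simp [hN]
    | succ k ih =>
      intro hk
      have h1 := ih (by omega)
      obtain ⟨r, hr⟩ : ∃ r, N - k = r + 1 := ⟨N - k - 1, by omega⟩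
      rw [show N - (k + 1) = r by omega]
      rw [hr] at h1
      have h2 := hpow (r + 1) _ h
      have hz0 : (diff F i ^ (r + 1)) z = 0 := by
        rw [pow_succ, Module.End.mul_apply, diff_apply, hz, sub_self, map_zero]
      rw [map_add, hz0, add_zero, diff_iterate_ι_mul] at h2
      have h3 := (Submodule.add_mem_iff_right _ (mul_mem_identities_left h1 _)).1 h2
      have h4 : shift F i ((diff F i ^ r) y) ∈ T := by
        rw [← Nat.cast_smul_eq_nsmul F] at h3
        exact (Submodule.smul_mem_iff _ (Nat.cast_ne_zero.2 r.succ_ne_zero)).1 h3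
      rw [pow_succ', Module.End.mul_apply, diff_apply] at h1
      simpa using sub_mem h4 h1
  simpa using key N le_rfl

/-- The dimensions of the spaces `ordSub` modulo `T(A)`, as a series. -/
def ordSeries (F : Type*) [Field F] {d : ℕ} (A : Type*) [Ring A] [Algebra F A]
    (l : List (Fin d)) : MvPowerSeries (Fin d) ℤ :=
  fun n => (Module.finrank F ((ordSub F l n).map (identities F A (Fin d)).mkQ) : ℤ)

instance finite_ordSub (l : List (Fin d)) (n : Fin d →₀ ℕ) : Module.Finite F (ordSub F l n) :=
  Submodule.finiteDimensional_of_le (ordSub_le_multiHom l n)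

/-- Modulo `T(A)` the sum of `x_i • ordSub (i :: l)` and `ordSub l` is direct. -/
lemma finrank_ordSub_cons [CharZero F] {i : Fin d} {l : List (Fin d)} (hi : i ∉ l)
    (n : Fin d →₀ ℕ) :
    Module.finrank F ((ordSub F (i :: l) (n + Finsupp.single i 1)).map
        (identities F A (Fin d)).mkQ) =
      Module.finrank F ((ordSub F (i :: l) n).map (identities F A (Fin d)).mkQ) +
      Module.finrank F ((ordSub F l (n + Finsupp.single i 1)).map
        (identities F A (Fin d)).mkQ) := by
  set T := identities F A (Fin d)
  set S := (ordSub F (i :: l) n).prod (ordSub F l (n + Finsupp.single i 1))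
  have h1 : (ordSub F (i :: l) (n + Finsupp.single i 1)).map T.mkQ =
      S.map (T.mkQ ∘ₗ (LinearMap.mulLeft F (FreeAlgebra.ι F i)).coprod LinearMap.id) := by
    rw [Submodule.map_comp, LinearMap.map_coprod_prod, ordSub_cons_add_single, Submodule.map_id]
  rw [h1, finrank_map_eq_of_ker_eq S _ (T.mkQ.prodMap T.mkQ)]
  · rw [← Module.finrank_prod]
    apply LinearEquiv.finrank_eq
    have : S.map (T.mkQ.prodMap T.mkQ) = ((ordSub F (i :: l) n).map T.mkQ).prod
        ((ordSub F l (n + Finsupp.single i 1)).map T.mkQ) := by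
      ext ⟨a, b⟩
      simp only [S, Submodule.mem_map, Submodule.mem_prod, Prod.exists, LinearMap.prodMap_apply,
        Prod.mk.injEq]
      constructor
      · rintro ⟨x, y, ⟨hx, hy⟩, rfl, rfl⟩
        exact ⟨⟨x, hx, rfl⟩, ⟨y, hy, rfl⟩⟩
      · rintro ⟨⟨x, hx, rfl⟩, ⟨y, hy, rfl⟩⟩
        exact ⟨x, y, ⟨hx, hy⟩, rfl, rfl⟩
    rw [this]
    exact
      { toFun := fun x => (⟨x.1.1, x.2.1⟩, ⟨x.1.2, x.2.2⟩)
        invFun := fun x => ⟨(x.1.1, x.2.1), x.1.2, x.2.2⟩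
        map_add' := fun _ _ => rfl
        map_smul' := fun _ _ => rfl
        left_inv := fun _ => rfl
        right_inv := fun _ => rfl }
  · rintro ⟨y, z⟩ ⟨hy, hz⟩
    simp only [LinearMap.comp_apply, LinearMap.coprod_apply, LinearMap.mulLeft_apply,
      LinearMap.id_apply, Submodule.mkQ_apply, Submodule.Quotient.mk_eq_zero,
      LinearMap.prodMap_apply, Prod.mk_eq_zero]
    constructor
    · intro h
      have hyT := mem_identities_of_ι_mul_add i (shift_ordSub hi hz) h
      exact ⟨hyT, (Submodule.add_mem_iff_right _ (mul_mem_identities_left hyT _)).1 h⟩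
    · rintro ⟨h1, h2⟩
      exact add_mem (mul_mem_identities_left h1 _) h2

lemma one_sub_X_mul_ordSeries [CharZero F] {i : Fin d} {l : List (Fin d)} (hi : i ∉ l) :
    (1 - MvPowerSeries.X i) * ordSeries F A (i :: l) = ordSeries F A l := by
  classical
  ext n
  rw [sub_mul, one_mul, map_sub]
  have hX : MvPowerSeries.coeff n (MvPowerSeries.X i * ordSeries F A (i :: l)) =
      if Finsupp.single i 1 ≤ n then
        MvPowerSeries.coeff (n - Finsupp.single i 1) (ordSeries F A (i :: l)) else 0 := by
    rw [MvPowerSeries.X, MvPowerSeries.coeff_monomial_mul, one_mul]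
  rw [hX]
  split_ifs with h
  · obtain ⟨m, rfl⟩ := exists_add_of_le h
    rw [add_tsub_cancel_left, add_comm, sub_eq_iff_eq_add']
    change ((Module.finrank F _ : ℕ) : ℤ) = ((Module.finrank F _ : ℕ) : ℤ) +
      ((Module.finrank F _ : ℕ) : ℤ)
    exact_mod_cast finrank_ordSub_cons (A := A) hi m
  · rw [sub_zero]
    have h0 : n i = 0 := by
      by_contra h0
      exact h (by simpa using Nat.one_le_iff_ne_zero.2 h0)
    change ((Module.finrank F _ : ℕ) : ℤ) = ((Module.finrank F _ : ℕ) : ℤ)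
    rw [ordSub_cons_of_eq_zero l h0]

/-- The free algebra modulo `T(A)` is a polynomial algebra over its proper part, as far as Hilbert
series go. -/
theorem prod_one_sub_X_mul_hilbSeries [CharZero F] :
    (∏ i : Fin d, (1 - MvPowerSeries.X i)) * hilbSeries F d A = properHilbert F A d := by
  have key : ∀ l : List (Fin d), l.Nodup →
      (l.map fun i => (1 - MvPowerSeries.X i : MvPowerSeries (Fin d) ℤ)).prod *
        ordSeries F A l = ordSeries F A [] := by
    intro l hl
    induction l with
    | nil => simp
    | cons i l ih =>
      rw [List.nodup_cons] at hl
      rw [List.map_cons, List.prod_cons, mul_comm (1 - MvPowerSeries.X i), mul_assoc,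
        one_sub_X_mul_ordSeries hl.1, ih hl.2]
  have h1 : ordSeries F A (List.finRange d) = hilbSeries F d A := by
    funext n
    simp only [ordSeries, hilbSeries, hilb]
    rw [ordSub_finRange]
  have h2 : ordSeries F A ([] : List (Fin d)) = properHilbert F A d := by
    ext n
    rw [coeff_properHilbert]
    rfl
  rw [← h2, ← key _ (List.nodup_finRange d), h1, ← List.ofFn_eq_map, List.prod_ofFn]

end Proper

/-! ### Linear algebra -/

section LinAlg

open scoped TensorProduct

variable {F : Type*} [Field F]

/-- A linear map over a field has a generalized inverse. -/
lemma exists_generalized_inverse {M N : Type*} [AddCommGroup M] [Module F M] [AddCommGroup N]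
    [Module F N] (f : M →ₗ[F] N) : ∃ g : N →ₗ[F] M, ∀ x, f (g (f x)) = f x := by
  obtain ⟨h, hh⟩ := f.rangeRestrict.exists_rightInverse_of_surjective f.range_rangeRestrict
  obtain ⟨g, hg⟩ := h.exists_extend
  refine ⟨g, fun x => ?_⟩
  have h1 : g (f x) = h ⟨f x, x, rfl⟩ := LinearMap.congr_fun hg ⟨f x, x, rfl⟩
  have h2 := LinearMap.congr_fun hh ⟨f x, x, rfl⟩
  rw [h1]
  exact congrArg Subtype.val h2

/-- Eigenvectors for distinct eigenvalues with zero sum vanish. -/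
lemma eq_zero_of_sum_eigenvectors {M ι : Type*} [AddCommGroup M] [Module F M] (T : M →ₗ[F] M)
    (S : Finset ι) (c : ι → F) (hc : Set.InjOn c S) (X : ι → M)
    (hX : ∀ a ∈ S, T (X a) = c a • X a) (h0 : ∑ a ∈ S, X a = 0) : ∀ a ∈ S, X a = 0 := by
  classical
  induction S using Finset.induction_on generalizing X with
  | empty => simp
  | insert b S hb ih =>
    rw [Finset.sum_insert hb] at h0
    have h1 : ∑ a ∈ S, (c a - c b) • X a = 0 := by
      have hT := congrArg T h0
      rw [map_add, map_sum, map_zero, hX b (Finset.mem_insert_self _ _),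
        Finset.sum_congr rfl fun a ha => hX a (Finset.mem_insert_of_mem ha)] at hT
      have h2 : c b • X b = -∑ a ∈ S, c b • X a := by
        rw [← Finset.smul_sum, ← smul_neg, eq_neg_of_add_eq_zero_left h0]
      rw [h2] at hT
      simp only [sub_smul, Finset.sum_sub_distrib]
      rw [sub_eq_add_neg, add_comm]
      exact hT
    have hS : ∀ a ∈ S, X a = 0 := by
      intro a ha
      have h3 := ih (hc.mono (by simp)) (fun a => (c a - c b) • X a) (fun a ha => by
        rw [map_smul, hX a (Finset.mem_insert_of_mem ha), smul_comm]) h1 a ha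
      refine (smul_eq_zero.1 h3).resolve_left fun h => hb ?_
      rw [sub_eq_zero] at h
      rwa [← hc (Finset.mem_insert_of_mem ha) (Finset.mem_insert_self _ _) h]
    intro a ha
    rcases Finset.mem_insert.1 ha with rfl | ha
    · rwa [Finset.sum_eq_zero hS, add_zero] at h0
    · exact hS a ha

/-- A tensor killed by all `id ⊗ λ`, for a separating family of functionals `λ`, is zero. -/
lemma tensor_eq_zero_of_lTensor {M N κ : Type*} [AddCommGroup M] [Module F M] [AddCommGroup N]
    [Module F N] (l : κ → N →ₗ[F] F) (hl : ∀ y, (∀ k, l k y = 0) → y = 0) (t : M ⊗[F] N)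
    (ht : ∀ k, TensorProduct.rid F M ((l k).lTensor M t) = 0) : t = 0 := by
  classical
  let b := Module.Basis.ofVectorSpace F M
  let e := TensorProduct.equivFinsuppOfBasisLeft (N := N) b
  apply e.injective
  rw [map_zero]
  ext i
  apply hl
  intro k
  have key : ∀ t : M ⊗[F] N,
      l k (e t i) = b.repr (TensorProduct.rid F M ((l k).lTensor M t)) i := by
    intro t
    induction t with
    | zero => simp
    | add x y hx hy => simp [hx, hy]
    | tmul x y => simp [e, mul_comm]
  rw [key, ht k]
  simp

/-- The tensor square of a function algebra embeds into functions of two variables. -/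
lemma tensor_pi_eq_zero {κ A : Type*} [AddCommGroup A] [Module F A]
    (t : (κ → A) ⊗[F] (κ → A))
    (ht : ∀ k k', TensorProduct.map (LinearMap.proj (R := F) (φ := fun _ : κ => A) k)
      (LinearMap.proj (R := F) (φ := fun _ : κ => A) k') t = 0) : t = 0 := by
  refine tensor_eq_zero_of_lTensor
    (fun (p : κ × Module.Dual F A) => p.2 ∘ₗ LinearMap.proj (R := F) (φ := fun _ : κ => A) p.1)
    ?_ t ?_
  · intro y hy
    funext k
    exact (Module.forall_dual_apply_eq_zero_iff F _).1 fun l => hy (k, l)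
  · rintro ⟨k', l⟩
    funext k
    have key : ∀ t : (κ → A) ⊗[F] (κ → A),
        TensorProduct.rid F (κ → A) ((l ∘ₗ LinearMap.proj (R := F)
          (φ := fun _ : κ => A) k').lTensor (κ → A) t) k =
        TensorProduct.rid F A (l.lTensor A (TensorProduct.map
          (LinearMap.proj (R := F) (φ := fun _ : κ => A) k)
          (LinearMap.proj (R := F) (φ := fun _ : κ => A) k') t)) := by
      intro t
      induction t with
      | zero => simp
      | add x y hx hy => simp only [map_add, Pi.add_apply, hx, hy]
      | tmul x y => simp
    dsimp only
    rw [key, ht]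
    simp

end LinAlg

/-! ### Cutting words -/

section Cut

open scoped TensorProduct

variable (F : Type*) [Field F] (A : Type*) [Ring A] [Algebra F A] (d : ℕ)

/-- The algebra of functions on the set of all homomorphisms `F⟨x_1, …, x_d⟩ → A`. The image of
the free algebra under evaluation is `F⟨x_1, …, x_d⟩ / T(A)`. -/
abbrev EvalTarget : Type _ := (FreeAlgebra F (Fin d) →ₐ[F] A) → A

/-- The simultaneous evaluation at all homomorphisms `F⟨x_1, …, x_d⟩ → A`. -/
def evalAll : FreeAlgebra F (Fin d) →ₐ[F] EvalTarget F A d :=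
  AlgHom.pi fun φ => φ

variable {F d}

@[simp] lemma evalAll_apply (f : FreeAlgebra F (Fin d)) (φ : FreeAlgebra F (Fin d) →ₐ[F] A) :
    evalAll F A d f φ = φ f := rfl

variable {A} in
lemma evalAll_eq_zero {f : FreeAlgebra F (Fin d)} :
    evalAll F A d f = 0 ↔ f ∈ identities F A (Fin d) := by
  rw [mem_identities, funext_iff]
  rfl

lemma hilb_eq (n : Fin d →₀ ℕ) :
    hilb F A n = Module.finrank F ((multiHom F d n).map (evalAll F A d).toLinearMap) := by
  unfold hilb
  apply finrank_map_eq_of_ker_eq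
  intro x _
  rw [Submodule.mkQ_apply, Submodule.Quotient.mk_eq_zero, AlgHom.toLinearMap_apply,
    evalAll_eq_zero]

lemma hilb_zero [Nontrivial A] : hilb F A (0 : Fin d →₀ ℕ) = 1 := by
  rw [hilb_eq, multiHom_eq]
  have h : {w : List (Fin d) | content w = 0} = {[]} := by
    ext w
    simp only [Set.mem_ofPred_eq, Set.mem_singleton_iff]
    constructor
    · intro h
      have := sum_content w
      rw [h] at this
      exact List.length_eq_zero_iff.1 (by simpa using this.symm)
    · rintro rfl
      simp
  rw [h, Set.image_singleton, word_nil, Submodule.map_span, Set.image_singleton,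
    finrank_span_singleton]
  rw [AlgHom.toLinearMap_apply, map_one]
  intro h1
  have := congrFun h1 (FreeAlgebra.lift F fun _ => 0)
  exact one_ne_zero this

/-- The map sending a word `w = u v`, with `u` of length `p` and of multidegree `a`, to `u ⊗ v`,
and the other words to zero. -/
def cut (p : ℕ) (a : Fin d →₀ ℕ) :
    FreeAlgebra F (Fin d) →ₗ[F] EvalTarget F A d ⊗[F] EvalTarget F A d :=
  open Classical in
  onWords fun w => if content (w.take p) = a then
    evalAll F A d (word F (w.take p)) ⊗ₜ evalAll F A d (word F (w.drop p)) else 0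

/-- The map sending a word `w = u x_i v`, with `u` of length `p` and of multidegree `a`, to
`u ⊗ v`, and the other words to zero. -/
def mark (p : ℕ) (i : Fin d) (a : Fin d →₀ ℕ) :
    FreeAlgebra F (Fin d) →ₗ[F] EvalTarget F A d ⊗[F] EvalTarget F A d :=
  open Classical in
  onWords fun w => if w[p]? = some i ∧ content (w.take p) = a then
    evalAll F A d (word F (w.take p)) ⊗ₜ evalAll F A d (word F (w.drop (p + 1))) else 0

open Classical in
lemma cut_word (p : ℕ) (a : Fin d →₀ ℕ) (w : List (Fin d)) :
    cut A p a (word F w) = if content (w.take p) = a then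
      evalAll F A d (word F (w.take p)) ⊗ₜ evalAll F A d (word F (w.drop p)) else 0 := by
  rw [cut, onWords_word]

open Classical in
lemma mark_word (p : ℕ) (i : Fin d) (a : Fin d →₀ ℕ) (w : List (Fin d)) :
    mark A p i a (word F w) = if w[p]? = some i ∧ content (w.take p) = a then
      evalAll F A d (word F (w.take p)) ⊗ₜ evalAll F A d (word F (w.drop (p + 1))) else 0 := by
  rw [mark, onWords_word]

lemma eq_take_cons_drop {α : Type*} {w : List α} {p : ℕ} {i : α} (h : w[p]? = some i) :
    w = w.take p ++ i :: w.drop (p + 1) := by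
  obtain ⟨hp, rfl⟩ := List.getElem?_eq_some_iff.1 h
  simp

lemma content_eq_of_getElem? {w : List (Fin d)} {p : ℕ} {i : Fin d} (h : w[p]? = some i) :
    content w = content (w.take p) + Finsupp.single i 1 + content (w.drop (p + 1)) := by
  conv_lhs => rw [eq_take_cons_drop h]
  rw [content_append, content_cons, add_assoc]

/-- The common kernel of the maps `cut p a` in multidegree `n`. -/
def cutKer (F : Type*) [Field F] (A : Type*) [Ring A] [Algebra F A] {d : ℕ} (n : Fin d →₀ ℕ)
    (p : ℕ) : Submodule F (FreeAlgebra F (Fin d)) :=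
  multiHom F d n ⊓ ⨅ a, LinearMap.ker (cut A p a)

/-- The common kernel of the maps `mark p i a` in multidegree `n`. -/
def markKer (F : Type*) [Field F] (A : Type*) [Ring A] [Algebra F A] {d : ℕ} (n : Fin d →₀ ℕ)
    (p : ℕ) : Submodule F (FreeAlgebra F (Fin d)) :=
  multiHom F d n ⊓ ⨅ i, ⨅ a, LinearMap.ker (mark A p i a)

/-- The common kernel of the maps `mark q i a`, `q < p`, in multidegree `n`. -/
def markKerLT (F : Type*) [Field F] (A : Type*) [Ring A] [Algebra F A] {d : ℕ} (n : Fin d →₀ ℕ)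
    (p : ℕ) : Submodule F (FreeAlgebra F (Fin d)) :=
  multiHom F d n ⊓ ⨅ q, ⨅ _ : q < p, ⨅ i, ⨅ a, LinearMap.ker (mark A q i a)

variable {A}

lemma mem_cutKer {n : Fin d →₀ ℕ} {p : ℕ} {f : FreeAlgebra F (Fin d)} :
    f ∈ cutKer F A n p ↔ f ∈ multiHom F d n ∧ ∀ a, cut A p a f = 0 := by
  simp [cutKer, Submodule.mem_iInf]

lemma mem_markKer {n : Fin d →₀ ℕ} {p : ℕ} {f : FreeAlgebra F (Fin d)} :
    f ∈ markKer F A n p ↔ f ∈ multiHom F d n ∧ ∀ i a, mark A p i a f = 0 := by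
  simp [markKer, Submodule.mem_iInf]

lemma mem_markKerLT {n : Fin d →₀ ℕ} {p : ℕ} {f : FreeAlgebra F (Fin d)} :
    f ∈ markKerLT F A n p ↔ f ∈ multiHom F d n ∧ ∀ q < p, ∀ i a, mark A q i a f = 0 := by
  simp [markKerLT, Submodule.mem_iInf]

lemma markKerLT_succ (n : Fin d →₀ ℕ) (p : ℕ) :
    markKerLT F A n (p + 1) = markKerLT F A n p ⊓ markKer F A n p := by
  ext f
  simp only [mem_markKerLT, mem_markKer, Submodule.mem_inf]
  constructor
  · rintro ⟨h1, h2⟩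
    exact ⟨⟨h1, fun q hq => h2 q (by omega)⟩, h1, h2 p (by omega)⟩
  · rintro ⟨⟨h1, h2⟩, -, h3⟩
    refine ⟨h1, fun q hq => ?_⟩
    rcases Nat.lt_succ_iff_lt_or_eq.1 hq with h | rfl
    · exact h2 q h
    · exact h3

lemma length_eq_of_content {n : Fin d →₀ ℕ} {w : List (Fin d)} (h : content w = n) :
    w.length = ∑ i, n i := by
  rw [← sum_content, h]

/-- Multiplying the second factor by the marked letter turns marking at `p` into cutting at `p`. -/
lemma markKer_le_cutKer {n : Fin d →₀ ℕ} {p : ℕ} (hp : p < ∑ i, n i) :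
    markKer F A n p ≤ cutKer F A n p := by
  classical
  intro f hf
  rw [mem_markKer] at hf
  rw [mem_cutKer]
  refine ⟨hf.1, fun a => ?_⟩
  have key : cut A p a f = (∑ i, (LinearMap.mulLeft F
      (evalAll F A d (FreeAlgebra.ι F i))).lTensor _ ∘ₗ mark A p i a) f := by
    refine multiHom_eqOn ?_ hf.1
    intro w hw
    have hl := length_eq_of_content hw
    obtain ⟨i, hi⟩ : ∃ i, w[p]? = some i := ⟨_, List.getElem?_eq_getElem (by omega)⟩
    simp only [LinearMap.sum_apply, LinearMap.comp_apply, cut_word, mark_word, hi,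
      Option.some.injEq]
    rw [Finset.sum_eq_single i]
    · simp only [true_and]
      split_ifs with h
      · have : w.drop p = i :: w.drop (p + 1) := by
          obtain ⟨hp, rfl⟩ := List.getElem?_eq_some_iff.1 hi
          simp
        simp [this]
      · simp
    · intro j _ hj
      simp [Ne.symm hj]
    · simp
  rw [key]
  simp [hf.2]

lemma markKer_le_cutKer_succ {n : Fin d →₀ ℕ} {p : ℕ} (hp : p < ∑ i, n i) :
    markKer F A n p ≤ cutKer F A n (p + 1) := by
  classical
  intro f hf
  rw [mem_markKer] at hf
  rw [mem_cutKer]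
  refine ⟨hf.1, fun a => ?_⟩
  have key : cut A (p + 1) a f = (∑ i, if Finsupp.single i 1 ≤ a then (LinearMap.mulRight F
      (evalAll F A d (FreeAlgebra.ι F i))).rTensor _ ∘ₗ mark A p i (a - Finsupp.single i 1)
      else 0) f := by
    refine multiHom_eqOn ?_ hf.1
    intro w hw
    have hl := length_eq_of_content hw
    obtain ⟨i, hi⟩ : ∃ i, w[p]? = some i := ⟨_, List.getElem?_eq_getElem (by omega)⟩
    have ht : w.take (p + 1) = w.take p ++ [i] := by
      obtain ⟨hp, rfl⟩ := List.getElem?_eq_some_iff.1 hi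
      simp
    rw [LinearMap.sum_apply, Finset.sum_eq_single i]
    · have hc : content (w.take (p + 1)) = content (w.take p) + Finsupp.single i 1 := by
        rw [ht, content_append, content_cons, content_nil, add_zero]
      rw [cut_word, hc]
      split_ifs with h1 h2 h2
      · have h3 : content (w.take p) = a - Finsupp.single i 1 := by
          rw [← h1, add_tsub_cancel_right]
        rw [LinearMap.comp_apply, mark_word, if_pos ⟨hi, h3⟩, ht]
        simp [word_append]
      · exact absurd (h1 ▸ le_add_self) h2
      · rw [LinearMap.comp_apply, mark_word, if_neg, map_zero]
        rintro ⟨-, h3⟩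
        exact h1 (by rw [h3, tsub_add_cancel_of_le h2])
      · simp
    · intro j _ hj
      split_ifs
      · simp [mark_word, hi, Ne.symm hj]
      · simp
    · simp
  rw [key, LinearMap.sum_apply]
  refine Finset.sum_eq_zero fun i _ => ?_
  split_ifs
  · simp [hf.2]
  · simp

lemma mark_word_mul_of_lt {q : ℕ} {u : List (Fin d)} (hq : q < u.length) (i : Fin d)
    (a : Fin d →₀ ℕ) {y y' : FreeAlgebra F (Fin d)} (h : evalAll F A d y = evalAll F A d y') :
    mark A q i a (word F u * y) = mark A q i a (word F u * y') := by
  classical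
  have key : mark A q i a ∘ₗ LinearMap.mulLeft F (word F u) =
      if u[q]? = some i ∧ content (u.take q) = a then
        TensorProduct.mk F _ _ (evalAll F A d (word F (u.take q))) ∘ₗ
          LinearMap.mulLeft F (evalAll F A d (word F (u.drop (q + 1)))) ∘ₗ
            (evalAll F A d).toLinearMap
      else 0 := by
    apply word_ext
    intro v
    rw [LinearMap.comp_apply, LinearMap.mulLeft_apply, ← word_append, mark_word,
      List.getElem?_append_left hq, List.take_append_of_le_length hq.le,
      List.drop_append_of_le_length (by omega : q + 1 ≤ u.length), word_append, map_mul]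
    split_ifs <;> simp
  have h1 := LinearMap.congr_fun key y
  have h2 := LinearMap.congr_fun key y'
  simp only [LinearMap.comp_apply, LinearMap.mulLeft_apply] at h1 h2
  rw [h1, h2]
  split_ifs <;> simp [h]

/-- The map sending a word `x_i v` to `v` and the other words to zero. -/
def headCut (F : Type*) [Field F] (A : Type*) [Ring A] [Algebra F A] {d : ℕ} (i : Fin d) :
    FreeAlgebra F (Fin d) →ₗ[F] EvalTarget F A d :=
  onWords fun w => if w[0]? = some i then evalAll F A d (word F (w.drop 1)) else 0

open Classical in
lemma mark_word_mul_length (u : List (Fin d)) (i : Fin d) (a : Fin d →₀ ℕ)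
    (y : FreeAlgebra F (Fin d)) :
    mark A u.length i a (word F u * y) =
      if content u = a then evalAll F A d (word F u) ⊗ₜ headCut F A i y else 0 := by
  have key : mark A u.length i a ∘ₗ LinearMap.mulLeft F (word F u) =
      if content u = a then
        TensorProduct.mk F _ _ (evalAll F A d (word F u)) ∘ₗ headCut F A i else 0 := by
    apply word_ext
    intro v
    rw [LinearMap.comp_apply, LinearMap.mulLeft_apply, ← word_append, mark_word]
    by_cases h : content u = a
    · have e1 : (u ++ v)[u.length]? = v[0]? := by simp [List.getElem?_append_right]
      have e2 : (u ++ v).drop (u.length + 1) = v.drop 1 := by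
        simp [List.drop_append]
      rw [e1, e2, List.take_left, if_pos h]
      by_cases h2 : v[0]? = some i
      · rw [if_pos ⟨h2, h⟩, LinearMap.comp_apply, headCut, onWords_word, if_pos h2]
        rfl
      · rw [if_neg fun h' => h2 h'.1, LinearMap.comp_apply, headCut, onWords_word, if_neg h2,
          map_zero]
    · simp [h]
  have h1 := LinearMap.congr_fun key y
  simp only [LinearMap.comp_apply, LinearMap.mulLeft_apply] at h1
  rw [h1]
  split_ifs <;> simp

/-- A polynomial killed by cutting at `p` splits into one killed by marking before `p` and one
killed by marking at `p`: replace the part after the cut by its normal form modulo `T(A)`. -/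
lemma cutKer_le {n : Fin d →₀ ℕ} {p : ℕ} (hp : p ≤ ∑ i, n i) :
    cutKer F A n p ≤ markKerLT F A n p ⊔ markKer F A n p := by
  classical
  have hg : ∀ b : Fin d →₀ ℕ, ∃ g : EvalTarget F A d →ₗ[F] FreeAlgebra F (Fin d),
      (∀ x, g x ∈ multiHom F d b) ∧
      ∀ y ∈ multiHom F d b, evalAll F A d (g (evalAll F A d y)) = evalAll F A d y := by
    intro b
    obtain ⟨g, hg⟩ := exists_generalized_inverse
      ((evalAll F A d).toLinearMap ∘ₗ (multiHom F d b).subtype)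
    exact ⟨(multiHom F d b).subtype ∘ₗ g, fun x => (g x).2, fun y hy => hg ⟨y, hy⟩⟩
  choose g hg1 hg2 using hg
  -- `R` replaces the second half of a word by the chosen representative of its class modulo `T(A)`
  let R : FreeAlgebra F (Fin d) →ₗ[F] FreeAlgebra F (Fin d) := onWords fun w =>
    word F (w.take p) * g (n - content (w.take p)) (evalAll F A d (word F (w.drop p)))
  have hRw : ∀ w, R (word F w) =
    word F (w.take p) * g (n - content (w.take p)) (evalAll F A d (word F (w.drop p))) :=
    fun w => onWords_word _ _
  have hsplit : ∀ w : List (Fin d), content w = n →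
      content (w.take p) + content (w.drop p) = n := by
    intro w hw
    rw [← content_append, List.take_append_drop, hw]
  have hlen : ∀ w : List (Fin d), content w = n → (w.take p).length = p := by
    intro w hw
    rw [List.length_take, length_eq_of_content hw]
    omega
  have hdrop : ∀ w : List (Fin d), content w = n →
      content (w.drop p) = n - content (w.take p) := by
    intro w hw
    rw [← hsplit w hw, add_tsub_cancel_left]
  intro f hf
  rw [mem_cutKer] at hf
  have hR : R f ∈ multiHom F d n := by
    refine map_multiHom_le ?_ hf.1
    intro w hw
    rw [hRw]
    have h := mul_mem_multiHom (word_mem_multiHom (F := F) (w.take p))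
      (hg1 (n - content (w.take p)) (evalAll F A d (word F (w.drop p))))
    rwa [← hdrop w hw, hsplit w hw, hdrop w hw] at h
  rw [← sub_add_cancel f (R f)]
  refine Submodule.add_mem_sup ?_ ?_
  · rw [mem_markKerLT]
    refine ⟨sub_mem hf.1 hR, fun q hq i a => ?_⟩
    rw [map_sub, sub_eq_zero, ← LinearMap.comp_apply]
    refine multiHom_eqOn ?_ hf.1
    intro w hw
    rw [LinearMap.comp_apply, hRw]
    conv_lhs => rw [← List.take_append_drop p w, word_append]
    refine mark_word_mul_of_lt (by rw [hlen w hw]; exact hq) i a ?_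
    rw [hg2]
    exact word_mem_multiHom_of_eq (hdrop w hw)
  · rw [mem_markKer]
    refine ⟨hR, fun i a => ?_⟩
    -- a marked letter right at the cut is read off from the representative of the second half
    have key : (mark A p i a ∘ₗ R) f =
        ((headCut F A i ∘ₗ g (n - a)).lTensor _ ∘ₗ cut A p a) f := by
      refine multiHom_eqOn ?_ hf.1
      intro w hw
      have h := mark_word_mul_length (A := A) (w.take p) i a
        (g (n - content (w.take p)) (evalAll F A d (word F (w.drop p))))
      rw [hlen w hw] at h
      rw [LinearMap.comp_apply, hRw, h, LinearMap.comp_apply, cut_word]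
      split_ifs with h1
      · simp [h1]
      · simp
    rw [LinearMap.comp_apply] at key
    rw [key, LinearMap.comp_apply, hf.2, map_zero]

lemma markKerLT_sup_markKer {n : Fin d →₀ ℕ} {p : ℕ} (h0 : 0 < p) (hp : p < ∑ i, n i) :
    markKerLT F A n p ⊔ markKer F A n p = cutKer F A n p := by
  refine le_antisymm (sup_le ?_ (markKer_le_cutKer hp)) (cutKer_le hp.le)
  obtain ⟨q, rfl⟩ := Nat.exists_eq_succ_of_ne_zero h0.ne'
  rw [Nat.succ_eq_add_one, markKerLT_succ]
  exact inf_le_right.trans (markKer_le_cutKer_succ (by omega))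

instance finite_markKer (n : Fin d →₀ ℕ) (p : ℕ) : Module.Finite F (markKer F A n p) :=
  Submodule.finiteDimensional_of_le (inf_le_left : _ ≤ multiHom F d n)

instance finite_markKerLT (n : Fin d →₀ ℕ) (p : ℕ) : Module.Finite F (markKerLT F A n p) :=
  Submodule.finiteDimensional_of_le (inf_le_left : _ ≤ multiHom F d n)

/-- Inclusion and exclusion: the intersection of `markKerLT p` and `markKer p` is the next
`markKerLT`, and their sum is `cutKer p`. -/
lemma finrank_markKerLT {n : Fin d →₀ ℕ} {p : ℕ} (hp : p < ∑ i, n i) :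
    (Module.finrank F (markKerLT F A n (p + 1)) : ℤ) =
      ∑ q ∈ Finset.range (p + 1), (Module.finrank F (markKer F A n q) : ℤ) -
      ∑ q ∈ Finset.Ico 1 (p + 1), (Module.finrank F (cutKer F A n q) : ℤ) := by
  induction p with
  | zero =>
    have : markKerLT F A n (0 + 1) = markKer F A n 0 := by
      rw [markKerLT_succ, inf_eq_right]
      intro f hf
      rw [mem_markKer] at hf
      rw [mem_markKerLT]
      exact ⟨hf.1, fun q hq => absurd hq (Nat.not_lt_zero q)⟩
    rw [this]
    simp
  | succ p ih =>
    have h := Submodule.finrank_sup_add_finrank_inf_eq (markKerLT F A n (p + 1))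
      (markKer F A n (p + 1))
    rw [markKerLT_sup_markKer (by omega) hp, ← markKerLT_succ] at h
    rw [Finset.sum_range_succ, Finset.sum_Ico_succ_top (by omega)]
    have ih' := ih (by omega)
    have h' : (Module.finrank F (cutKer F A n (p + 1)) : ℤ) +
      Module.finrank F (markKerLT F A n (p + 1 + 1)) =
      Module.finrank F (markKerLT F A n (p + 1)) + Module.finrank F (markKer F A n (p + 1)) := by
        exact_mod_cast h
    linarith

/-- The rank of a family of maps that cut words of multidegree `n` into two pieces. -/
lemma finrank_map_pi {κ : Type*} [Fintype κ] [DecidableEq κ] {n : Fin d →₀ ℕ}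
    (a b : κ → Fin d →₀ ℕ)
    (g : κ → FreeAlgebra F (Fin d) →ₗ[F] EvalTarget F A d ⊗[F] EvalTarget F A d)
    (h1 : ∀ w, content w = n → ∃ k u v, content u = a k ∧ content v = b k ∧
      ∀ k', g k' (word F w) = if k' = k then
        evalAll F A d (word F u) ⊗ₜ evalAll F A d (word F v) else 0)
    (h2 : ∀ k u v, content u = a k → content v = b k → ∃ w, content w = n ∧
      ∀ k', g k' (word F w) = if k' = k then
        evalAll F A d (word F u) ⊗ₜ evalAll F A d (word F v) else 0) :
    Module.finrank F ((multiHom F d n).map (LinearMap.pi g)) =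
      ∑ k, hilb F A (a k) * hilb F A (b k) := by
  let Q : (Fin d →₀ ℕ) → Submodule F (EvalTarget F A d) :=
    fun a => (multiHom F d a).map (evalAll F A d).toLinearMap
  have hQ : ∀ w : List (Fin d), evalAll F A d (word F w) ∈ Q (content w) :=
    fun w => ⟨_, word_mem_multiHom w, rfl⟩
  let Φ : (∀ k, (Q (a k) ⊗[F] Q (b k))) →ₗ[F] κ → EvalTarget F A d ⊗[F] EvalTarget F A d :=
    LinearMap.pi fun k => TensorProduct.mapIncl (Q (a k)) (Q (b k)) ∘ₗ LinearMap.proj k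
  have hΦ : Function.Injective Φ := by
    intro x y hxy
    funext k
    have hk := congrFun hxy k
    refine Module.Flat.tensorProduct_mapIncl_injective_of_left _ _ ?_
    exact hk
  have hrange : (multiHom F d n).map (LinearMap.pi g) = LinearMap.range Φ := by
    apply le_antisymm
    · rintro _ ⟨f, hf, rfl⟩
      refine map_multiHom_le ?_ hf
      intro w hw
      obtain ⟨k, u, v, hu, hv, hk⟩ := h1 w hw
      refine ⟨Pi.single k ((⟨_, hu ▸ hQ u⟩ : Q (a k)) ⊗ₜ (⟨_, hv ▸ hQ v⟩ : Q (b k))), ?_⟩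
      funext k'
      refine Eq.trans ?_ (hk k').symm
      simp only [Φ, LinearMap.pi_apply, LinearMap.comp_apply, LinearMap.proj_apply]
      split_ifs with h
      · subst h
        simp [TensorProduct.mapIncl]
      · simp [h]
    · rintro _ ⟨t, rfl⟩
      have ht : t = ∑ k, Pi.single k (t k) := by
        funext k
        simp [Finset.sum_apply]
      rw [ht, map_sum]
      refine sum_mem fun k _ => ?_
      induction t k with
      | zero => simp
      | add x y hx hy =>
        rw [Pi.single_add, map_add]
        exact add_mem hx hy
      | tmul x y =>
        obtain ⟨_, x, hx, rfl⟩ := x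
        obtain ⟨_, y, hy, rfl⟩ := y
        have e : Φ (Pi.single k (⟨(evalAll F A d).toLinearMap x, x, hx, rfl⟩ ⊗ₜ
            ⟨(evalAll F A d).toLinearMap y, y, hy, rfl⟩)) =
            Pi.single k (evalAll F A d x ⊗ₜ evalAll F A d y) := by
          funext k'
          simp only [Φ, LinearMap.pi_apply, LinearMap.comp_apply, LinearMap.proj_apply]
          by_cases h : k' = k
          · subst h
            simp [TensorProduct.mapIncl]
          · simp [h]
        rw [e]
        let B := LinearMap.mk₂ F (fun x y : FreeAlgebra F (Fin d) =>
          (Pi.single k (evalAll F A d x ⊗ₜ evalAll F A d y) :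
            κ → EvalTarget F A d ⊗[F] EvalTarget F A d))
          (by intros; rw [map_add, TensorProduct.add_tmul, Pi.single_add])
          (by intros; rw [map_smul, ← TensorProduct.smul_tmul', Pi.single_smul])
          (by intros; rw [map_add, TensorProduct.tmul_add, Pi.single_add])
          (by intros; rw [map_smul, TensorProduct.tmul_smul, Pi.single_smul])
        refine map_multiHom_le (f := B.flip y) (fun u hu => ?_) hx
        refine map_multiHom_le (f := B (word F u)) (fun v hv => ?_) hy
        obtain ⟨w, hw, hk⟩ := h2 k u v hu hv
        refine ⟨word F w, word_mem_multiHom_of_eq hw, ?_⟩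
        funext k'
        rw [LinearMap.pi_apply, hk k']
        simp only [B, LinearMap.mk₂_apply, Pi.single_apply]
  rw [hrange, LinearMap.finrank_range_of_inj hΦ, Module.finrank_pi_fintype]
  refine Finset.sum_congr rfl fun k _ => ?_
  rw [Module.finrank_tensorProduct, hilb_eq, hilb_eq]

lemma finrank_map_add_finrank_ker {M : Type*} [AddCommGroup M] [Module F M] (n : Fin d →₀ ℕ)
    (f : FreeAlgebra F (Fin d) →ₗ[F] M) :
    Module.finrank F ((multiHom F d n).map f) +
      Module.finrank F ↥(multiHom F d n ⊓ LinearMap.ker f) =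
      Module.finrank F (multiHom F d n) := by
  have h := (f.domRestrict (multiHom F d n)).finrank_range_add_finrank_ker
  rw [LinearMap.range_domRestrict] at h
  rw [← h, LinearMap.ker_domRestrict, inf_comm, ← Submodule.finrank_map_subtype_eq,
    Submodule.map_comap_subtype, inf_comm]

open Classical in
lemma finrank_cutKer {n : Fin d →₀ ℕ} {p : ℕ} (hp : p ≤ ∑ i, n i) :
    ∑ x ∈ (Finset.HasAntidiagonal.antidiagonal n).filter (fun x => ∑ i, x.1 i = p),
        hilb F A x.1 * hilb F A x.2 +
      Module.finrank F (cutKer F A n p) = Module.finrank F (multiHom F d n) := by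
  set S := (Finset.HasAntidiagonal.antidiagonal n).filter (fun x => ∑ i, x.1 i = p) with hS
  have hmem : ∀ x, x ∈ S ↔ x.1 + x.2 = n ∧ ∑ i, x.1 i = p := by
    intro x
    simp [hS]
  have hker : cutKer F A n p =
      multiHom F d n ⊓ LinearMap.ker (LinearMap.pi fun k : S => cut (F := F) A p k.1.1) := by
    ext f
    rw [mem_cutKer, Submodule.mem_inf, LinearMap.mem_ker, funext_iff]
    refine and_congr_right fun hf => ⟨fun h k => h _, fun h a => ?_⟩
    by_cases ha : ∃ b, (a, b) ∈ S
    · obtain ⟨b, hb⟩ := ha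
      exact h ⟨(a, b), hb⟩
    · refine multiHom_eqOn (M := EvalTarget F A d ⊗[F] EvalTarget F A d) (g := 0) ?_ hf
      intro w hw
      rw [cut_word, if_neg, LinearMap.zero_apply]
      rintro rfl
      refine ha ⟨content (w.drop p), (hmem _).2 ⟨?_, ?_⟩⟩
      · rw [← content_append, List.take_append_drop, hw]
      · rw [sum_content, List.length_take, length_eq_of_content hw]
        omega
  rw [hker, ← finrank_map_add_finrank_ker n (LinearMap.pi fun k : S =>
    cut (F := F) A p k.1.1), add_left_inj, finrank_map_pi (fun k : S => k.1.1)
    (fun k : S => k.1.2), Finset.sum_coe_sort S fun x => hilb F A x.1 * hilb F A x.2]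
  · intro w hw
    have h3 : (content (w.take p), content (w.drop p)) ∈ S := by
      refine (hmem _).2 ⟨?_, ?_⟩
      · rw [← content_append, List.take_append_drop, hw]
      · rw [sum_content, List.length_take, length_eq_of_content hw]
        omega
    refine ⟨⟨_, h3⟩, w.take p, w.drop p, rfl, rfl, fun k' => ?_⟩
    rw [cut_word]
    refine if_congr ?_ rfl rfl
    constructor
    · intro h
      have h4 := ((hmem _).1 k'.2).1
      have h5 := ((hmem _).1 h3).1
      simp only at h5
      refine Subtype.ext (Prod.ext h.symm ?_)
      rw [← h5, ← h] at h4
      exact add_left_cancel h4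
    · rintro rfl
      rfl
  · rintro ⟨⟨a, b⟩, hab⟩ u v hu hv
    have h4 := (hmem _).1 hab
    simp only at hu hv h4
    refine ⟨u ++ v, by rw [content_append, hu, hv, h4.1], fun k' => ?_⟩
    have hl : p = u.length := by rw [← sum_content, hu, h4.2]
    rw [cut_word, hl, List.take_left, List.drop_left]
    refine if_congr ?_ rfl rfl
    rw [hu]
    constructor
    · intro h
      refine Subtype.ext (Prod.ext h.symm ?_)
      have h5 := ((hmem _).1 k'.2).1
      rw [← h4.1, ← h] at h5
      exact add_left_cancel h5
    · rintro rfl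
      rfl

/-- The triples `(i, a, b)` with `a + e_i + b = n`. -/
def markIndex (n : Fin d →₀ ℕ) : Finset (Σ _ : Fin d, (Fin d →₀ ℕ) × (Fin d →₀ ℕ)) :=
  open Classical in
  Finset.univ.sigma fun i =>
    if Finsupp.single i 1 ≤ n then
      Finset.HasAntidiagonal.antidiagonal (n - Finsupp.single i 1)
    else ∅

lemma mem_markIndex {n : Fin d →₀ ℕ} {x : Σ _ : Fin d, (Fin d →₀ ℕ) × (Fin d →₀ ℕ)} :
    x ∈ markIndex n ↔ x.2.1 + Finsupp.single x.1 1 + x.2.2 = n := by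
  unfold markIndex
  simp only [Finset.mem_sigma, Finset.mem_univ, true_and]
  split_ifs with h
  · rw [Finset.HasAntidiagonal.mem_antidiagonal, eq_tsub_iff_add_eq_of_le h]
    rw [add_right_comm]
  · simp only [Finset.notMem_empty, false_iff]
    rintro rfl
    exact h (le_add_right le_add_self)

open Classical in
lemma finrank_markKer {n : Fin d →₀ ℕ} {p : ℕ} (hp : p < ∑ i, n i) :
    ∑ x ∈ (markIndex n).filter (fun x => ∑ i, x.2.1 i = p), hilb F A x.2.1 * hilb F A x.2.2 +
      Module.finrank F (markKer F A n p) = Module.finrank F (multiHom F d n) := by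
  set S := (markIndex n).filter (fun x => ∑ i, x.2.1 i = p) with hS
  have hmem : ∀ x, x ∈ S ↔ x.2.1 + Finsupp.single x.1 1 + x.2.2 = n ∧ ∑ i, x.2.1 i = p := by
    intro x
    simp [hS, mem_markIndex]
  have hw3 : ∀ (w : List (Fin d)) (i : Fin d), content w = n → w[p]? = some i →
      ⟨i, content (w.take p), content (w.drop (p + 1))⟩ ∈ S := by
    intro w i hw hi
    refine (hmem _).2 ⟨?_, ?_⟩
    · rw [← content_eq_of_getElem? hi, hw]
    · rw [sum_content, List.length_take, length_eq_of_content hw]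
      omega
  have hext : ∀ k k' : S, k.1.1 = k'.1.1 → k.1.2.1 = k'.1.2.1 → k = k' := by
    rintro ⟨⟨i, a, b⟩, hk⟩ ⟨⟨i', a', b'⟩, hk'⟩ rfl h
    simp only at h
    subst h
    have h1 := ((hmem _).1 hk).1
    have h2 := ((hmem _).1 hk').1
    simp only at h1 h2
    rw [← h2] at h1
    have h3 := add_left_cancel h1
    subst h3
    rfl
  have hker : markKer F A n p =
      multiHom F d n ⊓ LinearMap.ker (LinearMap.pi fun k : S =>
        mark (F := F) A p k.1.1 k.1.2.1) := by
    ext f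
    rw [mem_markKer, Submodule.mem_inf, LinearMap.mem_ker, funext_iff]
    refine and_congr_right fun hf => ⟨fun h k => h _ _, fun h i a => ?_⟩
    by_cases ha : ∃ b, ⟨i, a, b⟩ ∈ S
    · obtain ⟨b, hb⟩ := ha
      exact h ⟨⟨i, a, b⟩, hb⟩
    · refine multiHom_eqOn (M := EvalTarget F A d ⊗[F] EvalTarget F A d) (g := 0) ?_ hf
      intro w hw
      rw [mark_word, if_neg, LinearMap.zero_apply]
      rintro ⟨hi, rfl⟩
      exact ha ⟨_, hw3 w i hw hi⟩
  rw [hker, ← finrank_map_add_finrank_ker n (LinearMap.pi fun k : S =>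
    mark (F := F) A p k.1.1 k.1.2.1), add_left_inj, finrank_map_pi (fun k : S => k.1.2.1)
    (fun k : S => k.1.2.2), Finset.sum_coe_sort S fun x => hilb F A x.2.1 * hilb F A x.2.2]
  · intro w hw
    have hl := length_eq_of_content hw
    obtain ⟨i, hi⟩ : ∃ i, w[p]? = some i := ⟨_, List.getElem?_eq_getElem (by omega)⟩
    refine ⟨⟨_, hw3 w i hw hi⟩, w.take p, w.drop (p + 1), rfl, rfl, fun k' => ?_⟩
    rw [mark_word, hi]
    refine if_congr ?_ rfl rfl
    constructor
    · rintro ⟨h1, h2⟩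
      exact hext _ _ (Option.some.inj h1).symm h2.symm
    · rintro rfl
      exact ⟨rfl, rfl⟩
  · rintro ⟨⟨i, a, b⟩, hab⟩ u v hu hv
    have h4 := (hmem _).1 hab
    simp only at hu hv h4
    refine ⟨u ++ i :: v, by rw [content_append, content_cons, hu, hv, ← add_assoc, h4.1],
      fun k' => ?_⟩
    have hl : p = u.length := by rw [← sum_content, hu, h4.2]
    have e1 : (u ++ i :: v)[p]? = some i := by simp [hl]
    have e2 : (u ++ i :: v).take p = u := by simp [hl]
    have e3 : (u ++ i :: v).drop (p + 1) = v := by simp [hl, List.drop_append]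
    rw [mark_word, e1, e2, e3]
    refine if_congr ?_ rfl rfl
    rw [hu]
    constructor
    · rintro ⟨h1, h2⟩
      exact hext _ _ (Option.some.inj h1).symm h2.symm
    · rintro rfl
      exact ⟨rfl, rfl⟩

end Cut

/-! ### The identities of the triangular matrix algebra -/

section Triangular

open scoped TensorProduct

variable {F : Type*} [Field F] {A : Type*} [Ring A] [Algebra F A] {d : ℕ}

/-- The diagonal entries of the value of a word under a homomorphism to triangular matrices are the
values of the word under the homomorphisms given by the diagonal entries of the generators. -/
lemma ut2_word_diag (φ : FreeAlgebra F (Fin d) →ₐ[F] UT2 F A) (w : List (Fin d)) :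
    (φ (word F w)).1 0 0 =
        FreeAlgebra.lift F (fun j => (φ (FreeAlgebra.ι F j)).1 0 0) (word F w) ∧
      (φ (word F w)).1 1 1 =
        FreeAlgebra.lift F (fun j => (φ (FreeAlgebra.ι F j)).1 1 1) (word F w) := by
  induction w with
  | nil => simp
  | cons i w ih =>
    have h1 : (φ (FreeAlgebra.ι F i)).1 1 0 = 0 := (φ (FreeAlgebra.ι F i)).2
    have h2 : (φ (word F w)).1 1 0 = 0 := (φ (word F w)).2
    rw [word_cons, map_mul, map_mul, map_mul, ← ih.1, ← ih.2]
    simp [Matrix.mul_apply, Fin.sum_univ_two, h1, h2]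

/-- The off-diagonal entry of the value of a word under a homomorphism to triangular matrices. -/
lemma ut2_word_off (φ : FreeAlgebra F (Fin d) →ₐ[F] UT2 F A) (w : List (Fin d)) :
    (φ (word F w)).1 0 1 = ∑ p ∈ Finset.range w.length, ∑ i, if w[p]? = some i then
      FreeAlgebra.lift F (fun j => (φ (FreeAlgebra.ι F j)).1 0 0) (word F (w.take p)) *
        (φ (FreeAlgebra.ι F i)).1 0 1 *
        FreeAlgebra.lift F (fun j => (φ (FreeAlgebra.ι F j)).1 1 1) (word F (w.drop (p + 1)))
      else 0 := by
  induction w with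
  | nil => simp
  | cons i w ih =>
    rw [word_cons, map_mul, List.length_cons, Finset.sum_range_succ']
    have e : (φ (FreeAlgebra.ι F i) * φ (word F w)).1 0 1 =
        (φ (FreeAlgebra.ι F i)).1 0 0 * (φ (word F w)).1 0 1 +
          (φ (FreeAlgebra.ι F i)).1 0 1 * (φ (word F w)).1 1 1 := by
      simp [Matrix.mul_apply, Fin.sum_univ_two]
    rw [e, ih, (ut2_word_diag φ w).2, Finset.mul_sum]
    congr 1
    · refine Finset.sum_congr rfl fun p _ => ?_
      rw [Finset.mul_sum]
      refine Finset.sum_congr rfl fun j _ => ?_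
      simp [mul_assoc]
    · simp

/-- The map sending a word `u x_i v`, with `u` of length `p`, to `u ⊗ v`, and other words to
zero. -/
def markAt (F : Type*) [Field F] (A : Type*) [Ring A] [Algebra F A] {d : ℕ} (p : ℕ) (i : Fin d) :
    FreeAlgebra F (Fin d) →ₗ[F] EvalTarget F A d ⊗[F] EvalTarget F A d :=
  onWords fun w => if w[p]? = some i then
    evalAll F A d (word F (w.take p)) ⊗ₜ evalAll F A d (word F (w.drop (p + 1))) else 0

lemma ut2_off (φ : FreeAlgebra F (Fin d) →ₐ[F] UT2 F A)
    (m : Fin d → EvalTarget F A d ⊗[F] EvalTarget F A d →ₗ[F] A)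
    (hm : ∀ i u v, m i (evalAll F A d u ⊗ₜ evalAll F A d v) =
      FreeAlgebra.lift F (fun j => (φ (FreeAlgebra.ι F j)).1 0 0) u *
        (φ (FreeAlgebra.ι F i)).1 0 1 *
        FreeAlgebra.lift F (fun j => (φ (FreeAlgebra.ι F j)).1 1 1) v)
    {n : Fin d →₀ ℕ} {f : FreeAlgebra F (Fin d)} (hf : f ∈ multiHom F d n) :
    (φ f).1 0 1 = ∑ i, m i (∑ p ∈ Finset.range (∑ i, n i), markAt F A p i f) := by
  let off : UT2 F A →ₗ[F] A := Matrix.entryLinearMap F A 0 1 ∘ₗ (UT2 F A).val.toLinearMap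
  have key : (off ∘ₗ φ.toLinearMap) f =
      (∑ i, m i ∘ₗ ∑ p ∈ Finset.range (∑ i, n i), markAt F A p i) f := by
    refine multiHom_eqOn ?_ hf
    intro w hw
    have h1 : (off ∘ₗ φ.toLinearMap) (word F w) = (φ (word F w)).1 0 1 := rfl
    rw [h1, ut2_word_off, length_eq_of_content hw, Finset.sum_comm, LinearMap.sum_apply]
    refine Finset.sum_congr rfl fun i _ => ?_
    rw [LinearMap.comp_apply, LinearMap.sum_apply, map_sum]
    refine Finset.sum_congr rfl fun p _ => ?_
    rw [markAt, onWords_word]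
    split_ifs
    · rw [hm]
    · rw [map_zero]
  have h2 : (off ∘ₗ φ.toLinearMap) f = (φ f).1 0 1 := rfl
  rw [← h2, key, LinearMap.sum_apply]
  simp

lemma markAt_eq {n : Fin d →₀ ℕ} {f : FreeAlgebra F (Fin d)} (hf : f ∈ multiHom F d n) (p : ℕ)
    (i : Fin d) : markAt F A p i f = ∑ a ∈ Finset.Iic n, mark A p i a f := by
  classical
  have key : markAt F A p i f = (∑ a ∈ Finset.Iic n, mark A p i a) f := by
    refine multiHom_eqOn ?_ hf
    intro w hw
    rw [LinearMap.sum_apply, markAt, onWords_word, Finset.sum_eq_single (content (w.take p))]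
    · rw [mark_word]
      simp
    · intro a _ ha
      rw [mark_word, if_neg fun h => ha h.2.symm]
    · intro h
      refine absurd (Finset.mem_Iic.2 ?_) h
      rw [← hw]
      conv_rhs => rw [← List.take_append_drop p w, content_append]
      exact le_self_add
  rw [key, LinearMap.sum_apply]

lemma mark_eq_zero_of_ne {n : Fin d →₀ ℕ} {f : FreeAlgebra F (Fin d)} (hf : f ∈ multiHom F d n)
    {p : ℕ} (hp : p ≤ ∑ i, n i) (i : Fin d) {a : Fin d →₀ ℕ} (ha : ∑ i, a i ≠ p) :
    mark A p i a f = 0 := by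
  classical
  refine multiHom_eqOn (g := (0 : FreeAlgebra F (Fin d) →ₗ[F]
    EvalTarget F A d ⊗[F] EvalTarget F A d)) ?_ hf
  intro w hw
  rw [mark_word, if_neg, LinearMap.zero_apply]
  rintro ⟨-, rfl⟩
  apply ha
  rw [sum_content, List.length_take, length_eq_of_content hw]
  omega

/-- The scalar by which the substitution `x_i ↦ p_i x_i`, with `p_i` the `i`-th prime number, acts
in multidegree `a`. -/
def primeWeight (a : Fin d →₀ ℕ) : ℕ := ∏ i : Fin d, Nat.nth Nat.Prime i ^ a i

lemma primeWeight_injective : Function.Injective (primeWeight (d := d)) := by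
  have hp : ∀ i, (Nat.nth Nat.Prime i).Prime := Nat.prime_nth_prime
  intro a b hab
  let e : Fin d ↪ ℕ := ⟨fun i => Nat.nth Nat.Prime i, fun i j h =>
    Fin.val_injective (Nat.nth_injective Nat.infinite_setOfPred_prime h)⟩
  have h : ∀ a : Fin d →₀ ℕ, (primeWeight a).factorization = a.embDomain e := by
    intro a
    have h1 : primeWeight a = (a.embDomain e).prod (· ^ ·) := by
      rw [Finsupp.prod_embDomain, Finsupp.prod_fintype _ _ (by simp)]
      rfl
    rw [h1]
    refine Nat.prod_pow_factorization_eq_self fun p hp' => ?_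
    rw [Finsupp.support_embDomain, Finset.mem_map] at hp'
    obtain ⟨i, -, rfl⟩ := hp'
    exact hp i
  apply Finsupp.embDomain_injective e
  rw [← h, ← h, hab]

/-- The action of the substitution `x_i ↦ p_i x_i` on `F⟨x_1, …, x_d⟩ / T(A)`. -/
def scaleEval (F : Type*) [Field F] (A : Type*) [Ring A] [Algebra F A] (d : ℕ) :
    EvalTarget F A d →ₗ[F] EvalTarget F A d :=
  LinearMap.funLeft F A fun φ => φ.comp
    (FreeAlgebra.lift F fun i : Fin d => (Nat.nth Nat.Prime i : F) • FreeAlgebra.ι F i)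

lemma scaleEval_word (w : List (Fin d)) : scaleEval F A d (evalAll F A d (word F w)) =
    (primeWeight (content w) : F) • evalAll F A d (word F w) := by
  funext φ
  rw [Pi.smul_apply, evalAll_apply, scaleEval, LinearMap.funLeft_apply, evalAll_apply,
    AlgHom.comp_apply, ← map_smul]
  congr 1
  induction w with
  | nil => simp [primeWeight]
  | cons i w ih =>
    have h : primeWeight (content (i :: w)) = Nat.nth Nat.Prime i * primeWeight (content w) := by
      unfold primeWeight
      rw [content_cons]
      simp only [Finsupp.add_apply, pow_add, Finset.prod_mul_distrib]
      congr 1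
      rw [Finset.prod_eq_single i]
      · simp
      · intro j _ hj
        simp [hj]
      · simp
    rw [word_cons, map_mul, ih, h, FreeAlgebra.lift_ι_apply, smul_mul_smul_comm, Nat.cast_mul]

/-- The identities of `UT_2(A)` in multidegree `n`, for an algebra `A` that contains two copies of
itself whose product is their tensor product. -/
lemma mem_identities_ut2 [CharZero F]
    (hA : ∃ α β : A →ₐ[F] A, Function.Injective
      (LinearMap.mul' F A ∘ₗ TensorProduct.map α.toLinearMap β.toLinearMap))
    {n : Fin d →₀ ℕ} (hn : 0 < ∑ i, n i) {f : FreeAlgebra F (Fin d)} (hf : f ∈ multiHom F d n) :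
    f ∈ identities F (UT2 F A) (Fin d) ↔ f ∈ markKerLT F A n (∑ i, n i) := by
  classical
  rw [mem_markKerLT, mem_identities]
  constructor
  · intro h
    refine ⟨hf, ?_⟩
    obtain ⟨α, β, hαβ⟩ := hA
    -- all positions together
    have hsum : ∀ i, ∑ p ∈ Finset.range (∑ i, n i), markAt F A p i f = 0 := by
      intro i
      apply tensor_pi_eq_zero
      intro ψ₁ ψ₂
      apply hαβ
      rw [map_zero]
      let X : Fin d → UT2 F A := fun j =>
        ⟨!![α (ψ₁ (FreeAlgebra.ι F j)), if j = i then 1 else 0; 0, β (ψ₂ (FreeAlgebra.ι F j))], rfl⟩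
      let m : Fin d → EvalTarget F A d ⊗[F] EvalTarget F A d →ₗ[F] A := fun j =>
        if j = i then LinearMap.mul' F A ∘ₗ TensorProduct.map α.toLinearMap β.toLinearMap ∘ₗ
          TensorProduct.map (LinearMap.proj (R := F) ψ₁) (LinearMap.proj (R := F) ψ₂) else 0
      have h1 := ut2_off (FreeAlgebra.lift F X) m ?_ hf
      · rw [h (FreeAlgebra.lift F X), Finset.sum_eq_single i] at h1
        · simp only [m, if_true] at h1
          exact h1.symm
        · intro j _ hj
          simp [m, hj]
        · simp
      · intro j u v
        have e1 : FreeAlgebra.lift F (fun j => (FreeAlgebra.lift F X (FreeAlgebra.ι F j)).1 0 0) =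
            α.comp ψ₁ := by
          apply FreeAlgebra.hom_ext
          funext j
          simp [X]
        have e2 : FreeAlgebra.lift F (fun j => (FreeAlgebra.lift F X (FreeAlgebra.ι F j)).1 1 1) =
            β.comp ψ₂ := by
          apply FreeAlgebra.hom_ext
          funext j
          simp [X]
        rw [e1, e2, FreeAlgebra.lift_ι_apply]
        by_cases hj : j = i
        · simp [m, X, hj]
        · simp [m, X, hj]
    -- the substitution `x_i ↦ p_i x_i` in the first factor separates the positions
    intro q hq i a
    by_cases haq : ∑ i, a i = q
    swap
    · exact mark_eq_zero_of_ne hf hq.le i haq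
    subst haq
    by_cases han : a ≤ n
    swap
    · refine multiHom_eqOn (g := (0 : FreeAlgebra F (Fin d) →ₗ[F]
        EvalTarget F A d ⊗[F] EvalTarget F A d)) ?_ hf
      intro w hw
      rw [mark_word, if_neg, LinearMap.zero_apply]
      rintro ⟨h1, h2⟩
      apply han
      rw [← hw, content_eq_of_getElem? h1, add_assoc, h2]
      exact le_self_add
    have h2 : ∑ a ∈ (Finset.Iic n).filter (fun a => ∑ i, a i < ∑ i, n i),
        mark A (∑ i, a i) i a f = 0 := by
      rw [← hsum i, Finset.sum_congr rfl fun p _ => markAt_eq hf p i, Finset.sum_comm,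
        Finset.sum_filter]
      refine Finset.sum_congr rfl fun b _ => ?_
      split_ifs with hb
      · rw [Finset.sum_eq_single (∑ i, b i)]
        · intro p hp hpb
          exact mark_eq_zero_of_ne hf (Finset.mem_range.1 hp).le i (Ne.symm hpb)
        · intro h3
          exact absurd (Finset.mem_range.2 hb) h3
      · symm
        refine Finset.sum_eq_zero fun p hp => ?_
        have hp' := Finset.mem_range.1 hp
        exact mark_eq_zero_of_ne hf hp'.le i (by omega)
    refine eq_zero_of_sum_eigenvectors ((scaleEval F A d).rTensor _) _
      (fun a => (primeWeight a : F)) ?_ (fun a => mark A (∑ i, a i) i a f) ?_ h2 a ?_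
    · intro b _ c _ hbc
      exact primeWeight_injective (Nat.cast_injective hbc)
    · intro b _
      rw [← LinearMap.comp_apply, ← LinearMap.smul_apply]
      refine multiHom_eqOn ?_ hf
      intro w hw
      rw [LinearMap.comp_apply, LinearMap.smul_apply, mark_word]
      split_ifs with h3
      · rw [LinearMap.rTensor_tmul, scaleEval_word, h3.2, TensorProduct.smul_tmul']
      · simp
    · rw [Finset.mem_filter, Finset.mem_Iic]
      exact ⟨han, hq⟩
  · rintro ⟨-, h⟩ φ
    have hat : ∀ p < ∑ i, n i, ∀ i, markAt F A p i f = 0 := by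
      intro p hp i
      rw [markAt_eq hf]
      exact Finset.sum_eq_zero fun a _ => h p hp i a
    have hT : f ∈ identities F A (Fin d) := by
      rw [← evalAll_eq_zero]
      have h0 : f ∈ markKer F A n 0 := mem_markKer.2 ⟨hf, h 0 hn⟩
      have h1 := (mem_cutKer.1 (markKer_le_cutKer hn h0)).2 0
      have key : (evalAll F A d).toLinearMap f = (LinearMap.mul' F _ ∘ₗ cut A 0 0) f := by
        refine multiHom_eqOn ?_ hf
        intro w _
        rw [LinearMap.comp_apply, cut_word]
        simp
      have h2 := key
      rwa [LinearMap.comp_apply, h1, map_zero] at h2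
    rw [mem_identities] at hT
    apply Subtype.ext
    have h00 : (φ f).1 0 0 = 0 := by
      have e : (Matrix.entryLinearMap F A 0 0 ∘ₗ (UT2 F A).val.toLinearMap ∘ₗ φ.toLinearMap) f =
          (FreeAlgebra.lift F (fun j => (φ (FreeAlgebra.ι F j)).1 0 0)).toLinearMap f :=
        LinearMap.congr_fun (word_ext fun w => (ut2_word_diag φ w).1) f
      exact e.trans (hT _)
    have h11 : (φ f).1 1 1 = 0 := by
      have e : (Matrix.entryLinearMap F A 1 1 ∘ₗ (UT2 F A).val.toLinearMap ∘ₗ φ.toLinearMap) f =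
          (FreeAlgebra.lift F (fun j => (φ (FreeAlgebra.ι F j)).1 1 1)).toLinearMap f :=
        LinearMap.congr_fun (word_ext fun w => (ut2_word_diag φ w).2) f
      exact e.trans (hT _)
    have h01 : (φ f).1 0 1 = 0 := by
      rw [ut2_off φ (fun i => LinearMap.mul' F A ∘ₗ TensorProduct.map
        (LinearMap.mulRight F ((φ (FreeAlgebra.ι F i)).1 0 1) ∘ₗ LinearMap.proj (R := F)
          (FreeAlgebra.lift F (fun j => (φ (FreeAlgebra.ι F j)).1 0 0)))
        (LinearMap.proj (R := F)
          (FreeAlgebra.lift F (fun j => (φ (FreeAlgebra.ι F j)).1 1 1)))) (by simp) hf]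
      refine Finset.sum_eq_zero fun i _ => ?_
      rw [Finset.sum_eq_zero fun p hp => hat p (Finset.mem_range.1 hp) i, map_zero]
    have h10 : (φ f).1 1 0 = 0 := (φ f).2
    ext a b
    fin_cases a <;> fin_cases b <;> simp_all

/-- The dimension in positive multidegrees: the kernels of the marking maps meet in the identities,
and the sums of these kernels are the kernels of the cutting maps. -/
lemma hilb_ut2 [CharZero F]
    (hA : ∃ α β : A →ₐ[F] A, Function.Injective
      (LinearMap.mul' F A ∘ₗ TensorProduct.map α.toLinearMap β.toLinearMap))
    {n : Fin d →₀ ℕ} (hn : 0 < ∑ i, n i) :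
    (hilb F (UT2 F A) n : ℤ) =
      ∑ x ∈ markIndex n, (hilb F A x.2.1 * hilb F A x.2.2 : ℤ) -
      ∑ x ∈ (Finset.HasAntidiagonal.antidiagonal n).filter
        (fun x => 0 < ∑ i, x.1 i ∧ ∑ i, x.1 i < ∑ i, n i), (hilb F A x.1 * hilb F A x.2 : ℤ) := by
  classical
  obtain ⟨p, hp⟩ := Nat.exists_eq_succ_of_ne_zero hn.ne'
  have hk : multiHom F d n ⊓ LinearMap.ker (identities F (UT2 F A) (Fin d)).mkQ =
      markKerLT F A n (p + 1) := by
    ext f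
    rw [Submodule.mem_inf, Submodule.ker_mkQ]
    constructor
    · rintro ⟨h1, h2⟩
      rw [← Nat.succ_eq_add_one, ← hp]
      exact (mem_identities_ut2 hA hn h1).1 h2
    · intro h
      have h1 := (mem_markKerLT.1 h).1
      rw [← Nat.succ_eq_add_one, ← hp] at h
      exact ⟨h1, (mem_identities_ut2 hA hn h1).2 h⟩
  have h1 := finrank_map_add_finrank_ker n (identities F (UT2 F A) (Fin d)).mkQ
  rw [hk] at h1
  have h2 := finrank_markKerLT (F := F) (A := A) (n := n) (p := p) (by omega)
  have h1' : (hilb F (UT2 F A) n : ℤ) + Module.finrank F (markKerLT F A n (p + 1)) =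
    Module.finrank F (multiHom F d n) := by exact_mod_cast h1
  set v : ℤ := (Module.finrank F (multiHom F d n) : ℤ) with hv
  have h3 : ∑ q ∈ Finset.range (p + 1), (Module.finrank F (markKer F A n q) : ℤ) =
      (p + 1) * v - ∑ x ∈ markIndex n, (hilb F A x.2.1 * hilb F A x.2.2 : ℤ) := by
    have e : ∀ q ∈ Finset.range (p + 1), (Module.finrank F (markKer F A n q) : ℤ) = v -
        ∑ x ∈ (markIndex n).filter (fun x => ∑ i, x.2.1 i = q),
          (hilb F A x.2.1 * hilb F A x.2.2 : ℤ) := by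
      intro q hq
      have := finrank_markKer (F := F) (A := A) (n := n) (p := q)
        (by have := Finset.mem_range.1 hq; omega)
      rw [hv, ← this]
      push_cast
      ring
    rw [Finset.sum_congr rfl e, Finset.sum_sub_distrib, Finset.sum_const, Finset.card_range,
      Finset.sum_fiberwise_of_maps_to (t := Finset.range (p + 1))]
    · simp
    · intro x hx
      rw [mem_markIndex] at hx
      rw [Finset.mem_range, ← Nat.succ_eq_add_one, ← hp, ← hx]
      simp only [Finsupp.add_apply, Finset.sum_add_distrib]
      have : ∑ i, (Finsupp.single x.1 1 : Fin d →₀ ℕ) i = 1 := by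
        simp [Finsupp.single_apply]
      omega
  have h4 : ∑ q ∈ Finset.Ico 1 (p + 1), (Module.finrank F (cutKer F A n q) : ℤ) =
      p * v - ∑ x ∈ (Finset.HasAntidiagonal.antidiagonal n).filter
        (fun x => 0 < ∑ i, x.1 i ∧ ∑ i, x.1 i < ∑ i, n i),
          (hilb F A x.1 * hilb F A x.2 : ℤ) := by
    have e : ∀ q ∈ Finset.Ico 1 (p + 1), (Module.finrank F (cutKer F A n q) : ℤ) = v -
        ∑ x ∈ ((Finset.HasAntidiagonal.antidiagonal n).filter
          (fun x => 0 < ∑ i, x.1 i ∧ ∑ i, x.1 i < ∑ i, n i)).filter (fun x => ∑ i, x.1 i = q),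
          (hilb F A x.1 * hilb F A x.2 : ℤ) := by
      intro q hq
      have hq' := Finset.mem_Ico.1 hq
      have := finrank_cutKer (F := F) (A := A) (n := n) (p := q) (by omega)
      rw [hv, ← this, Finset.filter_filter]
      have e2 : (Finset.HasAntidiagonal.antidiagonal n).filter (fun x => ∑ i, x.1 i = q) =
          (Finset.HasAntidiagonal.antidiagonal n).filter (fun x => (0 < ∑ i, x.1 i ∧
            ∑ i, x.1 i < ∑ i, n i) ∧ ∑ i, x.1 i = q) := by
        refine Finset.filter_congr fun x _ => ?_
        omega
      rw [← e2]
      push_cast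
      ring
    rw [Finset.sum_congr rfl e, Finset.sum_sub_distrib, Finset.sum_const, Nat.card_Ico,
      Finset.sum_fiberwise_of_maps_to (t := Finset.Ico 1 (p + 1))]
    · simp
    · intro x hx
      have := (Finset.mem_filter.1 hx).2
      rw [Finset.mem_Ico]
      omega
  rw [h3, h4] at h2
  rw [h2] at h1'
  linarith

/-- The Hilbert series of the relatively free algebra of `UT_2(A)`. -/
theorem hilbSeries_ut2 [CharZero F] [Nontrivial A]
    (hA : ∃ α β : A →ₐ[F] A, Function.Injective
      (LinearMap.mul' F A ∘ₗ TensorProduct.map α.toLinearMap β.toLinearMap)) :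
    hilbSeries F d (UT2 F A) = 2 * hilbSeries F d A +
      (∑ i, MvPowerSeries.X i - 1) * hilbSeries F d A ^ 2 := by
  classical
  have hc : ∀ n : Fin d →₀ ℕ, MvPowerSeries.coeff n (hilbSeries F d A) = (hilb F A n : ℤ) :=
    fun n => rfl
  have hc2 : ∀ n : Fin d →₀ ℕ, MvPowerSeries.coeff n (hilbSeries F d A ^ 2) =
      ∑ x ∈ Finset.HasAntidiagonal.antidiagonal n, (hilb F A x.1 * hilb F A x.2 : ℤ) := by
    intro n
    rw [sq, MvPowerSeries.coeff_mul]
    rfl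
  ext n
  have hmark : MvPowerSeries.coeff n ((∑ i, MvPowerSeries.X i) * hilbSeries F d A ^ 2) =
      ∑ x ∈ markIndex n, (hilb F A x.2.1 * hilb F A x.2.2 : ℤ) := by
    rw [Finset.sum_mul, map_sum, markIndex, Finset.sum_sigma]
    refine Finset.sum_congr rfl fun i _ => ?_
    rw [MvPowerSeries.X, MvPowerSeries.coeff_monomial_mul, one_mul, hc2]
    split_ifs <;> simp
  rw [map_add, two_mul, map_add, sub_mul, one_mul, map_sub, hmark, hc2, hc]
  change (hilb F (UT2 F A) n : ℤ) = _
  by_cases hn : 0 < ∑ i, n i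
  · rw [hilb_ut2 hA hn]
    have h0 : ∀ m : Fin d →₀ ℕ, ∑ i, m i = 0 → m = 0 := by
      intro m hm
      ext i
      exact (Finset.sum_eq_zero_iff.1 hm) i (Finset.mem_univ i)
    have hne : n ≠ 0 := by
      rintro rfl
      simp at hn
    have hsplit := Finset.sum_filter_add_sum_filter_not (Finset.HasAntidiagonal.antidiagonal n)
      (fun x => 0 < ∑ i, x.1 i ∧ ∑ i, x.1 i < ∑ i, n i)
      (fun x => (hilb F A x.1 * hilb F A x.2 : ℤ))
    have hends : (Finset.HasAntidiagonal.antidiagonal n).filter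
        (fun x => ¬ (0 < ∑ i, x.1 i ∧ ∑ i, x.1 i < ∑ i, n i)) = {(0, n), (n, 0)} := by
      ext ⟨a, b⟩
      simp only [Finset.mem_filter, Finset.HasAntidiagonal.mem_antidiagonal, Finset.mem_insert,
        Finset.mem_singleton, Prod.mk.injEq]
      constructor
      · rintro ⟨rfl, h⟩
        by_cases ha : ∑ i, a i = 0
        · left
          simp [h0 a ha]
        · right
          have hb : b = 0 := by
            apply h0
            simp only [Finsupp.add_apply, Finset.sum_add_distrib] at h
            omega
          simp [hb]
      · rintro (⟨rfl, rfl⟩ | ⟨rfl, rfl⟩) <;> simp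
    rw [hends, Finset.sum_pair (by simp [hne.symm]), hilb_zero] at hsplit
    rw [← hsplit]
    push_cast
    ring
  · have h0 : n = 0 := by
      ext i
      exact (Finset.sum_eq_zero_iff.1 (Nat.eq_zero_of_not_pos hn)) i (Finset.mem_univ i)
    subst h0
    have : markIndex (0 : Fin d →₀ ℕ) = ∅ := by
      rw [Finset.eq_empty_iff_forall_notMem]
      intro x hx
      rw [mem_markIndex] at hx
      have := DFunLike.congr_fun hx x.1
      simp at this
    have : Nontrivial (UT2 F A) := inferInstance
    simp_all [hilb_zero]

end Triangular

/-! ### The Grassmann algebra -/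

section GrassmannAlgebra

open scoped TensorProduct

variable {F : Type*} [Field F]

/-- The Grassmann algebra contains two copies of itself, on the even and on the odd generators,
whose product is their tensor product. -/
lemma exists_grassmann_tensor (F : Type*) [Field F] :
    ∃ α β : Grassmann F →ₐ[F] Grassmann F, Function.Injective
      (LinearMap.mul' F (Grassmann F) ∘ₗ TensorProduct.map α.toLinearMap β.toLinearMap) := by
  let Q : QuadraticForm F (ℕ →₀ F) := 0
  let e : ((ℕ →₀ F) × (ℕ →₀ F)) ≃ₗ[F] (ℕ →₀ F) :=
    (Finsupp.sumFinsuppLEquivProdFinsupp F).symm ≪≫ₗ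
      Finsupp.domLCongr Equiv.natSumNatEquivNat
  let i : (Q.prod Q).IsometryEquiv Q := ⟨e, fun m => by simp [Q]⟩
  let φ : CliffordAlgebra (Q.prod Q) ≃ₐ[F] Grassmann F := CliffordAlgebra.equivOfIsometry i
  refine ⟨φ.toAlgHom.comp (CliffordAlgebra.map (.inl _ _)),
    φ.toAlgHom.comp (CliffordAlgebra.map (.inr _ _)), ?_⟩
  have h : ∀ t, (LinearMap.mul' F (Grassmann F) ∘ₗ TensorProduct.map
      (φ.toAlgHom.comp (CliffordAlgebra.map (.inl Q Q))).toLinearMap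
      (φ.toAlgHom.comp (CliffordAlgebra.map (.inr Q Q))).toLinearMap) t =
      φ ((CliffordAlgebra.prodEquiv Q Q).symm (GradedTensorProduct.of F
        (CliffordAlgebra.evenOdd Q) (CliffordAlgebra.evenOdd Q) t)) := by
    intro t
    induction t with
    | zero => simp
    | add x y hx hy => rw [map_add, hx, hy, map_add, map_add, map_add]
    | tmul x y =>
      have h1 : (CliffordAlgebra.prodEquiv Q Q).symm (GradedTensorProduct.of F
          (CliffordAlgebra.evenOdd Q) (CliffordAlgebra.evenOdd Q) (x ⊗ₜ[F] y)) =
          CliffordAlgebra.map (.inl Q Q) x * CliffordAlgebra.map (.inr Q Q) y := rfl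
      rw [h1, map_mul]
      rfl
  intro s t hst
  rw [h, h] at hst
  exact (GradedTensorProduct.of F (CliffordAlgebra.evenOdd Q) (CliffordAlgebra.evenOdd Q)).injective
    ((CliffordAlgebra.prodEquiv Q Q).symm.injective (φ.injective hst))

/-- The part of the Grassmann algebra of a given parity. -/
def parity (F : Type*) [Field F] (s : ZMod 2) : Submodule F (Grassmann F) :=
  CliffordAlgebra.evenOdd (0 : QuadraticForm F (ℕ →₀ F)) s

lemma parity_mul {s t : ZMod 2} {x y : Grassmann F} (hx : x ∈ parity F s) (hy : y ∈ parity F t) :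
    x * y ∈ parity F (s + t) :=
  SetLike.GradedMul.mul_mem (A := CliffordAlgebra.evenOdd (0 : QuadraticForm F (ℕ →₀ F))) hx hy

lemma parity_comm {s t : ZMod 2} {x y : Grassmann F} (hx : x ∈ parity F s) (hy : y ∈ parity F t) :
    x * y = (-1 : ℤˣ) ^ (t * s) • (y * x) := by
  have h := CliffordAlgebra.map_mul_map_of_isOrtho_of_mem_evenOdd
    (QuadraticMap.Isometry.id (0 : QuadraticForm F (ℕ →₀ F)))
    (QuadraticMap.Isometry.id (0 : QuadraticForm F (ℕ →₀ F)))
    (fun x y => by simp [QuadraticMap.IsOrtho]) x y hx hy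
  rw [CliffordAlgebra.map_id] at h
  exact h

lemma odd_anticomm {x y : Grassmann F} (hx : x ∈ parity F 1) (hy : y ∈ parity F 1) :
    x * y = -(y * x) := by
  rw [parity_comm hx hy]
  simp

lemma even_comm {x y : Grassmann F} (hx : x ∈ parity F 0) : x * y = y * x := by
  have hy : y ∈ parity F 0 ⊔ parity F 1 := by
    have := (CliffordAlgebra.evenOdd_isCompl (0 : QuadraticForm F (ℕ →₀ F))).sup_eq_top
    unfold parity
    rw [this]
    trivial
  obtain ⟨a, ha, b, hb, rfl⟩ := Submodule.mem_sup.1 hy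
  rw [mul_add, add_mul, parity_comm hx ha, parity_comm hx hb]
  simp

lemma exists_even_add_odd (x : Grassmann F) :
    ∃ a ∈ parity F 0, ∃ b ∈ parity F 1, a + b = x := by
  have h : x ∈ parity F 0 ⊔ parity F 1 := by
    unfold parity
    rw [(CliffordAlgebra.evenOdd_isCompl (0 : QuadraticForm F (ℕ →₀ F))).sup_eq_top]
    trivial
  exact Submodule.mem_sup.1 h

lemma commutator_add_even {a b a' b' : Grassmann F} (ha : a ∈ parity F 0) (ha' : a' ∈ parity F 0) :
    (a + b) * (a' + b') - (a' + b') * (a + b) = b * b' - b' * b := by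
  have h1 := even_comm (y := b') ha
  have h2 := even_comm (y := a') ha
  have h3 := even_comm (y := b) ha'
  simp only [add_mul, mul_add, h1, h2, h3]
  abel

lemma one_mem_parity : (1 : Grassmann F) ∈ parity F 0 :=
  SetLike.GradedOne.one_mem (A := CliffordAlgebra.evenOdd (0 : QuadraticForm F (ℕ →₀ F)))

/-- Commutators in the Grassmann algebra are even, hence central. -/
lemma commutator_even (x y : Grassmann F) : x * y - y * x ∈ parity F 0 := by
  obtain ⟨a, ha, b, hb, rfl⟩ := exists_even_add_odd x
  obtain ⟨a', ha', b', hb', rfl⟩ := exists_even_add_odd y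
  have e : (1 + 1 : ZMod 2) = 0 := by decide
  have h1 := parity_mul hb hb'
  have h2 := parity_mul hb' hb
  rw [e] at h1 h2
  rw [commutator_add_even ha ha']
  exact Submodule.sub_mem _ h1 h2

variable {d : ℕ}

/-- The evaluation `x_i ↦ e_i` at the generators of the Grassmann algebra. -/
def genEval (F : Type*) [Field F] (d : ℕ) : FreeAlgebra F (Fin d) →ₐ[F] Grassmann F :=
  FreeAlgebra.lift F fun i => ExteriorAlgebra.ι F (Finsupp.single (i : ℕ) 1)

lemma leftNormed_append {σ : Type*} (i : σ) (js : List σ) (k : σ) :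
    leftNormed F i (js ++ [k]) =
      leftNormed F i js * FreeAlgebra.ι F k - FreeAlgebra.ι F k * leftNormed F i js := by
  simp [leftNormed]

/-- The value of a left-normed commutator under a homomorphism to the Grassmann algebra depends
only on the odd parts of the values of the variables. -/
lemma map_leftNormed_eq (φ ψ : FreeAlgebra F (Fin d) →ₐ[F] Grassmann F)
    (h : ∀ i, φ (FreeAlgebra.ι F i) - ψ (FreeAlgebra.ι F i) ∈ parity F 0) (i : Fin d)
    {js : List (Fin d)} (hjs : js ≠ []) :
    φ (leftNormed F i js) = ψ (leftNormed F i js) ∧ φ (leftNormed F i js) ∈ parity F 0 := by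
  induction js using List.reverseRecOn with
  | nil => exact absurd rfl hjs
  | append_singleton js k ih =>
    rw [leftNormed_append]
    simp only [map_sub, map_mul]
    refine ⟨?_, commutator_even _ _⟩
    by_cases hjs' : js = []
    · subst hjs'
      have h1 : ∀ i, φ (FreeAlgebra.ι F i) = (φ (FreeAlgebra.ι F i) - ψ (FreeAlgebra.ι F i)) +
        ψ (FreeAlgebra.ι F i) := fun i => (sub_add_cancel _ _).symm
      have h2 : leftNormed F i [] = FreeAlgebra.ι F i := rfl
      rw [h2, h1 i, h1 k]
      exact commutator_add_even (h i) (h k)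
    · obtain ⟨h1, h2⟩ := ih hjs'
      rw [even_comm h2, sub_self, ← h1, even_comm h2, sub_self]

/-- A proper polynomial is an identity of the Grassmann algebra if and only if it vanishes at the
generators. -/
lemma proper_mem_identities_iff [CharZero F] {f : FreeAlgebra F (Fin d)}
    (hf : f ∈ properPolys F (Fin d)) :
    f ∈ identities F (Grassmann F) (Fin d) ↔ genEval F d f = 0 := by
  rw [mem_identities]
  refine ⟨fun h => h _, fun h φ => ?_⟩
  have hodd : ∀ i : Fin d, ∃ b ∈ parity F 1, φ (FreeAlgebra.ι F i) - b ∈ parity F 0 := by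
    intro i
    obtain ⟨a, ha, b, hb, hab⟩ := exists_even_add_odd (φ (FreeAlgebra.ι F i))
    exact ⟨b, hb, by rwa [← hab, add_sub_cancel_right]⟩
  choose b hb1 hb2 using hodd
  let L : (ℕ →₀ F) →ₗ[F] Grassmann F :=
    Finsupp.linearCombination F fun k => if hk : k < d then b ⟨k, hk⟩ else 0
  have hL : ∀ m, L m ∈ parity F 1 := by
    intro m
    rw [Finsupp.linearCombination_apply]
    refine Submodule.sum_mem _ fun k _ => Submodule.smul_mem _ _ ?_
    split_ifs
    · exact hb1 _
    · exact zero_mem _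
  have hL2 : ∀ m, L m * L m = 0 := by
    intro m
    have h1 := odd_anticomm (hL m) (hL m)
    have h2 : (2 : F) • (L m * L m) = 0 := by
      rw [two_smul]
      nth_rewrite 1 [h1]
      exact neg_add_cancel _
    exact (smul_eq_zero.1 h2).resolve_left two_ne_zero
  let ψ : Grassmann F →ₐ[F] Grassmann F := ExteriorAlgebra.lift F ⟨L, hL2⟩
  have hψ : ∀ i, (ψ.comp (genEval F d)) (FreeAlgebra.ι F i) = b i := by
    intro i
    simp [ψ, genEval, L]
  have key : ∀ g ∈ properPolys F (Fin d), φ g = (ψ.comp (genEval F d)) g := by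
    intro g hg
    unfold properPolys at hg
    induction hg using Algebra.adjoin_induction with
    | mem x hx =>
      obtain ⟨i, js, hjs, rfl⟩ := hx
      exact (map_leftNormed_eq _ _ (fun i => by rw [hψ]; exact hb2 i) i hjs).1
    | algebraMap r => simp
    | add x y _ _ hx hy => rw [map_add, map_add, hx, hy]
    | mul x y _ _ hx hy => rw [map_mul, map_mul, hx, hy]
  rw [key f hf, AlgHom.comp_apply, h, map_zero]

lemma genEval_proper_even {f : FreeAlgebra F (Fin d)} (hf : f ∈ properPolys F (Fin d)) :
    genEval F d f ∈ parity F 0 := by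
  unfold properPolys at hf
  induction hf using Algebra.adjoin_induction with
  | mem x hx =>
    obtain ⟨i, js, hjs, rfl⟩ := hx
    exact (map_leftNormed_eq (genEval F d) (genEval F d)
      (fun i => by rw [sub_self]; exact zero_mem _) i hjs).2
  | algebraMap r =>
    rw [AlgHom.commutes, Algebra.algebraMap_eq_smul_one]
    exact Submodule.smul_mem _ _ one_mem_parity
  | add x y _ _ hx hy => rw [map_add]; exact add_mem hx hy
  | mul x y _ _ hx hy =>
    rw [map_mul]
    simpa using parity_mul hx hy

lemma genEval_word_parity (w : List (Fin d)) :
    genEval F d (word F w) ∈ parity F (w.length : ZMod 2) := by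
  induction w with
  | nil =>
    rw [word_nil, map_one, List.length_nil, Nat.cast_zero]
    exact one_mem_parity
  | cons i w ih =>
    rw [word_cons, map_mul, List.length_cons, Nat.cast_succ, add_comm]
    refine parity_mul ?_ ih
    rw [genEval, FreeAlgebra.lift_ι_apply]
    exact CliffordAlgebra.ι_mem_evenOdd_one (0 : QuadraticForm F (ℕ →₀ F)) _

lemma genEval_word (w : List (Fin d)) : genEval F d (word F w) =
    ExteriorAlgebra.ιMulti F w.length fun j => Finsupp.single (w.get j : ℕ) (1 : F) := by
  rw [ExteriorAlgebra.ιMulti_apply, word, map_list_prod, List.map_map]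
  congr 1
  apply List.ext_getElem
  · simp
  · intro k h1 h2
    simp [genEval]

lemma genEval_word_eq_zero {w : List (Fin d)} (hw : ¬ w.Nodup) : genEval F d (word F w) = 0 := by
  rw [genEval_word]
  apply ExteriorAlgebra.ιMulti_eq_zero_of_not_inj
  intro h
  apply hw
  rw [List.nodup_iff_injective_get]
  intro a b hab
  exact h (by simp only [hab])

lemma genEval_word_ne_zero {w : List (Fin d)} (hw : w.Nodup) : genEval F d (word F w) ≠ 0 := by
  classical
  rw [genEval_word]
  let L : (ℕ →₀ F) →ₗ[F] (Fin w.length → F) :=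
    LinearMap.pi fun j => Finsupp.lapply (w.get j : ℕ)
  let g : (ℕ →₀ F) [⋀^Fin w.length]→ₗ[F] F := Matrix.detRowAlternating.compLinearMap L
  intro h
  have h1 := congrArg (ExteriorAlgebra.liftAlternating (R := F) (M := ℕ →₀ F) (N := F)
    (Pi.single w.length g)) h
  rw [ExteriorAlgebra.liftAlternating_apply_ιMulti, Pi.single_eq_same, map_zero] at h1
  have h2 : g (fun j => Finsupp.single (w.get j : ℕ) (1 : F)) = 1 := by
    change Matrix.det _ = 1
    rw [← Matrix.det_one (n := Fin w.length)]
    congr 1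
    ext a b
    have hinj := List.nodup_iff_injective_get.1 hw
    by_cases hab : a = b
    · subst hab
      simp [L]
    · have h3 : (w.get a : ℕ) ≠ w.get b := fun h => hab (hinj (Fin.val_injective h))
      rw [Matrix.one_apply_ne hab]
      exact Finsupp.single_eq_of_ne h3.symm
  exact one_ne_zero (h2.symm.trans h1)

lemma genEval_word_perm {w w' : List (Fin d)} (h : w.Perm w') :
    ∃ c : F, genEval F d (word F w) = c • genEval F d (word F w') := by
  induction h with
  | nil => exact ⟨1, by simp⟩
  | cons x _ ih =>
    obtain ⟨c, hc⟩ := ih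
    exact ⟨c, by rw [word_cons, word_cons, map_mul, hc, map_mul, mul_smul_comm]⟩
  | swap x y l =>
    refine ⟨-1, ?_⟩
    simp only [word_cons, map_mul, genEval, FreeAlgebra.lift_ι_apply, ← mul_assoc]
    rw [eq_neg_of_add_eq_zero_left (ExteriorAlgebra.ι_add_mul_swap _ _), neg_mul, neg_smul,
      one_smul]
  | trans _ _ ih₁ ih₂ =>
    obtain ⟨c, hc⟩ := ih₁
    obtain ⟨c', hc'⟩ := ih₂
    exact ⟨c * c', by rw [hc, hc', smul_smul]⟩

/-- The product of the commutators of consecutive letters of a word of even length. -/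
lemma exists_proper_of_even : ∀ (k : ℕ) (w : List (Fin d)), w.length = 2 * k →
    ∃ g ∈ properPolys F (Fin d), g ∈ multiHom F d (content w) ∧
      genEval F d g = (2 : F) ^ k • genEval F d (word F w) := by
  intro k
  induction k with
  | zero =>
    intro w hw
    obtain rfl : w = [] := List.length_eq_zero_iff.1 hw
    exact ⟨1, one_mem _, by simpa using one_mem_multiHom, by simp⟩
  | succ k ih =>
    intro w hw
    match w, hw with
    | i :: j :: w, hw =>
      obtain ⟨g, hg1, hg2, hg3⟩ := ih w (by simp at hw; omega)
      refine ⟨(FreeAlgebra.ι F i * FreeAlgebra.ι F j - FreeAlgebra.ι F j * FreeAlgebra.ι F i) * g,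
        mul_mem (leftNormed_pair_mem i j) hg1, ?_, ?_⟩
      · rw [content_cons, content_cons, ← add_assoc]
        refine mul_mem_multiHom (sub_mem ?_ ?_) hg2
        · exact mul_mem_multiHom (ι_mem_multiHom i) (ι_mem_multiHom j)
        · rw [add_comm]
          exact mul_mem_multiHom (ι_mem_multiHom j) (ι_mem_multiHom i)
      · have h1 : genEval F d (FreeAlgebra.ι F j) * genEval F d (FreeAlgebra.ι F i) =
            -(genEval F d (FreeAlgebra.ι F i) * genEval F d (FreeAlgebra.ι F j)) := by
          simp only [genEval, FreeAlgebra.lift_ι_apply]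
          exact eq_neg_of_add_eq_zero_left (ExteriorAlgebra.ι_add_mul_swap _ _)
        rw [map_mul, map_sub, map_mul, map_mul, hg3, h1, word_cons, word_cons, map_mul, map_mul,
          sub_neg_eq_add, ← two_smul F, pow_succ', mul_smul, mul_smul_comm, smul_mul_assoc,
          mul_assoc, smul_comm]

open Classical in
/-- The proper Hilbert series of the Grassmann algebra is the sum of the elementary symmetric
polynomials of even degree. -/
lemma coeff_properHilbert_grassmann [CharZero F] (n : Fin d →₀ ℕ) :
    MvPowerSeries.coeff n (properHilbert F (Grassmann F) d) =
      if (∀ i, n i ≤ 1) ∧ Even (∑ i, n i) then 1 else 0 := by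
  rw [coeff_properHilbert, finrank_map_eq_of_ker_eq _ _ (genEval F d).toLinearMap]
  swap
  · intro f hf
    rw [Submodule.mkQ_apply, Submodule.Quotient.mk_eq_zero, proper_mem_identities_iff hf.1,
      AlgHom.toLinearMap_apply]
  set S := (Subalgebra.toSubmodule (properPolys F (Fin d)) ⊓ multiHom F d n).map
    (genEval F d).toLinearMap with hS
  by_cases h1 : ∀ i, n i ≤ 1
  swap
  · rw [if_neg fun h => h1 h.1]
    have h0 : S = ⊥ := by
      rw [eq_bot_iff]
      rintro _ ⟨f, hf, rfl⟩
      refine map_multiHom_le (f := (genEval F d).toLinearMap) ?_ hf.2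
      intro w hw
      rw [Submodule.mem_bot]
      apply genEval_word_eq_zero
      intro hnd
      apply h1
      intro i
      rw [← hw]
      exact List.nodup_iff_count_le_one.1 hnd i
    rw [h0, finrank_bot]
    rfl
  by_cases h2 : Even (∑ i, n i)
  swap
  · rw [if_neg fun h => h2 h.2]
    have h0 : S = ⊥ := by
      rw [eq_bot_iff]
      rintro _ ⟨f, hf, rfl⟩
      have hodd : (genEval F d).toLinearMap f ∈ parity F 1 := by
        refine map_multiHom_le (f := (genEval F d).toLinearMap) ?_ hf.2
        intro w hw
        have h3 := genEval_word_parity (F := F) w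
        rw [length_eq_of_content hw] at h3
        have h4 : ((∑ i, n i : ℕ) : ZMod 2) = 1 :=
          ZMod.natCast_eq_one_iff_odd.2 (Nat.not_even_iff_odd.1 h2)
        rwa [h4] at h3
      exact (CliffordAlgebra.evenOdd_isCompl (0 : QuadraticForm F (ℕ →₀ F))).disjoint.le_bot
        ⟨genEval_proper_even hf.1, hodd⟩
    rw [h0, finrank_bot]
    rfl
  rw [if_pos ⟨h1, h2⟩]
  let w₀ : List (Fin d) := (List.finRange d).filter fun i => n i = 1
  have hw₀ : w₀.Nodup := (List.nodup_finRange d).filter _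
  have hc₀ : content w₀ = n := by
    ext i
    have h3 := h1 i
    rw [content_apply]
    by_cases hi : n i = 1
    · rw [hi]
      exact List.count_eq_one_of_mem hw₀ (by simp [w₀, hi])
    · rw [List.count_eq_zero_of_not_mem (by simp [w₀, hi])]
      omega
  have hspan : S = Submodule.span F {genEval F d (word F w₀)} := by
    apply le_antisymm
    · rintro _ ⟨f, hf, rfl⟩
      refine map_multiHom_le (f := (genEval F d).toLinearMap) ?_ hf.2
      intro w hw
      have hperm : w.Perm w₀ := by
        rw [List.perm_iff_count]
        intro i
        rw [← content_apply, ← content_apply, hw, hc₀]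
      obtain ⟨c, hc⟩ := genEval_word_perm (F := F) hperm
      rw [AlgHom.toLinearMap_apply, hc]
      exact Submodule.smul_mem _ _ (Submodule.mem_span_singleton_self _)
    · rw [Submodule.span_singleton_le_iff_mem]
      obtain ⟨k, hk⟩ := h2
      obtain ⟨g, hg1, hg2, hg3⟩ := exists_proper_of_even (F := F) k w₀
        (by rw [length_eq_of_content hc₀, hk, two_mul])
      rw [hc₀] at hg2
      have h3 : (genEval F d).toLinearMap g ∈ S := ⟨g, ⟨hg1, hg2⟩, rfl⟩
      rw [AlgHom.toLinearMap_apply, hg3] at h3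
      exact (Submodule.smul_mem_iff _ (pow_ne_zero _ two_ne_zero)).1 h3
  rw [hspan, finrank_span_singleton (genEval_word_ne_zero hw₀)]
  rfl

end GrassmannAlgebra

/-! ### Horizontal strips and the branching rule for semistandard tableaux -/

section Branching

/-- The skew shape `μ / ν` is a horizontal strip: it has at most one cell in each column. -/
def HStrip (ν μ : YoungDiagram) : Prop :=
  ν ≤ μ ∧ ∀ i j, (i + 1, j) ∈ μ → (i, j) ∈ ν

lemma finite_card_eq (N : ℕ) : {μ : YoungDiagram | μ.card = N}.Finite := by
  refine Set.Finite.of_finite_image (f := YoungDiagram.cells)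
    (((Finset.range N ×ˢ Finset.range N).powerset.finite_toSet).subset ?_)
    (fun μ _ ν _ h => YoungDiagram.ext h)
  rintro _ ⟨μ, hμ, rfl⟩
  simp only [Finset.coe_powerset, Set.mem_preimage, Set.mem_powerset_iff, Finset.coe_subset]
  rintro ⟨i, j⟩ hij
  have hμ : μ.cells.card = N := hμ
  have hij' : (i, j) ∈ μ := (YoungDiagram.mem_cells _).1 hij
  rw [Finset.mem_product, Finset.mem_range, Finset.mem_range]
  constructor
  · have h : μ.col j ⊆ μ.cells := Finset.filter_subset _ _
    have h1 := Finset.card_le_card h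
    rw [← YoungDiagram.colLen_eq_card] at h1
    have h2 := YoungDiagram.mem_iff_lt_colLen.1 hij'
    simp only
    omega
  · have h : μ.row i ⊆ μ.cells := Finset.filter_subset _ _
    have h1 := Finset.card_le_card h
    rw [← YoungDiagram.rowLen_eq_card] at h1
    have h2 := YoungDiagram.mem_iff_lt_rowLen.1 hij'
    simp only
    omega

/-- The finite set of Young diagrams with `N` cells. -/
def diagrams (N : ℕ) : Finset YoungDiagram := (finite_card_eq N).toFinset

@[simp] lemma mem_diagrams {N : ℕ} {μ : YoungDiagram} : μ ∈ diagrams N ↔ μ.card = N := by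
  simp [diagrams]

/-- Semistandard tableaux of shape `μ` with entries below `d` and content `c`. -/
def Tab (d : ℕ) (c : ℕ → ℕ) (μ : YoungDiagram) : Type :=
  {T : SemistandardYoungTableau μ // (∀ x ∈ μ.cells, T x.1 x.2 < d) ∧
    ∀ a < d, (μ.cells.filter fun x => T x.1 x.2 = a).card = c a}

instance (d : ℕ) (c : ℕ → ℕ) (μ : YoungDiagram) : Finite (Tab d c μ) := by
  refine Finite.of_injective
    (fun (T : Tab d c μ) (x : μ.cells) => (⟨T.1 x.1.1 x.1.2, T.2.1 x.1 x.2⟩ : Fin d)) ?_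
  intro T T' h
  apply Subtype.ext
  apply SemistandardYoungTableau.ext
  intro i j
  by_cases hij : (i, j) ∈ μ
  · exact congrArg Fin.val (congrFun h ⟨(i, j), hij⟩)
  · rw [T.1.zeros hij, T'.1.zeros hij]

/-- The number of semistandard tableaux of shape `μ` with entries below `d` and content `c`. -/
def tabCount (d : ℕ) (c : ℕ → ℕ) (μ : YoungDiagram) : ℕ := Nat.card (Tab d c μ)

lemma tabCount_eq_zero {d : ℕ} {c : ℕ → ℕ} {μ : YoungDiagram}
    (h : μ.card ≠ ∑ a ∈ Finset.range d, c a) : tabCount d c μ = 0 := by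
  rw [tabCount, Nat.card_eq_zero]
  left
  constructor
  rintro ⟨T, hT1, hT2⟩
  apply h
  change μ.cells.card = _
  rw [Finset.card_eq_sum_card_fiberwise (f := fun x => T x.1 x.2) (t := Finset.range d)]
  · exact Finset.sum_congr rfl fun a ha => hT2 a (Finset.mem_range.1 ha)
  · intro x hx
    simpa using hT1 x hx

/-- Filling a horizontal strip with the entry `d`. -/
def extendTab {d : ℕ} {c : ℕ → ℕ} {ν μ : YoungDiagram} (h : HStrip ν μ)
    (hc : ν.card + c d = μ.card) (T : Tab d c ν) : Tab (d + 1) c μ := by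
  classical
  refine ⟨⟨fun i j => if (i, j) ∈ ν then T.1 i j else if (i, j) ∈ μ then d else 0, ?_, ?_, ?_⟩,
    ?_, ?_⟩
  · intro i j1 j2 hj hij
    by_cases h2 : (i, j2) ∈ ν
    · have h1 : (i, j1) ∈ ν := ν.up_left_mem le_rfl hj.le h2
      simp only [h1, h2, if_true]
      exact T.1.row_weak hj h2
    · simp only [h2, if_false, hij, if_true]
      split_ifs with h1 h3
      · exact (T.2.1 _ h1).le
      · exact le_rfl
      · exact Nat.zero_le _
  · intro i1 i2 j hi hij
    have h1 : (i1, j) ∈ ν := h.2 i1 j (μ.up_left_mem hi le_rfl hij)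
    by_cases h2 : (i2, j) ∈ ν
    · simp only [h1, h2, if_true]
      exact T.1.col_strict hi h2
    · simp only [h1, h2, if_true, if_false, hij]
      exact T.2.1 _ h1
  · intro i j hij
    have h1 : (i, j) ∉ ν := fun h' => hij (h.1 h')
    simp [h1, hij]
  · intro x hx
    change (if x ∈ ν then T.1 x.1 x.2 else if x ∈ μ then d else 0) < d + 1
    split_ifs with h1
    · exact Nat.lt_succ_of_lt (T.2.1 x h1)
    · exact Nat.lt_succ_self d
    · exact Nat.succ_pos d
  · intro a ha
    change (μ.cells.filter fun x =>
      (if x ∈ ν then T.1 x.1 x.2 else if x ∈ μ then d else 0) = a).card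
      = c a
    by_cases had : a < d
    · rw [← T.2.2 a had]
      congr 1
      ext x
      simp only [Finset.mem_filter, YoungDiagram.mem_cells]
      by_cases hx : x ∈ ν
      · simp [hx, h.1 hx]
      · simp only [hx, if_false, false_and, iff_false, not_and]
        intro hxμ
        rw [if_pos hxμ]
        omega
    · obtain rfl : a = d := by omega
      have e : (μ.cells.filter fun x =>
          (if x ∈ ν then T.1 x.1 x.2 else if x ∈ μ then a else 0) = a) = μ.cells \ ν.cells := by
        ext x
        simp only [Finset.mem_filter, Finset.mem_sdiff, YoungDiagram.mem_cells]
        refine and_congr_right fun hx => ?_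
        by_cases hxν : x ∈ ν
        · simp only [hxν, if_true, not_true_eq_false, iff_false]
          exact (T.2.1 x hxν).ne
        · simp [hxν, hx]
      rw [e, Finset.card_sdiff_of_subset (YoungDiagram.cells_subset_iff.2 h.1)]
      change μ.card - ν.card = _
      omega

open Classical in
lemma extendTab_apply {d : ℕ} {c : ℕ → ℕ} {ν μ : YoungDiagram} (h : HStrip ν μ)
    (hc : ν.card + c d = μ.card) (T : Tab d c ν) (i j : ℕ) :
    (extendTab h hc T).1 i j = if (i, j) ∈ ν then T.1 i j else if (i, j) ∈ μ then d else 0 := by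
  unfold extendTab
  change (if _ then _ else if _ then _ else _) = _
  congr

lemma mem_iff_extendTab_lt {d : ℕ} {c : ℕ → ℕ} {ν μ : YoungDiagram} (h : HStrip ν μ)
    (hc : ν.card + c d = μ.card) (T : Tab d c ν) (i j : ℕ) :
    (i, j) ∈ ν ↔ (i, j) ∈ μ ∧ (extendTab h hc T).1 i j < d := by
  classical
  rw [extendTab_apply]
  by_cases h1 : (i, j) ∈ ν
  · simp only [h1, if_true, true_iff]
    exact ⟨h.1 h1, T.2.1 _ h1⟩
  · simp only [h1, if_false, false_iff, not_and]
    intro h2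
    simp [h2]

open Classical in
/-- Branching rule: removing the largest entry from a semistandard tableau. -/
lemma tabCount_succ {d : ℕ} {c : ℕ → ℕ} {μ : YoungDiagram} {N : ℕ} (hμ : μ.card = N + c d) :
    tabCount (d + 1) c μ = ∑ ν ∈ (diagrams N).filter fun ν => HStrip ν μ, tabCount d c ν := by
  set S := (diagrams N).filter fun ν => HStrip ν μ with hS
  have hmem : ∀ ν, ν ∈ S ↔ ν.card = N ∧ HStrip ν μ := by
    intro ν
    simp [hS]
  let f : (Σ ν : S, Tab d c ν.1) → Tab (d + 1) c μ := fun x =>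
    extendTab ((hmem _).1 x.1.2).2 (by rw [hμ, ((hmem _).1 x.1.2).1]) x.2
  have hf : Function.Bijective f := by
    constructor
    · rintro ⟨⟨ν₁, h₁⟩, T₁⟩ ⟨⟨ν₂, h₂⟩, T₂⟩ h
      have hν : ν₁ = ν₂ := by
        apply YoungDiagram.ext
        ext ⟨i, j⟩
        rw [YoungDiagram.mem_cells, YoungDiagram.mem_cells,
          mem_iff_extendTab_lt ((hmem _).1 h₁).2 (by rw [hμ, ((hmem _).1 h₁).1]) T₁,
          mem_iff_extendTab_lt ((hmem _).1 h₂).2 (by rw [hμ, ((hmem _).1 h₂).1]) T₂]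
        have h' : extendTab _ _ T₁ = extendTab _ _ T₂ := h
        rw [h']
      subst hν
      have hT : T₁ = T₂ := by
        apply Subtype.ext
        apply SemistandardYoungTableau.ext
        intro i j
        by_cases hij : (i, j) ∈ ν₁
        · have h' : (extendTab _ _ T₁).1 i j = (extendTab _ _ T₂).1 i j :=
            congrArg (fun T : Tab (d + 1) c μ => T.1 i j) h
          rw [extendTab_apply, extendTab_apply, if_pos hij, if_pos hij] at h'
          exact h'
        · rw [T₁.1.zeros hij, T₂.1.zeros hij]
      rw [hT]
    · intro T
      have hle : ∀ i1 i2 j1 j2, i1 ≤ i2 → j1 ≤ j2 → (i2, j2) ∈ μ → T.1 i1 j1 ≤ T.1 i2 j2 := by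
        intro i1 i2 j1 j2 hi hj h
        exact (T.1.row_weak_of_le hj (μ.up_left_mem hi le_rfl h)).trans (T.1.col_weak hi h)
      let ν : YoungDiagram := ⟨μ.cells.filter fun x => T.1 x.1 x.2 < d, by
        intro x y hyx hx
        simp only [Finset.coe_filter, Set.mem_ofPred_eq, YoungDiagram.mem_cells] at hx ⊢
        exact ⟨μ.up_left_mem hyx.1 hyx.2 hx.1, (hle _ _ _ _ hyx.1 hyx.2 hx.1).trans_lt hx.2⟩⟩
      have hν : ∀ i j, (i, j) ∈ ν ↔ (i, j) ∈ μ ∧ T.1 i j < d := by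
        intro i j
        rw [← YoungDiagram.mem_cells]
        simp [ν]
      have hT1 : ∀ i j, (i, j) ∈ μ → (i, j) ∉ ν → T.1 i j = d := by
        intro i j h1 h2
        have h3 := T.2.1 (i, j) h1
        have h4 : ¬ T.1 i j < d := fun h => h2 ((hν i j).2 ⟨h1, h⟩)
        simp only at h3
        omega
      have hstrip : HStrip ν μ := by
        refine ⟨fun x hx => ((hν x.1 x.2).1 hx).1, fun i j hij => (hν i j).2 ⟨?_, ?_⟩⟩
        · exact μ.up_left_mem (Nat.le_succ i) le_rfl hij
        · have h1 : T.1 i j < T.1 (i + 1) j := T.1.col_strict (Nat.lt_succ_self i) hij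
          have h2 := T.2.1 (i + 1, j) hij
          simp only at h2
          omega
      have hcard : ν.card + c d = μ.card := by
        rw [← T.2.2 d (Nat.lt_succ_self d)]
        change (μ.cells.filter fun x => T.1 x.1 x.2 < d).card + _ = μ.cells.card
        rw [← Finset.card_filter_add_card_filter_not (s := μ.cells) (fun x => T.1 x.1 x.2 < d)]
        congr 2
        refine Finset.filter_congr fun x hx => ?_
        have := T.2.1 x hx
        omega
      have hνS : ν ∈ S := (hmem ν).2 ⟨by omega, hstrip⟩
      let T' : Tab d c ν := by
        refine ⟨⟨fun i j => if (i, j) ∈ ν then T.1 i j else 0, ?_, ?_, ?_⟩, ?_, ?_⟩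
        · intro i j1 j2 hj hij
          have h1 : (i, j1) ∈ ν := ν.up_left_mem le_rfl hj.le hij
          simp only [h1, hij, if_true]
          exact T.1.row_weak hj ((hν _ _).1 hij).1
        · intro i1 i2 j hi hij
          have h1 : (i1, j) ∈ ν := ν.up_left_mem hi.le le_rfl hij
          simp only [h1, hij, if_true]
          exact T.1.col_strict hi ((hν _ _).1 hij).1
        · intro i j hij
          simp [hij]
        · intro x hx
          change (if x ∈ ν then T.1 x.1 x.2 else 0) < d
          rw [if_pos ((YoungDiagram.mem_cells x).1 hx)]
          exact ((hν x.1 x.2).1 hx).2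
        · intro a ha
          rw [← T.2.2 a (Nat.lt_succ_of_lt ha)]
          congr 1
          ext x
          change x ∈ ν.cells.filter (fun x => (if x ∈ ν then T.1 x.1 x.2 else 0) = a) ↔ _
          simp only [Finset.mem_filter, YoungDiagram.mem_cells]
          constructor
          · rintro ⟨h1, h2⟩
            rw [if_pos h1] at h2
            exact ⟨hstrip.1 h1, h2⟩
          · rintro ⟨h1, h2⟩
            have h3 : x ∈ ν := (hν x.1 x.2).2 ⟨h1, by omega⟩
            exact ⟨h3, by rw [if_pos h3, h2]⟩
      refine ⟨⟨⟨ν, hνS⟩, T'⟩, ?_⟩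
      apply Subtype.ext
      apply SemistandardYoungTableau.ext
      intro i j
      refine (extendTab_apply hstrip hcard T' i j).trans ?_
      split_ifs with h1 h2
      · change (if (i, j) ∈ ν then T.1 i j else 0) = _
        rw [if_pos h1]
      · exact (hT1 i j h2 h1).symm
      · exact (T.1.zeros h2).symm
  unfold tabCount
  rw [← Nat.card_eq_of_bijective f hf, Nat.card_sigma, Finset.sum_coe_sort S
    fun ν => Nat.card (Tab d c ν)]

lemma tabCount_zero_bot (c : ℕ → ℕ) : tabCount 0 c ⊥ = 1 := by
  rw [tabCount, Nat.card_eq_one_iff_unique]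
  constructor
  · constructor
    intro T T'
    apply Subtype.ext
    apply SemistandardYoungTableau.ext
    intro i j
    rw [T.1.zeros (YoungDiagram.notMem_bot _), T'.1.zeros (YoungDiagram.notMem_bot _)]
  · exact ⟨⟨⟨fun _ _ => 0, by intros; simp, fun _ h => absurd h (YoungDiagram.notMem_bot _),
      fun _ => rfl⟩, fun x hx => by simp at hx, fun a ha => absurd ha (Nat.not_lt_zero a)⟩⟩

open Classical in
/-- The adjoint of multiplication by the complete symmetric function `h_r`, on functions of
partitions: the sum of the values of `a` at the diagrams obtained by adding a horizontal strip of
size `r`. -/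
def skew (r : ℕ) (a : YoungDiagram → ℤ) (ν : YoungDiagram) : ℤ :=
  ∑ μ ∈ (diagrams (ν.card + r)).filter fun μ => HStrip ν μ, a μ

/-- The coefficient of `t^c` in `∑ a(μ) S_μ(t_0, …, t_{d-1})`. -/
def schurSum : ℕ → (ℕ → ℕ) → (YoungDiagram → ℤ) → ℤ
  | 0, _, a => a ⊥
  | d + 1, c, a => schurSum d c (skew (c d) a)

/-- The iterated branching rule. -/
lemma sum_mul_tabCount (d : ℕ) (c : ℕ → ℕ) (a : YoungDiagram → ℤ) :
    ∑ μ ∈ diagrams (∑ k ∈ Finset.range d, c k), a μ * tabCount d c μ = schurSum d c a := by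
  classical
  induction d generalizing a with
  | zero =>
    have h : diagrams (∑ k ∈ Finset.range 0, c k) = {⊥} := by
      ext μ
      rw [mem_diagrams, Finset.sum_range_zero, Finset.mem_singleton]
      constructor
      · intro h
        apply YoungDiagram.ext
        rw [YoungDiagram.cells_bot]
        exact Finset.card_eq_zero.1 h
      · rintro rfl
        rfl
    rw [h, Finset.sum_singleton, tabCount_zero_bot]
    simp [schurSum]
  | succ d ih =>
    rw [schurSum, ← ih, Finset.sum_range_succ]
    set N := ∑ k ∈ Finset.range d, c k
    have h1 : ∀ μ ∈ diagrams (N + c d), a μ * tabCount (d + 1) c μ =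
        ∑ ν ∈ diagrams N, if HStrip ν μ then a μ * tabCount d c ν else 0 := by
      intro μ hμ
      rw [tabCount_succ (mem_diagrams.1 hμ), ← Finset.sum_filter, Nat.cast_sum, Finset.mul_sum]
    rw [Finset.sum_congr rfl h1, Finset.sum_comm]
    refine Finset.sum_congr rfl fun ν hν => ?_
    rw [skew, mem_diagrams.1 hν, Finset.sum_mul, Finset.sum_filter]

lemma skew_add (r : ℕ) (a b : YoungDiagram → ℤ) : skew r (a + b) = skew r a + skew r b := by
  funext ν
  simp [skew, Finset.sum_add_distrib]

lemma skew_smul (r : ℕ) (k : ℤ) (a : YoungDiagram → ℤ) : skew r (k • a) = k • skew r a := by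
  funext ν
  simp [skew, Finset.mul_sum]

lemma schurSum_add (d : ℕ) (c : ℕ → ℕ) (a b : YoungDiagram → ℤ) :
    schurSum d c (a + b) = schurSum d c a + schurSum d c b := by
  induction d generalizing a b with
  | zero => rfl
  | succ d ih => rw [schurSum, schurSum, schurSum, skew_add, ih]

lemma schurSum_smul (d : ℕ) (c : ℕ → ℕ) (k : ℤ) (a : YoungDiagram → ℤ) :
    schurSum d c (k • a) = k • schurSum d c a := by
  induction d generalizing a with
  | zero => rfl
  | succ d ih => rw [schurSum, schurSum, skew_smul, ih]

lemma schurSum_congr {d : ℕ} {c c' : ℕ → ℕ} (h : ∀ i < d, c i = c' i) (a : YoungDiagram → ℤ) :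
    schurSum d c a = schurSum d c' a := by
  induction d generalizing a with
  | zero => rfl
  | succ d ih =>
    rw [schurSum, schurSum, h d (Nat.lt_succ_self d), ih fun i hi => h i (Nat.lt_succ_of_lt hi)]

/-- A function of partitions that is an eigenvector of all the operators `skew r` is the expansion
of a product of series in the single variables. -/
lemma schurSum_of_eigen {a : YoungDiagram → ℤ} {γ : ℕ → ℤ} (h : ∀ r, skew r a = γ r • a)
    (h0 : a ⊥ = 1) (d : ℕ) (c : ℕ → ℕ) :
    schurSum d c a = ∏ i ∈ Finset.range d, γ (c i) := by
  induction d with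
  | zero => simp [schurSum, h0]
  | succ d ih =>
    rw [schurSum, h, schurSum_smul, ih, Finset.prod_range_succ, smul_eq_mul, mul_comm]

end Branching

/-! ### Adding and removing boxes -/

section Boxes

lemma ext_rowLen {μ ν : YoungDiagram} (h : ∀ i, μ.rowLen i = ν.rowLen i) : μ = ν := by
  apply YoungDiagram.ext
  ext ⟨i, j⟩
  rw [YoungDiagram.mem_cells, YoungDiagram.mem_cells, YoungDiagram.mem_iff_lt_rowLen,
    YoungDiagram.mem_iff_lt_rowLen, h]

lemma exists_rowLen_eq {f : ℕ → ℕ} (hf : Antitone f) {N : ℕ} (hN : f N = 0) :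
    ∃ μ : YoungDiagram, ∀ i, μ.rowLen i = f i := by
  let μ : YoungDiagram := ⟨(Finset.range N ×ˢ Finset.range (f 0)).filter fun x => x.2 < f x.1, by
    rintro ⟨i, j⟩ ⟨i', j'⟩ ⟨hi, hj⟩ hx
    simp only [Finset.coe_filter, Finset.mem_product, Finset.mem_range, Set.mem_ofPred_eq] at *
    exact ⟨⟨by omega, by omega⟩, (hj.trans_lt hx.2).trans_le (hf hi)⟩⟩
  have hμ : ∀ i j, (i, j) ∈ μ ↔ j < f i := by
    intro i j
    rw [← YoungDiagram.mem_cells]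
    simp only [μ, Finset.mem_filter, Finset.mem_product, Finset.mem_range, and_iff_right_iff_imp]
    intro h
    refine ⟨?_, h.trans_le (hf (Nat.zero_le i))⟩
    by_contra hi
    have := hf (Nat.le_of_not_lt hi)
    omega
  refine ⟨μ, fun i => ?_⟩
  have h : ∀ j, j < μ.rowLen i ↔ j < f i := fun j => by
    rw [← YoungDiagram.mem_iff_lt_rowLen, hμ]
  have h1 := h (f i)
  have h2 := h (μ.rowLen i)
  omega

lemma rowLen_colLen_zero (μ : YoungDiagram) : μ.rowLen (μ.colLen 0) = 0 := by
  by_contra h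
  have h1 : (μ.colLen 0, 0) ∈ μ := YoungDiagram.mem_iff_lt_rowLen.2 (Nat.pos_of_ne_zero h)
  exact lt_irrefl _ (YoungDiagram.mem_iff_lt_colLen.1 h1)

lemma le_iff_rowLen {ν μ : YoungDiagram} : ν ≤ μ ↔ ∀ i, ν.rowLen i ≤ μ.rowLen i := by
  constructor
  · intro h i
    by_contra hi
    have h1 : (i, μ.rowLen i) ∈ ν := YoungDiagram.mem_iff_lt_rowLen.2 (by omega)
    exact lt_irrefl _ (YoungDiagram.mem_iff_lt_rowLen.1 (h h1))
  · rintro h ⟨i, j⟩ hij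
    exact YoungDiagram.mem_iff_lt_rowLen.2 ((YoungDiagram.mem_iff_lt_rowLen.1 hij).trans_le (h i))

lemma hStrip_iff_rowLen {ν μ : YoungDiagram} :
    HStrip ν μ ↔ (∀ i, ν.rowLen i ≤ μ.rowLen i) ∧ ∀ i, μ.rowLen (i + 1) ≤ ν.rowLen i := by
  unfold HStrip
  rw [le_iff_rowLen]
  refine and_congr_right fun _ => ⟨fun h i => ?_, fun h i j hij => ?_⟩
  · by_contra hi
    have h1 := h i (ν.rowLen i) (YoungDiagram.mem_iff_lt_rowLen.2 (by omega))
    exact lt_irrefl _ (YoungDiagram.mem_iff_lt_rowLen.1 h1)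
  · exact YoungDiagram.mem_iff_lt_rowLen.2 ((YoungDiagram.mem_iff_lt_rowLen.1 hij).trans_le (h i))

/-- The diagram `μ` is obtained from `κ` by adding a box to the row `i`. -/
def AddBox (κ : YoungDiagram) (i : ℕ) (μ : YoungDiagram) : Prop :=
  ∀ k, μ.rowLen k = κ.rowLen k + if k = i then 1 else 0

lemma AddBox.le {κ μ : YoungDiagram} {i : ℕ} (h : AddBox κ i μ) : κ ≤ μ :=
  le_iff_rowLen.2 fun k => by rw [h k]; exact Nat.le_add_right _ _

lemma AddBox.card {κ μ : YoungDiagram} {i : ℕ} (h : AddBox κ i μ) : μ.card = κ.card + 1 := by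
  have h1 : μ.cells = insert (i, κ.rowLen i) κ.cells := by
    ext ⟨a, b⟩
    rw [Finset.mem_insert, YoungDiagram.mem_cells, YoungDiagram.mem_cells,
      YoungDiagram.mem_iff_lt_rowLen, YoungDiagram.mem_iff_lt_rowLen, h a, Prod.mk.injEq]
    split_ifs with ha
    · subst ha
      simp only [true_and]
      omega
    · simp [ha]
  change μ.cells.card = κ.cells.card + 1
  rw [h1, Finset.card_insert_of_notMem]
  rw [YoungDiagram.mem_cells, YoungDiagram.mem_iff_lt_rowLen]
  exact lt_irrefl _

lemma exists_addBox {κ μ : YoungDiagram} (hle : κ ≤ μ) (hc : μ.card = κ.card + 1) :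
    ∃ i, AddBox κ i μ := by
  have h1 : (μ.cells \ κ.cells).card = 1 := by
    rw [Finset.card_sdiff_of_subset (YoungDiagram.cells_subset_iff.2 hle)]
    change μ.card - κ.card = 1
    omega
  obtain ⟨⟨i, j⟩, hx⟩ := Finset.card_eq_one.1 h1
  have hm : ∀ a b, b < μ.rowLen a ∧ ¬ b < κ.rowLen a ↔ a = i ∧ b = j := by
    intro a b
    rw [← YoungDiagram.mem_iff_lt_rowLen, ← YoungDiagram.mem_iff_lt_rowLen,
      ← YoungDiagram.mem_cells, ← YoungDiagram.mem_cells, ← Finset.mem_sdiff, hx,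
      Finset.mem_singleton, Prod.mk.injEq]
  have hle' := le_iff_rowLen.1 hle
  refine ⟨i, fun k => ?_⟩
  have h2 := hle' k
  split_ifs with hk
  · subst hk
    have h3 := (hm k j).2 ⟨rfl, rfl⟩
    have h4 := (hm k (κ.rowLen k)).1 ⟨by omega, by omega⟩
    by_contra h5
    have h6 := (hm k (κ.rowLen k + 1)).1 ⟨by omega, by omega⟩
    omega
  · by_contra h5
    exact hk ((hm k (κ.rowLen k)).1 ⟨by omega, by omega⟩).1

lemma exists_addBox_above {κ : YoungDiagram} {i : ℕ}
    (h : ∀ k, k + 1 = i → κ.rowLen i < κ.rowLen k) : ∃ μ, AddBox κ i μ := by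
  have hf : Antitone fun k => κ.rowLen k + if k = i then 1 else 0 := by
    refine antitone_nat_of_succ_le fun k => ?_
    have h1 := κ.rowLen_anti k (k + 1) (Nat.le_succ k)
    have h2 := h k
    split_ifs with h3 h4 h4
    · omega
    · have := h2 h3
      rw [← h3] at this
      omega
    · omega
    · omega
  have hN : (fun k => κ.rowLen k + if k = i then 1 else 0) (κ.colLen 0 + i + 1) = 0 := by
    have h1 := κ.rowLen_anti (κ.colLen 0) (κ.colLen 0 + i + 1) (by omega)
    rw [rowLen_colLen_zero] at h1
    simp only
    rw [if_neg (by omega)]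
    omega
  exact exists_rowLen_eq hf hN

lemma exists_addBox_below {ν : YoungDiagram} {j : ℕ} (h : ν.rowLen (j + 1) < ν.rowLen j) :
    ∃ ρ, AddBox ρ j ν := by
  have hf : Antitone fun k => ν.rowLen k - if k = j then 1 else 0 := by
    refine antitone_nat_of_succ_le fun k => ?_
    have h1 := ν.rowLen_anti k (k + 1) (Nat.le_succ k)
    split_ifs with h3 h4 h4
    · omega
    · omega
    · subst h4
      omega
    · omega
  have hN : (fun k => ν.rowLen k - if k = j then 1 else 0) (ν.colLen 0) = 0 := by
    simp only [rowLen_colLen_zero]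
    omega
  obtain ⟨ρ, hρ⟩ := exists_rowLen_eq hf hN
  refine ⟨ρ, fun k => ?_⟩
  rw [hρ]
  split_ifs with hk
  · subst hk
    omega
  · omega

lemma AddBox.unique_above {κ μ μ' : YoungDiagram} {i : ℕ} (h : AddBox κ i μ) (h' : AddBox κ i μ') :
    μ = μ' := ext_rowLen fun k => by rw [h k, h' k]

lemma AddBox.unique_below {κ κ' μ : YoungDiagram} {i : ℕ} (h : AddBox κ i μ) (h' : AddBox κ' i μ) :
    κ = κ' := ext_rowLen fun k => by
  have h1 := h k
  have h2 := h' k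
  omega

lemma AddBox.row_unique {κ μ : YoungDiagram} {i i' : ℕ} (h : AddBox κ i μ) (h' : AddBox κ i' μ) :
    i = i' := by
  have h1 := h i
  have h2 := h' i
  by_contra hne
  rw [if_pos rfl] at h1
  rw [if_neg hne] at h2
  omega

open Classical in
/-- Multiplication by `S_{(1)}` on the coefficients of an expansion into Schur functions: the sum
of the values of `a` at the diagrams obtained by removing a box. -/
def lower (a : YoungDiagram → ℤ) (μ : YoungDiagram) : ℤ :=
  ∑ κ ∈ (diagrams (μ.card - 1)).filter fun κ => κ ≤ μ ∧ κ.card + 1 = μ.card, a κ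

open Classical in
/-- The local form of the Pieri rule: the numbers of ways to pass from `ν` to `κ` by adding a
horizontal strip and then removing a box, or in the other order, differ by one exactly when `κ / ν`
is a horizontal strip. -/
lemma card_strip_box {κ ν : YoungDiagram} :
    ((diagrams (κ.card + 1)).filter fun μ => κ ≤ μ ∧ HStrip ν μ).card =
      ((diagrams (ν.card - 1)).filter fun ρ => (ρ ≤ ν ∧ ρ.card + 1 = ν.card) ∧ HStrip ρ κ).card +
        if HStrip ν κ then 1 else 0 := by
  set U := (diagrams (κ.card + 1)).filter fun μ => κ ≤ μ ∧ HStrip ν μ with hU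
  set P := (diagrams (ν.card - 1)).filter fun ρ => (ρ ≤ ν ∧ ρ.card + 1 = ν.card) ∧ HStrip ρ κ
    with hP
  have hmU : ∀ μ, μ ∈ U ↔ μ.card = κ.card + 1 ∧ κ ≤ μ ∧ HStrip ν μ := by
    intro μ
    simp [hU]
  have hmP : ∀ ρ, ρ ∈ P ↔ (ρ ≤ ν ∧ ρ.card + 1 = ν.card) ∧ HStrip ρ κ := by
    intro ρ
    simp only [hP, Finset.mem_filter, mem_diagrams, and_iff_right_iff_imp]
    omega
  by_cases hs : HStrip ν κ
  · rw [if_pos hs]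
    rw [hStrip_iff_rowLen] at hs
    -- the rows of `ν` from which a box can be removed so that `κ / ρ` stays a horizontal strip
    let J := (Finset.range (ν.colLen 0)).filter fun j => κ.rowLen (j + 1) < ν.rowLen j
    have hJ : ∀ j, j ∈ J ↔ κ.rowLen (j + 1) < ν.rowLen j := by
      intro j
      simp only [J, Finset.mem_filter, Finset.mem_range, and_iff_right_iff_imp]
      intro h
      by_contra hj
      have h1 := ν.rowLen_anti (ν.colLen 0) j (by omega)
      rw [rowLen_colLen_zero] at h1
      omega
    have hPJ : P.card = J.card := by
      symm
      have hex : ∀ j ∈ J, ∃ ρ, AddBox ρ j ν := fun j hj =>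
        exists_addBox_below ((hs.1 (j + 1)).trans_lt ((hJ j).1 hj))
      choose! g hg using hex
      refine Finset.card_bij (fun j _ => g j) ?_ ?_ ?_
      · intro j hj
        refine (hmP _).2 ⟨⟨(hg j hj).le, (hg j hj).card.symm⟩, hStrip_iff_rowLen.2 ⟨fun k => ?_,
          fun k => ?_⟩⟩
        · have := hg j hj k
          have := hs.1 k
          omega
        · have h1 := hg j hj k
          have h2 := hs.2 k
          have h3 := (hJ j).1 hj
          split_ifs at h1 with hk
          · subst hk
            omega
          · omega
      · intro j hj j' hj' h
        have h1 := hg j' hj'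
        rw [← h] at h1
        exact (hg j hj).row_unique h1
      · intro ρ hρ
        have h1 := (hmP ρ).1 hρ
        obtain ⟨j, hj⟩ := exists_addBox h1.1.1 h1.1.2.symm
        have h2 := (hStrip_iff_rowLen.1 h1.2).2 j
        have h3 := hj j
        rw [if_pos rfl] at h3
        have hjJ : j ∈ J := (hJ j).2 (by omega)
        exact ⟨j, hjJ, (hg j hjJ).unique_below hj⟩
    -- a box can be added to `κ` in the first row, and in the rows below those of `J`
    let I := insert 0 (J.image Nat.succ)
    have hI : I.card = J.card + 1 := by
      rw [Finset.card_insert_of_notMem (by simp),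
        Finset.card_image_of_injective _ Nat.succ_injective]
    rw [hPJ, ← hI]
    symm
    have hex : ∀ i ∈ I, ∃ μ, AddBox κ i μ := by
      intro i hi
      apply exists_addBox_above
      rintro k rfl
      have hk : k ∈ J := by simpa [I] using hi
      exact ((hJ k).1 hk).trans_le (hs.1 k)
    choose! g hg using hex
    refine Finset.card_bij (fun i _ => g i) ?_ ?_ ?_
    · intro i hi
      refine (hmU _).2 ⟨(hg i hi).card, (hg i hi).le, hStrip_iff_rowLen.2 ⟨fun k => ?_,
        fun k => ?_⟩⟩
      · have h1 := le_iff_rowLen.1 (hg i hi).le k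
        have := hs.1 k
        omega
      · rw [hg i hi]
        split_ifs with hk
        · subst hk
          have hk : k ∈ J := by simpa [I] using hi
          exact (hJ k).1 hk
        · exact hs.2 k
    · intro i hi i' hi' h
      have h1 := hg i' hi'
      rw [← h] at h1
      exact (hg i hi).row_unique h1
    · intro μ hμ
      have h1 := (hmU μ).1 hμ
      obtain ⟨i, hi⟩ := exists_addBox h1.2.1 h1.1
      have hiI : i ∈ I := by
        cases i with
        | zero => simp [I]
        | succ k =>
          have h2 := (hStrip_iff_rowLen.1 h1.2.2).2 k
          have h3 := hi (k + 1)
          rw [if_pos rfl] at h3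
          have : k ∈ J := (hJ k).2 (by omega)
          simpa [I] using this
      exact ⟨i, hiI, (hg i hiI).unique_above hi⟩
  -- otherwise `κ ⊔ ν` and `κ ⊓ ν` are the only candidates, and they are admissible together
  · rw [if_neg hs, add_zero]
    have hcard : (κ ⊔ ν).card + (κ ⊓ ν).card = κ.card + ν.card :=
      Finset.card_union_add_card_inter κ.cells ν.cells
    have hU1 : ∀ μ ∈ U, μ = κ ⊔ ν := by
      intro μ hμ
      obtain ⟨h1, h2, h3⟩ := (hmU μ).1 hμ
      have hle : κ ⊔ ν ≤ μ := sup_le h2 h3.1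
      have hlt : κ < κ ⊔ ν := by
        rw [left_lt_sup]
        intro h4
        exact hs ⟨h4, fun i j hij => h3.2 i j (h2 hij)⟩
      have h5 : κ.card < (κ ⊔ ν).card :=
        Finset.card_lt_card (YoungDiagram.cells_ssubset_iff.2 hlt)
      have h6 : μ.cells.card ≤ (κ ⊔ ν).cells.card := by
        change μ.card ≤ (κ ⊔ ν).card
        omega
      exact YoungDiagram.ext (Finset.eq_of_subset_of_card_le
        (YoungDiagram.cells_subset_iff.2 hle) h6).symm
    have hP1 : ∀ ρ ∈ P, ρ = κ ⊓ ν := by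
      intro ρ hρ
      obtain ⟨⟨h1, h2⟩, h3⟩ := (hmP ρ).1 hρ
      have hle : ρ ≤ κ ⊓ ν := le_inf h3.1 h1
      have hlt : κ ⊓ ν < ν := by
        rw [inf_lt_right]
        intro h4
        exact hs ⟨h4, fun i j hij => h1 (h3.2 i j hij)⟩
      have h5 : (κ ⊓ ν).card < ν.card :=
        Finset.card_lt_card (YoungDiagram.cells_ssubset_iff.2 hlt)
      have h6 : (κ ⊓ ν).cells.card ≤ ρ.cells.card := by
        change (κ ⊓ ν).card ≤ ρ.card
        omega
      exact YoungDiagram.ext (Finset.eq_of_subset_of_card_le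
        (YoungDiagram.cells_subset_iff.2 hle) h6)
    have hUP : κ ⊔ ν ∈ U ↔ κ ⊓ ν ∈ P := by
      rw [hmU, hmP]
      constructor
      · rintro ⟨h1, -, h3⟩
        refine ⟨⟨inf_le_right, by omega⟩, inf_le_left, fun i j hij => ?_⟩
        rw [YoungDiagram.mem_inf]
        exact ⟨κ.up_left_mem (Nat.le_succ i) le_rfl hij,
          h3.2 i j (YoungDiagram.mem_sup.2 (Or.inl hij))⟩
      · rintro ⟨⟨-, h1⟩, h3⟩
        refine ⟨by omega, le_sup_left, le_sup_right, fun i j hij => ?_⟩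
        rcases YoungDiagram.mem_sup.1 hij with h | h
        · exact (YoungDiagram.mem_inf.1 (h3.2 i j h)).2
        · exact ν.up_left_mem (Nat.le_succ i) le_rfl h
    by_cases h : κ ⊔ ν ∈ U
    · rw [(Finset.eq_singleton_iff_unique_mem.2 ⟨h, hU1⟩ : U = {κ ⊔ ν}),
        (Finset.eq_singleton_iff_unique_mem.2 ⟨hUP.1 h, hP1⟩ : P = {κ ⊓ ν})]
      simp
    · rw [Finset.eq_empty_iff_forall_notMem.2 fun μ hμ => h (hU1 μ hμ ▸ hμ),
        Finset.eq_empty_iff_forall_notMem.2 fun ρ hρ => h (hUP.2 (hP1 ρ hρ ▸ hρ))]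

/-- The commutation relation between `h_r^⊥` and the multiplication by `S_{(1)}`. -/
lemma skew_lower (r : ℕ) (a : YoungDiagram → ℤ) :
    skew r (lower a) = lower (skew r a) + if r = 0 then 0 else skew (r - 1) a := by
  classical
  funext ν
  rw [Pi.add_apply]
  by_cases h0 : ν.card + r = 0
  · have hr : r = 0 := by omega
    have hν : ν.card = 0 := by omega
    rw [if_pos hr, Pi.zero_apply, add_zero]
    have e1 : lower (skew r a) ν = 0 := by
      refine Finset.sum_eq_zero fun κ hκ => ?_
      have := (Finset.mem_filter.1 hκ).2.2
      omega
    rw [e1]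
    refine Finset.sum_eq_zero fun μ hμ => ?_
    have hμ' := mem_diagrams.1 (Finset.mem_filter.1 hμ).1
    refine Finset.sum_eq_zero fun κ hκ => ?_
    have := (Finset.mem_filter.1 hκ).2.2
    omega
  obtain ⟨N, hN⟩ := Nat.exists_eq_succ_of_ne_zero h0
  have e1 : skew r (lower a) ν = ∑ κ ∈ diagrams N,
      ((diagrams (κ.card + 1)).filter fun μ => κ ≤ μ ∧ HStrip ν μ).card * a κ := by
    unfold skew
    have h1 : ∀ μ ∈ (diagrams (ν.card + r)).filter fun μ => HStrip ν μ, lower a μ =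
        ∑ κ ∈ diagrams N, if κ ≤ μ then a κ else 0 := by
      intro μ hμ
      have hμ' := mem_diagrams.1 (Finset.mem_filter.1 hμ).1
      unfold lower
      rw [← Finset.sum_filter, show μ.card - 1 = N by omega]
      refine Finset.sum_congr (Finset.filter_congr fun κ hκ => ?_) fun _ _ => rfl
      have := mem_diagrams.1 hκ
      exact ⟨fun h => h.1, fun h => ⟨h, by omega⟩⟩
    rw [Finset.sum_congr rfl h1, Finset.sum_comm]
    refine Finset.sum_congr rfl fun κ hκ => ?_
    have hκ' := mem_diagrams.1 hκ
    rw [← Finset.sum_filter, Finset.filter_filter, Finset.sum_const, nsmul_eq_mul, hκ', hN]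
    congr 3
    exact Finset.filter_congr fun μ _ => and_comm
  have e2 : lower (skew r a) ν = ∑ κ ∈ diagrams N,
      ((diagrams (ν.card - 1)).filter fun ρ => (ρ ≤ ν ∧ ρ.card + 1 = ν.card) ∧
        HStrip ρ κ).card * a κ := by
    unfold lower
    have h1 : ∀ ρ ∈ (diagrams (ν.card - 1)).filter fun ρ => ρ ≤ ν ∧ ρ.card + 1 = ν.card,
        skew r a ρ = ∑ κ ∈ diagrams N, if HStrip ρ κ then a κ else 0 := by
      intro ρ hρ
      have hρ' := (Finset.mem_filter.1 hρ).2.2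
      rw [skew, ← Finset.sum_filter, show ρ.card + r = N by omega]
    rw [Finset.sum_congr rfl h1, Finset.sum_comm]
    refine Finset.sum_congr rfl fun κ hκ => ?_
    rw [← Finset.sum_filter, Finset.filter_filter, Finset.sum_const, nsmul_eq_mul]
  have e3 : (if r = 0 then (0 : YoungDiagram → ℤ) else skew (r - 1) a) ν =
      ∑ κ ∈ diagrams N, (if HStrip ν κ then 1 else 0) * a κ := by
    simp only [ite_mul, one_mul, zero_mul]
    rw [← Finset.sum_filter]
    split_ifs with hr
    · rw [Pi.zero_apply]
      symm
      refine Finset.sum_eq_zero fun κ hκ => ?_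
      obtain ⟨h1, h2⟩ := Finset.mem_filter.1 hκ
      have h3 : ν.card ≤ κ.card := Finset.card_le_card (YoungDiagram.cells_subset_iff.2 h2.1)
      have h4 := mem_diagrams.1 h1
      omega
    · rw [skew, show ν.card + (r - 1) = N by omega]
  rw [e1, e2, e3, ← Finset.sum_add_distrib]
  refine Finset.sum_congr rfl fun κ _ => ?_
  rw [card_strip_box, ← add_mul]
  push_cast
  rfl

/-- The Pieri rule for `S_{(1)}`. -/
lemma schurSum_lower (d : ℕ) (c : ℕ → ℕ) (a : YoungDiagram → ℤ) :
    schurSum d c (lower a) = ∑ i ∈ Finset.range d,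
      if c i = 0 then 0 else schurSum d (Function.update c i (c i - 1)) a := by
  classical
  induction d generalizing a with
  | zero =>
    rw [Finset.sum_range_zero, schurSum]
    refine Finset.sum_eq_zero fun κ hκ => ?_
    have h : (⊥ : YoungDiagram).card = 0 := rfl
    have := (Finset.mem_filter.1 hκ).2.2
    omega
  | succ d ih =>
    rw [schurSum, skew_lower, schurSum_add, ih, Finset.sum_range_succ]
    congr 1
    · refine Finset.sum_congr rfl fun i hi => ?_
      have hid : d ≠ i := (Finset.mem_range.1 hi).ne'
      rw [schurSum, Function.update_of_ne hid]
    · split_ifs with h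
      · clear ih
        have := schurSum_smul d c 0 (0 : YoungDiagram → ℤ)
        rwa [zero_smul, zero_smul] at this
      · rw [schurSum, Function.update_self]
        refine schurSum_congr (fun i hi => ?_) _
        rw [Function.update_of_ne hi.ne]

end Boxes

/-! ### Functions of the first two columns of a fat hook -/

section FatHooks

lemma lt_colLen_iff {μ : YoungDiagram} {i j : ℕ} : i < μ.colLen j ↔ j < μ.rowLen i := by
  rw [← YoungDiagram.mem_iff_lt_colLen, YoungDiagram.mem_iff_lt_rowLen]

lemma colLen_eq {μ : YoungDiagram} {j N : ℕ} (h : ∀ i, j < μ.rowLen i ↔ i < N) :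
    μ.colLen j = N := by
  have h1 := h N
  have h2 := h (μ.colLen j)
  rw [← lt_colLen_iff] at h1 h2
  omega

lemma ext_colLen {μ ν : YoungDiagram} (h : ∀ j, μ.colLen j = ν.colLen j) : μ = ν := by
  apply YoungDiagram.ext
  ext ⟨i, j⟩
  rw [YoungDiagram.mem_cells, YoungDiagram.mem_cells, YoungDiagram.mem_iff_lt_colLen,
    YoungDiagram.mem_iff_lt_colLen, h]

lemma le_iff_colLen {ν μ : YoungDiagram} : ν ≤ μ ↔ ∀ j, ν.colLen j ≤ μ.colLen j := by
  constructor
  · intro h j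
    by_contra hj
    have h1 : (μ.colLen j, j) ∈ ν := YoungDiagram.mem_iff_lt_colLen.2 (by omega)
    exact lt_irrefl _ (YoungDiagram.mem_iff_lt_colLen.1 (h h1))
  · rintro h ⟨i, j⟩ hij
    exact YoungDiagram.mem_iff_lt_colLen.2 ((YoungDiagram.mem_iff_lt_colLen.1 hij).trans_le (h j))

lemma hStrip_iff_colLen {ν μ : YoungDiagram} :
    HStrip ν μ ↔ ∀ j, ν.colLen j ≤ μ.colLen j ∧ μ.colLen j ≤ ν.colLen j + 1 := by
  unfold HStrip
  rw [le_iff_colLen, forall_and]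
  refine and_congr_right fun _ => ⟨fun h j => ?_, fun h i j hij => ?_⟩
  · by_contra hj
    have h1 := h (ν.colLen j) j (YoungDiagram.mem_iff_lt_colLen.2 (by omega))
    exact lt_irrefl _ (YoungDiagram.mem_iff_lt_colLen.1 h1)
  · have h1 := YoungDiagram.mem_iff_lt_colLen.1 hij
    have h2 := h j
    exact YoungDiagram.mem_iff_lt_colLen.2 (by omega)

lemma card_eq_sum_colLen (μ : YoungDiagram) {N : ℕ} (hN : μ.rowLen 0 ≤ N) :
    μ.card = ∑ j ∈ Finset.range N, μ.colLen j := by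
  change μ.cells.card = _
  rw [Finset.card_eq_sum_card_fiberwise (f := Prod.snd) (t := Finset.range N)]
  · refine Finset.sum_congr rfl fun j _ => ?_
    rw [YoungDiagram.colLen_eq_card]
    rfl
  · rintro ⟨i, j⟩ hij
    have h1 : (i, j) ∈ μ := (YoungDiagram.mem_cells _).1 hij
    have h2 := YoungDiagram.mem_iff_lt_rowLen.1 h1
    have h3 := μ.rowLen_anti 0 i (Nat.zero_le i)
    simp only [Finset.coe_range, Set.mem_Iio]
    omega

/-- In a fat hook, that is when only the first row reaches the third column, the later columns have
length one up to the end of the first row. -/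
lemma colLen_add_two {μ : YoungDiagram} (h : μ.colLen 2 ≤ 1) (j : ℕ) :
    μ.colLen (j + 2) = if j < μ.rowLen 0 - 2 then 1 else 0 := by
  have h1 := μ.colLen_anti 2 (j + 2) (by omega)
  have h2 := lt_colLen_iff (μ := μ) (i := 0) (j := j + 2)
  split_ifs with h3 <;> omega

lemma card_fatHook {μ : YoungDiagram} (h : μ.colLen 2 ≤ 1) :
    μ.card = μ.colLen 0 + μ.colLen 1 + (μ.rowLen 0 - 2) := by
  rw [card_eq_sum_colLen μ (N := μ.rowLen 0 - 2 + 2) (by omega), Finset.sum_range_succ',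
    Finset.sum_range_succ']
  have h1 : ∑ k ∈ Finset.range (μ.rowLen 0 - 2), μ.colLen (k + 1 + 1) = μ.rowLen 0 - 2 := by
    rw [Finset.sum_congr rfl fun j hj => ?_, Finset.sum_const, Finset.card_range, smul_eq_mul,
      mul_one]
    rw [colLen_add_two h, if_pos (Finset.mem_range.1 hj)]
  rw [h1, zero_add]
  omega

lemma exists_colLen_eq {f : ℕ → ℕ} (hf : Antitone f) {N : ℕ} (hN : f N = 0) :
    ∃ μ : YoungDiagram, ∀ j, μ.colLen j = f j := by
  obtain ⟨μ, hμ⟩ := exists_rowLen_eq hf hN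
  exact ⟨μ.transpose, fun j => by rw [YoungDiagram.colLen_transpose, hμ]⟩

lemma one_le_colLen_one {μ : YoungDiagram} (h : μ.rowLen 0 - 2 ≠ 0) : 1 ≤ μ.colLen 1 := by
  rw [Nat.succ_le_iff, lt_colLen_iff]
  omega

/-- The fat hook with prescribed first two columns and with `n` cells to the right of them. -/
lemma exists_fatHook {a b n : ℕ} (hba : b ≤ a) (hn : n ≠ 0 → 1 ≤ b) :
    ∃ μ : YoungDiagram, μ.colLen 0 = a ∧ μ.colLen 1 = b ∧ μ.colLen 2 ≤ 1 ∧
      μ.rowLen 0 - 2 = n := by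
  let f : ℕ → ℕ := fun j => if j = 0 then a else if j = 1 then b else if j < n + 2 then 1 else 0
  have hf : Antitone f := by
    refine antitone_nat_of_succ_le fun j => ?_
    simp only [f]
    grind
  have hN : f (n + 2) = 0 := by simp [f]
  obtain ⟨μ, hμ⟩ := exists_colLen_eq hf hN
  have h2 : μ.colLen 2 ≤ 1 := by
    rw [hμ]
    simp only [f]
    grind
  refine ⟨μ, by simp [hμ, f], by simp [hμ, f], h2, ?_⟩
  have h3 : ∀ j, (j < μ.rowLen 0 - 2) ↔ j < n := by
    intro j
    have h4 := colLen_add_two h2 j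
    rw [hμ] at h4
    simp only [f] at h4
    grind
  have h5 := h3 n
  have h6 := h3 (μ.rowLen 0 - 2)
  omega

lemma fatHook_ext {μ ν : YoungDiagram} (hμ : μ.colLen 2 ≤ 1) (hν : ν.colLen 2 ≤ 1)
    (h0 : μ.colLen 0 = ν.colLen 0) (h1 : μ.colLen 1 = ν.colLen 1) (hc : μ.card = ν.card) :
    μ = ν := by
  have h2 := card_fatHook hμ
  have h3 := card_fatHook hν
  refine ext_colLen fun j => ?_
  match j with
  | 0 => exact h0
  | 1 => exact h1
  | j + 2 =>
    rw [colLen_add_two hμ, colLen_add_two hν]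
    have : μ.rowLen 0 - 2 = ν.rowLen 0 - 2 := by omega
    rw [this]

lemma hStrip_fatHook {ν μ : YoungDiagram} (hν : ν.colLen 2 ≤ 1) (hμ : μ.colLen 2 ≤ 1) :
    HStrip ν μ ↔ (ν.colLen 0 ≤ μ.colLen 0 ∧ μ.colLen 0 ≤ ν.colLen 0 + 1) ∧
      (ν.colLen 1 ≤ μ.colLen 1 ∧ μ.colLen 1 ≤ ν.colLen 1 + 1) ∧
      ν.rowLen 0 - 2 ≤ μ.rowLen 0 - 2 := by
  rw [hStrip_iff_colLen]
  constructor
  · intro h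
    refine ⟨h 0, h 1, ?_⟩
    by_contra h1
    have h2 := h (μ.rowLen 0 - 2 + 2)
    rw [colLen_add_two hν, colLen_add_two hμ, if_pos (by omega), if_neg (by omega)] at h2
    omega
  · rintro ⟨h0, h1, h2⟩ j
    match j with
    | 0 => exact h0
    | 1 => exact h1
    | j + 2 =>
      rw [colLen_add_two hν, colLen_add_two hμ]
      split_ifs <;> omega

/-- The function on diagrams that vanishes off the fat hooks and is given on them by the lengths of
the first two columns. -/
def hookFun (v : ℕ → ℕ → ℤ) (μ : YoungDiagram) : ℤ :=
  if μ.colLen 2 ≤ 1 then v (μ.colLen 0) (μ.colLen 1) else 0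

/-- A horizontal strip on a fat hook adds at most one cell to each of the first two columns, and
the remaining cells to the first row. -/
lemma skew_hookFun (r : ℕ) (v : ℕ → ℕ → ℤ) (ν : YoungDiagram) :
    skew r (hookFun v) ν = if ν.colLen 2 ≤ 1 then
      ∑ x ∈ Finset.range 2 ×ˢ Finset.range 2,
        if ν.colLen 1 + x.2 ≤ ν.colLen 0 + x.1 ∧ x.1 + x.2 ≤ r ∧
          (r = x.1 + x.2 ∨ 0 < ν.colLen 1 + x.2)
        then v (ν.colLen 0 + x.1) (ν.colLen 1 + x.2) else 0
      else 0 := by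
  classical
  unfold skew
  split_ifs with hν
  · refine Finset.sum_bij_ne_zero
      (fun μ _ _ => (μ.colLen 0 - ν.colLen 0, μ.colLen 1 - ν.colLen 1)) ?_ ?_ ?_ ?_
    · intro μ hμ h0
      have h1 : μ.colLen 2 ≤ 1 := by
        by_contra h
        exact h0 (by rw [hookFun, if_neg h])
      have h2 := ((hStrip_fatHook hν h1).1 (Finset.mem_filter.1 hμ).2)
      simp only [Finset.mem_product, Finset.mem_range]
      omega
    · intro μ hμ h0 μ' hμ' h0' he
      have h1 : μ.colLen 2 ≤ 1 := by
        by_contra h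
        exact h0 (by rw [hookFun, if_neg h])
      have h1' : μ'.colLen 2 ≤ 1 := by
        by_contra h
        exact h0' (by rw [hookFun, if_neg h])
      rw [Finset.mem_filter, mem_diagrams] at hμ hμ'
      have h2 := (hStrip_fatHook hν h1).1 hμ.2
      have h2' := (hStrip_fatHook hν h1').1 hμ'.2
      rw [Prod.mk.injEq] at he
      exact fatHook_ext h1 h1' (by omega) (by omega) (by omega)
    · rintro ⟨δ, ε⟩ hx h0
      simp only [Finset.mem_product, Finset.mem_range] at hx
      have hcond : ν.colLen 1 + ε ≤ ν.colLen 0 + δ ∧ δ + ε ≤ r ∧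
          (r = δ + ε ∨ 0 < ν.colLen 1 + ε) := by
        by_contra h
        exact h0 (if_neg h)
      rw [if_pos hcond] at h0
      obtain ⟨μ, h1, h2, h3, h4⟩ := exists_fatHook (a := ν.colLen 0 + δ) (b := ν.colLen 1 + ε)
        (n := ν.rowLen 0 - 2 + (r - (δ + ε))) hcond.1 (by
          intro hn
          rcases hcond.2.2 with h | h
          · have := one_le_colLen_one (μ := ν) (by omega)
            omega
          · omega)
      have hcμ := card_fatHook h3
      have hcν := card_fatHook hν
      refine ⟨μ, Finset.mem_filter.2 ⟨mem_diagrams.2 (by omega), (hStrip_fatHook hν h3).2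
        ⟨by omega, by omega, by omega⟩⟩, ?_, ?_⟩
      · rwa [hookFun, if_pos h3, h1, h2]
      · rw [Prod.mk.injEq]
        omega
    · intro μ hμ h0
      have h1 : μ.colLen 2 ≤ 1 := by
        by_contra h
        exact h0 (by rw [hookFun, if_neg h])
      rw [Finset.mem_filter, mem_diagrams] at hμ
      have h2 := (hStrip_fatHook hν h1).1 hμ.2
      have hcμ := card_fatHook h1
      have hcν := card_fatHook hν
      have h3 : ν.colLen 0 + (μ.colLen 0 - ν.colLen 0) = μ.colLen 0 := by omega
      have h4 : ν.colLen 1 + (μ.colLen 1 - ν.colLen 1) = μ.colLen 1 := by omega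
      have h5 := μ.colLen_anti 0 1 (by omega)
      have h6 := one_le_colLen_one (μ := μ)
      simp only [h3, h4]
      rw [if_pos ⟨by omega, by omega, by omega⟩, hookFun, if_pos h1]
  · refine Finset.sum_eq_zero fun μ hμ => ?_
    have h1 := hStrip_iff_colLen.1 (Finset.mem_filter.1 hμ).2 2
    rw [hookFun, if_neg (by omega)]

/-- Removing one box is the same as removing a horizontal strip of size one. -/
lemma le_and_card_iff {κ μ : YoungDiagram} :
    (κ ≤ μ ∧ κ.card + 1 = μ.card) ↔ HStrip κ μ ∧ κ.card + 1 = μ.card := by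
  constructor
  · rintro ⟨h1, h2⟩
    refine ⟨?_, h2⟩
    obtain ⟨i, hi⟩ := exists_addBox h1 h2.symm
    rw [hStrip_iff_rowLen]
    refine ⟨fun k => ?_, fun k => ?_⟩
    · rw [hi k]
      exact Nat.le_add_right _ _
    · have h3 := hi (k + 1)
      have h4 := hi k
      have h5 := μ.rowLen_anti k (k + 1) (by omega)
      have h6 := κ.rowLen_anti k (k + 1) (by omega)
      split_ifs at h3 h4 <;> omega
  · rintro ⟨h1, h2⟩
    exact ⟨h1.1, h2⟩

/-- Removing a box from a fat hook. -/
lemma lower_hookFun_of_le (v : ℕ → ℕ → ℤ) {μ : YoungDiagram} (hμ : μ.colLen 2 ≤ 1) :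
    lower (hookFun v) μ =
      (if μ.colLen 1 < μ.colLen 0 then v (μ.colLen 0 - 1) (μ.colLen 1) else 0) +
      (if 2 ≤ μ.colLen 1 ∨ (μ.colLen 1 = 1 ∧ μ.rowLen 0 - 2 = 0)
        then v (μ.colLen 0) (μ.colLen 1 - 1) else 0) +
      (if μ.rowLen 0 - 2 ≠ 0 then v (μ.colLen 0) (μ.colLen 1) else 0) := by
  classical
  have key : lower (hookFun v) μ = ∑ x ∈ Finset.range 2 ×ˢ Finset.range 2,
      if (x.1 + x.2 ≤ 1 ∧ x.1 ≤ μ.colLen 0 ∧ x.2 ≤ μ.colLen 1) ∧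
        μ.colLen 1 - x.2 ≤ μ.colLen 0 - x.1 ∧ (x.1 + x.2 = 1 ∨ μ.rowLen 0 - 2 ≠ 0) ∧
        (μ.rowLen 0 - 2 - (1 - (x.1 + x.2)) ≠ 0 → 1 ≤ μ.colLen 1 - x.2)
      then v (μ.colLen 0 - x.1) (μ.colLen 1 - x.2) else 0 := by
    unfold lower
    refine Finset.sum_bij_ne_zero
      (fun κ _ _ => (μ.colLen 0 - κ.colLen 0, μ.colLen 1 - κ.colLen 1)) ?_ ?_ ?_ ?_
    · intro κ hκ h0
      have h2 := hStrip_iff_colLen.1 (le_and_card_iff.1 (Finset.mem_filter.1 hκ).2).1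
      have h3 := h2 0
      have h4 := h2 1
      simp only [Finset.mem_product, Finset.mem_range]
      omega
    · intro κ hκ h0 κ' hκ' h0' he
      rw [Finset.mem_filter, le_and_card_iff, hStrip_iff_colLen] at hκ hκ'
      rw [Prod.mk.injEq] at he
      have h1 := hκ.2.1
      have h2 := hκ'.2.1
      have h10 := h1 0
      have h11 := h1 1
      have h12 := h1 2
      have h20 := h2 0
      have h21 := h2 1
      have h22 := h2 2
      exact fatHook_ext (by omega) (by omega) (by omega) (by omega) (by omega)
    · rintro ⟨δ, ε⟩ hx h0
      simp only [Finset.mem_product, Finset.mem_range] at hx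
      have hcond : (δ + ε ≤ 1 ∧ δ ≤ μ.colLen 0 ∧ ε ≤ μ.colLen 1) ∧
          μ.colLen 1 - ε ≤ μ.colLen 0 - δ ∧ (δ + ε = 1 ∨ μ.rowLen 0 - 2 ≠ 0) ∧
          (μ.rowLen 0 - 2 - (1 - (δ + ε)) ≠ 0 → 1 ≤ μ.colLen 1 - ε) := by
        by_contra h
        exact h0 (if_neg h)
      rw [if_pos hcond] at h0
      obtain ⟨κ, h1, h2, h3, h4⟩ := exists_fatHook (a := μ.colLen 0 - δ) (b := μ.colLen 1 - ε)
        (n := μ.rowLen 0 - 2 - (1 - (δ + ε))) hcond.2.1 hcond.2.2.2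
      have hcμ := card_fatHook hμ
      have hcκ := card_fatHook h3
      have hc : κ.card + 1 = μ.card := by omega
      refine ⟨κ, Finset.mem_filter.2 ⟨mem_diagrams.2 (by omega), le_and_card_iff.2
        ⟨(hStrip_fatHook h3 hμ).2 ⟨by omega, by omega, by omega⟩, hc⟩⟩, ?_, ?_⟩
      · rwa [hookFun, if_pos h3, h1, h2]
      · rw [Prod.mk.injEq]
        omega
    · intro κ hκ h0
      rw [Finset.mem_filter, le_and_card_iff] at hκ
      have h1 := hStrip_iff_colLen.1 hκ.2.1 2
      have hκ2 : κ.colLen 2 ≤ 1 := by omega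
      have h2 := (hStrip_fatHook hκ2 hμ).1 hκ.2.1
      have hcμ := card_fatHook hμ
      have hcκ := card_fatHook hκ2
      have h3 : μ.colLen 0 - (μ.colLen 0 - κ.colLen 0) = κ.colLen 0 := by omega
      have h4 : μ.colLen 1 - (μ.colLen 1 - κ.colLen 1) = κ.colLen 1 := by omega
      have h5 := κ.colLen_anti 0 1 (by omega)
      have h6 := one_le_colLen_one (μ := κ)
      simp only [h3, h4]
      rw [if_pos ⟨by omega, by omega, by omega, by omega⟩, hookFun, if_pos hκ2]
  have h5 := μ.colLen_anti 0 1 (by omega)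
  have h6 := one_le_colLen_one (μ := μ)
  rw [key, Finset.sum_product]
  simp only [Finset.sum_range_succ, Finset.sum_range_zero, zero_add, Nat.sub_zero, add_zero]
  rw [if_neg (c := (1 + 1 ≤ 1 ∧ _) ∧ _) (by omega), add_zero]
  have e1 : ((0 ≤ 1 ∧ 0 ≤ μ.colLen 0 ∧ 0 ≤ μ.colLen 1) ∧ μ.colLen 1 ≤ μ.colLen 0 ∧
      (0 = 1 ∨ μ.rowLen 0 - 2 ≠ 0) ∧ (μ.rowLen 0 - 2 - 1 ≠ 0 → 1 ≤ μ.colLen 1)) ↔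
      μ.rowLen 0 - 2 ≠ 0 := by omega
  have e2 : ((1 ≤ 1 ∧ 0 ≤ μ.colLen 0 ∧ 1 ≤ μ.colLen 1) ∧ μ.colLen 1 - 1 ≤ μ.colLen 0 ∧
      (True ∨ μ.rowLen 0 - 2 ≠ 0) ∧ (μ.rowLen 0 - 2 - 0 ≠ 0 → 1 ≤ μ.colLen 1 - 1)) ↔
      (2 ≤ μ.colLen 1 ∨ (μ.colLen 1 = 1 ∧ μ.rowLen 0 - 2 = 0)) := by grind
  have e3 : ((1 ≤ 1 ∧ 1 ≤ μ.colLen 0 ∧ 0 ≤ μ.colLen 1) ∧ μ.colLen 1 ≤ μ.colLen 0 - 1 ∧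
      (True ∨ μ.rowLen 0 - 2 ≠ 0) ∧ (μ.rowLen 0 - 2 - 0 ≠ 0 → 1 ≤ μ.colLen 1)) ↔
      μ.colLen 1 < μ.colLen 0 := by grind
  rw [if_congr e1 rfl rfl]
  simp only [Nat.sub_self]
  rw [if_congr e2 rfl rfl, if_congr e3 rfl rfl]
  ring

/-- The only box whose removal turns a diagram with at least two cells in the third column into a
fat hook is the second cell of the third column. -/
lemma lower_hookFun_of_lt (v : ℕ → ℕ → ℤ) {μ : YoungDiagram} (hμ : 1 < μ.colLen 2) :
    lower (hookFun v) μ =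
      if μ.colLen 2 = 2 ∧ μ.colLen 3 ≤ 1 then v (μ.colLen 0) (μ.colLen 1) else 0 := by
  classical
  -- a second column losing a cell would make the number of removed cells at least two
  have hcol : ∀ κ : YoungDiagram, κ ≤ μ → κ.card + 1 = μ.card → κ.colLen 2 ≤ 1 →
      ∀ j, κ.colLen j = μ.colLen j - if j = 2 then 1 else 0 := by
    intro κ h1 h2 h3 j
    have hs := hStrip_iff_colLen.1 (le_and_card_iff.1 ⟨h1, h2⟩).1
    by_contra hne
    have hj : κ.colLen j + 1 = μ.colLen j ∧ j ≠ 2 := by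
      have := hs j
      have := hs 2
      split_ifs at hne with h
      · subst h
        omega
      · exact ⟨by omega, h⟩
    have hc := card_eq_sum_colLen μ (N := max (μ.rowLen 0) (max (κ.rowLen 0) (j + 3)))
      (by omega)
    have hc' := card_eq_sum_colLen κ (N := max (μ.rowLen 0) (max (κ.rowLen 0) (j + 3)))
      (by omega)
    have hle : ∑ i ∈ Finset.range (max (μ.rowLen 0) (max (κ.rowLen 0) (j + 3))),
        (κ.colLen i + ((if i = j then 1 else 0) + if i = 2 then 1 else 0)) ≤
        ∑ i ∈ Finset.range (max (μ.rowLen 0) (max (κ.rowLen 0) (j + 3))), μ.colLen i := by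
      refine Finset.sum_le_sum fun i _ => ?_
      have h4 := hs i
      split_ifs with h5 h6 h6
      · omega
      · subst h5
        omega
      · subst h6
        omega
      · omega
    rw [Finset.sum_add_distrib, Finset.sum_add_distrib, Finset.sum_ite_eq', Finset.sum_ite_eq',
      if_pos (Finset.mem_range.2 (by omega)), if_pos (Finset.mem_range.2 (by omega))] at hle
    omega
  unfold lower
  split_ifs with h
  · obtain ⟨h2, h3⟩ := h
    have hf : Antitone fun j => μ.colLen j - if j = 2 then 1 else 0 := by
      refine antitone_nat_of_succ_le fun j => ?_
      have h4 := μ.colLen_anti j (j + 1) (by omega)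
      split_ifs with h5 h6 h6
      · omega
      · omega
      · subst h6
        norm_num
        omega
      · omega
    have hN : (fun j => μ.colLen j - if j = 2 then 1 else 0) (μ.rowLen 0) = 0 := by
      have h4 := lt_colLen_iff (μ := μ) (i := 0) (j := μ.rowLen 0)
      have h5 : μ.colLen (μ.rowLen 0) = 0 := by omega
      simp [h5]
    obtain ⟨κ, hκ⟩ := exists_colLen_eq hf hN
    have hle : κ ≤ μ := le_iff_colLen.2 fun j => by rw [hκ]; exact Nat.sub_le _ _
    have hcard : κ.card + 1 = μ.card := by
      have h4 : 2 < μ.rowLen 0 := lt_colLen_iff.1 (by omega)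
      have h5 := le_iff_rowLen.1 hle 0
      rw [card_eq_sum_colLen κ h5, card_eq_sum_colLen μ le_rfl]
      have h6 : ∀ j, μ.colLen j = κ.colLen j + if j = 2 then 1 else 0 := by
        intro j
        rw [hκ]
        split_ifs with h
        · subst h
          omega
        · omega
      rw [Finset.sum_congr rfl fun j _ => h6 j, Finset.sum_add_distrib, Finset.sum_ite_eq',
        if_pos (Finset.mem_range.2 h4)]
    have hκ2 : κ.colLen 2 ≤ 1 := by
      rw [hκ, if_pos rfl]
      omega
    rw [Finset.sum_eq_single κ]
    · rw [hookFun, if_pos hκ2, hκ, hκ]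
      norm_num
    · intro κ' hκ' hne
      rw [hookFun, if_neg]
      intro h4
      have h5 := (Finset.mem_filter.1 hκ').2
      exact hne (ext_colLen fun j => by rw [hcol κ' h5.1 h5.2 h4, hκ])
    · intro h4
      exact absurd (Finset.mem_filter.2 ⟨mem_diagrams.2 (by omega), hle, hcard⟩) h4
  · refine Finset.sum_eq_zero fun κ hκ => ?_
    rw [hookFun, if_neg]
    intro h4
    have h5 := (Finset.mem_filter.1 hκ).2
    have h6 := hcol κ h5.1 h5.2 h4
    have h7 := h6 2
    have h8 := h6 3
    have h9 := κ.colLen_anti 2 3 (by omega)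
    rw [if_pos rfl] at h7
    rw [if_neg (by omega)] at h8
    omega

end FatHooks

/-! ### The multiplicities -/

section Multiplicities

/-- The values of the eigenfunction of all `skew r` with eigenvalues `1, 3, 4, 4, …`, in terms of
the lengths `a` and `b` of the first two columns. -/
def vTriple (a b : ℕ) : ℤ := if b = 0 then 2 * a + 1 else 4 * (a - b + 1)

/-- The indicator of the columns. -/
def vCol (_ b : ℕ) : ℤ := if b = 0 then 1 else 0

/-- The columns, weighted by the parity of their length. -/
def vSign (a b : ℕ) : ℤ := if b = 0 then (-1) ^ a else 0

lemma colLen_bot (j : ℕ) : (⊥ : YoungDiagram).colLen j = 0 := by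
  by_contra h
  have h1 : (0, j) ∈ (⊥ : YoungDiagram) :=
    YoungDiagram.mem_iff_lt_colLen.2 (Nat.pos_of_ne_zero h)
  exact YoungDiagram.notMem_bot _ h1

lemma hookFun_bot (v : ℕ → ℕ → ℤ) : hookFun v ⊥ = v 0 0 := by
  simp [hookFun, colLen_bot]

lemma skew_vTriple (r : ℕ) :
    skew r (hookFun vTriple) = (if r = 0 then 1 else if r = 1 then 3 else 4 : ℤ) •
      hookFun vTriple := by
  funext ν
  rw [skew_hookFun, Pi.smul_apply, hookFun]
  split_ifs with h1 h2 h2 h3 <;>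
  simp only [Finset.sum_product, Finset.sum_range_succ, Finset.sum_range_zero, zero_add, add_zero,
    smul_zero]
  all_goals
    have h0 := ν.colLen_anti 0 1 (by omega)
    simp only [vTriple, smul_eq_mul]
    generalize ν.colLen 0 = a at *
    generalize ν.colLen 1 = b at *
    push_cast
    grind

lemma skew_vCol (r : ℕ) :
    skew r (hookFun vCol) = (if r ≤ 1 then 1 else 0 : ℤ) • hookFun vCol := by
  funext ν
  rw [skew_hookFun, Pi.smul_apply, hookFun]
  split_ifs with h1 h2 h2 <;>
  simp only [Finset.sum_product, Finset.sum_range_succ, Finset.sum_range_zero, zero_add, add_zero,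
    smul_zero]
  all_goals
    have h0 := ν.colLen_anti 0 1 (by omega)
    simp only [vCol, smul_eq_mul]
    grind

lemma skew_vSign (r : ℕ) :
    skew r (hookFun vSign) = (if r ≤ 1 then (-1) ^ r else 0 : ℤ) • hookFun vSign := by
  funext ν
  rw [skew_hookFun, Pi.smul_apply, hookFun]
  split_ifs with h1 h2 h2 <;>
  simp only [Finset.sum_product, Finset.sum_range_succ, Finset.sum_range_zero, zero_add, add_zero,
    smul_zero]
  · have h0 := ν.colLen_anti 0 1 (by omega)
    simp only [vSign, smul_eq_mul]
    interval_cases r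
    · grind
    · grind
  · simp only [vSign, smul_eq_mul]
    grind

/-- The multiplicity of the Schur function `S_μ` in the proper Hilbert series of `UT_2(E)`. The
cases are the columns, the shapes `(k, 1^l)`, the other fat hooks, and the shapes
`(k, 3, 2^m, 1^l)`. -/
def mult (μ : YoungDiagram) : ℕ :=
  if μ.colLen 2 ≤ 1 then
    if μ.colLen 1 = 0 then if Even (μ.colLen 0) then 1 else 0
    else if μ.colLen 1 = 1 then
      if μ.rowLen 0 = 2 then μ.colLen 0 / 2 else μ.colLen 0 - 1
    else if μ.rowLen 0 = 2 then μ.colLen 0 - μ.colLen 1 + 1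
    else 2 * (μ.colLen 0 - μ.colLen 1 + 1)
  else if μ.colLen 2 = 2 ∧ μ.colLen 3 ≤ 1 then μ.colLen 0 - μ.colLen 1 + 1
  else 0

lemma hookFun_add (v w : ℕ → ℕ → ℤ) : hookFun (v + w) = hookFun v + hookFun w := by
  funext μ
  simp only [hookFun, Pi.add_apply]
  split_ifs <;> simp

lemma hookFun_smul (k : ℤ) (v : ℕ → ℕ → ℤ) : hookFun (k • v) = k • hookFun v := by
  funext μ
  simp only [hookFun, Pi.smul_apply]
  split_ifs <;> simp

/-- The Schur coefficients of `4 H^B(E)^2 / ∏ (1 - t_i)`, in terms of the lengths of the first two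
columns of a fat hook. -/
def vSquare : ℕ → ℕ → ℤ := vTriple + (2 : ℤ) • vCol + vSign

lemma vSquare_zero (a : ℕ) : vSquare a 0 = 4 * ((a / 2 : ℕ) : ℤ) + 4 := by
  have h : vSquare a 0 = 2 * a + 1 + 2 + (-1) ^ a := by
    simp [vSquare, vTriple, vCol, vSign]
  rw [h]
  rcases Nat.even_or_odd a with ha | ha
  · rw [ha.neg_one_pow]
    obtain ⟨k, rfl⟩ := ha
    omega
  · rw [ha.neg_one_pow]
    obtain ⟨k, rfl⟩ := ha
    omega

lemma vSquare_of_pos (a : ℕ) {b : ℕ} (hb : b ≠ 0) : vSquare a b = 4 * (a - b + 1) := by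
  simp [vSquare, vTriple, vCol, vSign, hb]

lemma vCol_add_vSign (a b : ℕ) :
    vCol a b + vSign a b = if b = 0 ∧ Even a then 2 else 0 := by
  by_cases hb : b = 0
  · rcases Nat.even_or_odd a with ha | ha
    · simp [vCol, vSign, hb, ha, ha.neg_one_pow]
    · simp [vCol, vSign, hb, ha.neg_one_pow, Nat.not_even_iff_odd.2 ha]
  · simp [vCol, vSign, hb]

lemma four_mul_mult :
    (fun μ => 4 * (mult μ : ℤ)) = lower (hookFun vSquare) + (-1 : ℤ) • hookFun vSquare +
      (4 : ℤ) • hookFun (vCol + vSign) := by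
  funext μ
  simp only [Pi.add_apply, Pi.smul_apply, smul_eq_mul]
  have h10 := μ.colLen_anti 0 1 (by omega)
  have h21 := μ.colLen_anti 1 2 (by omega)
  by_cases hμ : μ.colLen 2 ≤ 1
  · rw [lower_hookFun_of_le _ hμ, hookFun, hookFun, if_pos hμ, if_pos hμ, Pi.add_apply,
      Pi.add_apply, vCol_add_vSign, mult, if_pos hμ]
    have h2 := one_le_colLen_one (μ := μ)
    by_cases h0 : μ.colLen 1 = 0
    · have h3 : μ.rowLen 0 - 2 = 0 := by
        by_contra h
        have := h2 h
        omega
      simp only [h0, h3, vSquare_zero, if_true, true_and]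
      by_cases he : Even (μ.colLen 0)
      · have h4 := he
        obtain ⟨k, hk⟩ := h4
        simp only [he, if_true]
        grind
      · obtain ⟨k, hk⟩ := Nat.not_even_iff_odd.1 he
        simp only [he, if_false]
        grind
    · rw [if_neg h0, if_neg (c := μ.colLen 1 = 0 ∧ _) (fun h => h0 h.1), vSquare_of_pos _ h0,
        vSquare_of_pos _ h0]
      have h3 : 2 ≤ μ.rowLen 0 := by
        have h4 := lt_colLen_iff (μ := μ) (i := 0) (j := 1)
        omega
      by_cases h1 : μ.colLen 1 = 1
      · rw [h1, if_pos rfl, vSquare_zero]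
        split_ifs <;> push_cast <;> omega
      · rw [if_neg h1, vSquare_of_pos _ (by omega : μ.colLen 1 - 1 ≠ 0)]
        split_ifs <;> omega
  · rw [lower_hookFun_of_lt _ (by omega), hookFun, hookFun, if_neg hμ, if_neg hμ, mult, if_neg hμ,
      vSquare_of_pos _ (by omega)]
    split_ifs <;> push_cast <;> omega

end Multiplicities

/-! ### Reading the multiplicities off the row lengths -/

section RowLengths

lemma rowLens_getD (μ : YoungDiagram) (i : ℕ) : μ.rowLens.getD i 0 = μ.rowLen i := by
  by_cases h : i < μ.rowLens.length
  · rw [List.getD_eq_getElem _ _ h, YoungDiagram.get_rowLens]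
  · rw [List.getD_eq_default _ _ (not_lt.1 h)]
    rw [YoungDiagram.length_rowLens, lt_colLen_iff] at h
    omega

lemma rowLens_eq {μ : YoungDiagram} {w : List ℕ} (hw : ∀ x ∈ w, 0 < x)
    (h : ∀ i, μ.rowLen i = w.getD i 0) : μ.rowLens = w := by
  have hlen : μ.rowLens.length = w.length := by
    rw [YoungDiagram.length_rowLens]
    refine colLen_eq fun i => ?_
    rw [h]
    constructor
    · intro h1
      by_contra h2
      rw [List.getD_eq_default _ _ (not_lt.1 h2)] at h1
      exact lt_irrefl _ h1
    · intro h1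
      rw [List.getD_eq_getElem _ _ h1]
      exact hw _ (List.getElem_mem h1)
  refine List.ext_getElem hlen fun i h1 h2 => ?_
  rw [YoungDiagram.get_rowLens, h, List.getD_eq_getElem _ _ h2]

lemma getD_twos_ones (m l i : ℕ) :
    (List.replicate m 2 ++ List.replicate l 1).getD i 0 =
      if i < m then 2 else if i < m + l then 1 else 0 := by
  by_cases h : i < m
  · rw [List.getD_append _ _ _ _ (by simpa using h), List.getD_replicate _ h, if_pos h]
  · rw [List.getD_append_right _ _ _ _ (by simpa using h), if_neg h, List.length_replicate]
    by_cases h1 : i < m + l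
    · rw [List.getD_replicate _ (by omega), if_pos h1]
    · rw [List.getD_eq_default _ _ (by simp; omega), if_neg h1]

lemma pos_of_mem_twos_ones {m l x : ℕ} (h : x ∈ List.replicate m 2 ++ List.replicate l 1) :
    0 < x := by
  rcases List.mem_append.1 h with h | h
  · rw [List.eq_of_mem_replicate h]
    norm_num
  · rw [List.eq_of_mem_replicate h]
    norm_num

lemma colLen_of_ones {μ : YoungDiagram} {l : ℕ} (h : μ.rowLens = List.replicate l 1) :
    μ.colLen 0 = l ∧ μ.colLen 1 = 0 := by
  have hr : ∀ i, μ.rowLen i = if i < l then 1 else 0 := by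
    intro i
    rw [← rowLens_getD, h]
    simpa using getD_twos_ones 0 l i
  refine ⟨colLen_eq fun i => ?_, colLen_eq fun i => ?_⟩ <;> rw [hr] <;> grind

lemma colLen_of_hook {μ : YoungDiagram} {k m l : ℕ} (hk : 2 ≤ k)
    (h : μ.rowLens = k :: (List.replicate m 2 ++ List.replicate l 1)) :
    μ.rowLen 0 = k ∧ μ.colLen 0 = m + l + 1 ∧ μ.colLen 1 = m + 1 ∧ μ.colLen 2 ≤ 1 := by
  have hr0 : μ.rowLen 0 = k := by
    rw [← rowLens_getD, h, List.getD_cons_zero]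
  have hr : ∀ i, μ.rowLen (i + 1) = if i < m then 2 else if i < m + l then 1 else 0 := by
    intro i
    rw [← rowLens_getD, h, List.getD_cons_succ, getD_twos_ones]
  refine ⟨hr0, colLen_eq fun i => ?_, colLen_eq fun i => ?_, ?_⟩
  · rcases i with _ | i
    · rw [hr0]
      omega
    · rw [hr]
      grind
  · rcases i with _ | i
    · rw [hr0]
      omega
    · rw [hr]
      grind
  · by_contra h2
    have h3 := lt_colLen_iff.1 (not_le.1 h2)
    rw [hr 0] at h3
    grind

lemma colLen_of_three {μ : YoungDiagram} {k m l : ℕ} (hk : 3 ≤ k)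
    (h : μ.rowLens = k :: 3 :: (List.replicate m 2 ++ List.replicate l 1)) :
    μ.colLen 0 = m + l + 2 ∧ μ.colLen 1 = m + 2 ∧ μ.colLen 2 = 2 ∧ μ.colLen 3 ≤ 1 := by
  have hr0 : μ.rowLen 0 = k := by
    rw [← rowLens_getD, h, List.getD_cons_zero]
  have hr1 : μ.rowLen 1 = 3 := by
    rw [← rowLens_getD, h, List.getD_cons_succ, List.getD_cons_zero]
  have hr : ∀ i, μ.rowLen (i + 2) = if i < m then 2 else if i < m + l then 1 else 0 := by
    intro i
    rw [← rowLens_getD, h, List.getD_cons_succ, List.getD_cons_succ, getD_twos_ones]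
  refine ⟨colLen_eq fun i => ?_, colLen_eq fun i => ?_, colLen_eq fun i => ?_, ?_⟩
  · match i with
    | 0 => omega
    | 1 => omega
    | i + 2 => rw [hr]; grind
  · match i with
    | 0 => omega
    | 1 => omega
    | i + 2 => rw [hr]; grind
  · match i with
    | 0 => omega
    | 1 => omega
    | i + 2 => rw [hr]; grind
  · by_contra h2
    have h3 := lt_colLen_iff.1 (not_le.1 h2)
    omega

lemma shape_of_mult_ne_zero {μ : YoungDiagram} (h : mult μ ≠ 0) :
    (∃ k m l : ℕ, 2 ≤ k ∧ μ.rowLens = k :: (List.replicate m 2 ++ List.replicate l 1)) ∨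
    (∃ l : ℕ, μ.rowLens = List.replicate l 1) ∨
    (∃ k m l : ℕ, 3 ≤ k ∧
      μ.rowLens = k :: 3 :: (List.replicate m 2 ++ List.replicate l 1)) := by
  have c0 := fun i => lt_colLen_iff (μ := μ) (i := i) (j := 0)
  have c1 := fun i => lt_colLen_iff (μ := μ) (i := i) (j := 1)
  have c2 := fun i => lt_colLen_iff (μ := μ) (i := i) (j := 2)
  have c3 := fun i => lt_colLen_iff (μ := μ) (i := i) (j := 3)
  have h10 := μ.colLen_anti 0 1 (by omega)
  have h21 := μ.colLen_anti 1 2 (by omega)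
  by_cases hμ : μ.colLen 2 ≤ 1
  · by_cases h1 : μ.colLen 1 = 0
    · refine Or.inr (Or.inl ⟨μ.colLen 0, rowLens_eq (fun x hx => ?_) fun i => ?_⟩)
      · rw [List.eq_of_mem_replicate hx]
        norm_num
      · have h2 := getD_twos_ones 0 (μ.colLen 0) i
        simp only [List.replicate_zero, List.nil_append, zero_add] at h2
        rw [h2]
        have := c0 i
        have := c1 i
        split_ifs <;> omega
    · refine Or.inl ⟨μ.rowLen 0, μ.colLen 1 - 1, μ.colLen 0 - μ.colLen 1, ?_,
        rowLens_eq (fun x hx => ?_) fun i => ?_⟩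
      · have := c1 0
        omega
      · rcases List.mem_cons.1 hx with rfl | hx
        · have := c1 0
          omega
        · exact pos_of_mem_twos_ones hx
      · rcases i with _ | i
        · rw [List.getD_cons_zero]
        · rw [List.getD_cons_succ, getD_twos_ones]
          have := c0 (i + 1)
          have := c1 (i + 1)
          have := c2 (i + 1)
          split_ifs <;> omega
  · rw [mult, if_neg hμ] at h
    have h2 : μ.colLen 2 = 2 ∧ μ.colLen 3 ≤ 1 := by
      by_contra h2
      exact h (if_neg h2)
    refine Or.inr (Or.inr ⟨μ.rowLen 0, μ.colLen 1 - 2, μ.colLen 0 - μ.colLen 1, ?_,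
        rowLens_eq (fun x hx => ?_) fun i => ?_⟩)
    · have := c2 0
      omega
    · rcases List.mem_cons.1 hx with rfl | hx
      · have := c2 0
        omega
      · rcases List.mem_cons.1 hx with rfl | hx
        · norm_num
        · exact pos_of_mem_twos_ones hx
    · match i with
      | 0 => rw [List.getD_cons_zero]
      | 1 =>
        rw [List.getD_cons_succ, List.getD_cons_zero]
        have := c2 1
        have := c3 1
        omega
      | i + 2 =>
        rw [List.getD_cons_succ, List.getD_cons_succ, getD_twos_ones]
        have := c0 (i + 2)
        have := c1 (i + 2)
        have := c2 (i + 2)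
        split_ifs <;> omega

lemma mult_hook {μ : YoungDiagram} {k m l : ℕ} (hk : 3 ≤ k) (hm : 1 ≤ m)
    (h : μ.rowLens = k :: (List.replicate m 2 ++ List.replicate l 1)) :
    mult μ = 2 * (l + 1) := by
  obtain ⟨h1, h2, h3, h4⟩ := colLen_of_hook (by omega) h
  rw [mult, if_pos h4, if_neg (by omega), if_neg (by omega), if_neg (by omega)]
  omega

lemma mult_twos_ones {μ : YoungDiagram} {m l : ℕ} (hm : 2 ≤ m)
    (h : μ.rowLens = List.replicate m 2 ++ List.replicate l 1) : mult μ = l + 1 := by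
  obtain ⟨m, rfl⟩ := Nat.exists_eq_add_of_le' (show 1 ≤ m by omega)
  rw [List.replicate_succ, List.cons_append] at h
  obtain ⟨h1, h2, h3, h4⟩ := colLen_of_hook le_rfl h
  rw [mult, if_pos h4, if_neg (by omega), if_neg (by omega), if_pos h1]
  omega

lemma mult_row_ones {μ : YoungDiagram} {k l : ℕ} (hk : 3 ≤ k)
    (h : μ.rowLens = k :: List.replicate l 1) : mult μ = l := by
  obtain ⟨h1, h2, h3, h4⟩ := colLen_of_hook (m := 0) (by omega) h
  rw [mult, if_pos h4, if_neg (by omega), if_pos (by omega), if_neg (by omega)]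
  omega

lemma mult_ones {μ : YoungDiagram} {l : ℕ} (h : μ.rowLens = List.replicate l 1) :
    mult μ = if Even l then 1 else 0 := by
  obtain ⟨h1, h2⟩ := colLen_of_ones h
  have h3 := μ.colLen_anti 1 2 (by omega)
  rw [mult, if_pos (by omega), if_pos h2, h1]

lemma mult_two_ones {μ : YoungDiagram} {l : ℕ} (h : μ.rowLens = 2 :: List.replicate l 1) :
    mult μ = (l + 1) / 2 := by
  obtain ⟨h1, h2, h3, h4⟩ := colLen_of_hook (m := 0) le_rfl h
  rw [mult, if_pos h4, if_neg (by omega), if_pos (by omega), if_pos h1, h2, zero_add]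

lemma mult_three {μ : YoungDiagram} {k m l : ℕ} (hk : 3 ≤ k)
    (h : μ.rowLens = k :: 3 :: (List.replicate m 2 ++ List.replicate l 1)) :
    mult μ = l + 1 := by
  obtain ⟨h1, h2, h3, h4⟩ := colLen_of_three hk h
  rw [mult, if_neg (by omega), if_pos ⟨h3, h4⟩]
  omega

end RowLengths

/-! ### Series whose coefficients are products -/

section ProductSeries

variable {d : ℕ}

/-- The power series `∏ i, ∑ k, γ i k * t_i ^ k`. -/
def prodSeries (γ : Fin d → ℕ → ℤ) : MvPowerSeries (Fin d) ℤ := fun n => ∏ i, γ i (n i)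

lemma coeff_prodSeries (γ : Fin d → ℕ → ℤ) (n : Fin d →₀ ℕ) :
    MvPowerSeries.coeff n (prodSeries γ) = ∏ i, γ i (n i) := rfl

lemma prodSeries_mul (γ γ' : Fin d → ℕ → ℤ) :
    prodSeries γ * prodSeries γ' =
      prodSeries fun i k => ∑ x ∈ Finset.HasAntidiagonal.antidiagonal k, γ i x.1 * γ' i x.2 := by
  classical
  ext n
  rw [MvPowerSeries.coeff_mul, coeff_prodSeries, Finset.prod_univ_sum]
  refine Finset.sum_bij' (fun p _ i => (p.1 i, p.2 i))
    (fun q _ => (Finsupp.equivFunOnFinite.symm fun i => (q i).1,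
      Finsupp.equivFunOnFinite.symm fun i => (q i).2)) ?_ ?_ ?_ ?_ ?_
  · intro p hp
    rw [Finset.HasAntidiagonal.mem_antidiagonal] at hp
    rw [Fintype.mem_piFinset]
    intro i
    rw [Finset.HasAntidiagonal.mem_antidiagonal, ← hp]
    rfl
  · intro q hq
    rw [Fintype.mem_piFinset] at hq
    rw [Finset.HasAntidiagonal.mem_antidiagonal]
    ext i
    exact Finset.HasAntidiagonal.mem_antidiagonal.1 (hq i)
  · intro p _
    ext i <;> rfl
  · intro q _
    rfl
  · intro p _
    rw [coeff_prodSeries, coeff_prodSeries, ← Finset.prod_mul_distrib]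

/-- The coefficients of `1 + c t`. -/
def linSeq (c : ℤ) (k : ℕ) : ℤ := if k = 0 then 1 else if k = 1 then c else 0

lemma sum_antidiagonal_linSeq_mul (c : ℤ) (f : ℕ → ℤ) (k : ℕ) :
    ∑ x ∈ Finset.HasAntidiagonal.antidiagonal k, linSeq c x.1 * f x.2 =
      f k + if k = 0 then 0 else c * f (k - 1) := by
  rcases k with _ | k
  · simp [linSeq]
  · rw [Finset.Nat.sum_antidiagonal_succ]
    rcases k with _ | k
    · simp [linSeq]
    · rw [Finset.Nat.sum_antidiagonal_succ]
      simp [linSeq]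

lemma prodSeries_linSeq_zero : prodSeries (fun _ : Fin d => linSeq 0) = 1 := by
  classical
  ext n
  rw [coeff_prodSeries, MvPowerSeries.coeff_one]
  split_ifs with h
  · simp [h, linSeq]
  · obtain ⟨i, hi⟩ := Finsupp.ne_iff.1 h
    refine Finset.prod_eq_zero (Finset.mem_univ i) ?_
    rw [Finsupp.zero_apply] at hi
    simp [linSeq, hi]

lemma one_sub_X_eq_prodSeries (i : Fin d) :
    (1 - MvPowerSeries.X i : MvPowerSeries (Fin d) ℤ) =
      prodSeries fun j => if j = i then linSeq (-1) else linSeq 0 := by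
  classical
  ext n
  rw [map_sub, MvPowerSeries.coeff_one, MvPowerSeries.coeff_X, coeff_prodSeries,
    Fintype.prod_eq_mul_prod_compl i, if_pos rfl]
  have h1 : ∏ j ∈ {i}ᶜ, (if j = i then linSeq (-1) else linSeq 0) (n j) =
      if ∀ j, j ≠ i → n j = 0 then 1 else 0 := by
    split_ifs with h
    · refine Finset.prod_eq_one fun j hj => ?_
      rw [Finset.mem_compl, Finset.mem_singleton] at hj
      rw [if_neg hj, h j hj]
      rfl
    · push Not at h
      obtain ⟨j, hj, hn⟩ := h
      refine Finset.prod_eq_zero (i := j) (by simpa using hj) ?_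
      rw [if_neg hj]
      simp [linSeq, hn]
  rw [h1]
  by_cases h : ∀ j, j ≠ i → n j = 0
  · have e : n = Finsupp.single i (n i) := by
      ext j
      by_cases hj : j = i
      · rw [hj, Finsupp.single_eq_same]
      · rw [h j hj, Finsupp.single_eq_of_ne hj]
    have e0 : n = 0 ↔ n i = 0 :=
      ⟨fun h => by rw [h]; rfl, fun h => by rw [e, h, Finsupp.single_zero]⟩
    have e1 : n = Finsupp.single i 1 ↔ n i = 1 :=
      ⟨fun h => by rw [h, Finsupp.single_eq_same], fun h => by rw [e, h]⟩
    rw [if_pos h, if_congr e0 rfl rfl, if_congr e1 rfl rfl, linSeq]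
    split_ifs <;> omega
  · rw [if_neg h, if_neg, if_neg]
    · simp
    · rintro rfl
      exact h fun j hj => Finsupp.single_eq_of_ne hj
    · rintro rfl
      exact h fun j hj => rfl

lemma prod_one_sub_X_eq_prodSeries :
    (∏ i : Fin d, (1 - MvPowerSeries.X i) : MvPowerSeries (Fin d) ℤ) =
      prodSeries fun _ => linSeq (-1) := by
  classical
  have key : ∀ s : Finset (Fin d), (∏ i ∈ s, (1 - MvPowerSeries.X i) : MvPowerSeries (Fin d) ℤ) =
      prodSeries fun j => if j ∈ s then linSeq (-1) else linSeq 0 := by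
    intro s
    induction s using Finset.induction_on with
    | empty => simpa using prodSeries_linSeq_zero.symm
    | insert i s hi ih =>
      rw [Finset.prod_insert hi, ih, one_sub_X_eq_prodSeries, prodSeries_mul]
      congr 1
      funext j k
      by_cases hj : j = i
      · subst hj
        simp only [if_true, hi, if_false, Finset.mem_insert_self, sum_antidiagonal_linSeq_mul]
        simp only [linSeq]
        grind
      · simp only [hj, if_false, Finset.mem_insert, false_or, sum_antidiagonal_linSeq_mul]
        simp
  rw [key]
  simp

lemma invProd_mul_prod :
    invProd d * ∏ i : Fin d, (1 - MvPowerSeries.X i) = 1 := by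
  refine MvPowerSeries.invOfUnit_mul _ _ ?_
  simp

lemma invProd_eq_prodSeries : invProd d = prodSeries fun _ _ => 1 := by
  have h : (∏ i : Fin d, (1 - MvPowerSeries.X i)) *
      prodSeries (fun (_ : Fin d) _ => (1 : ℤ)) = 1 := by
    rw [prod_one_sub_X_eq_prodSeries, prodSeries_mul, ← prodSeries_linSeq_zero]
    congr 1
    funext i k
    rw [sum_antidiagonal_linSeq_mul (-1) fun _ => 1]
    simp only [linSeq]
    split_ifs <;> omega
  rw [← mul_one (invProd d), ← h, ← mul_assoc, invProd_mul_prod, one_mul]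

end ProductSeries

/-! ### Schur expansions of power series -/

section SchurExpansion

variable {d : ℕ}

/-- A multidegree in `d` variables, extended by zero. -/
def extendDeg (n : Fin d →₀ ℕ) (a : ℕ) : ℕ := if h : a < d then n ⟨a, h⟩ else 0

lemma extendDeg_apply (n : Fin d →₀ ℕ) (i : Fin d) : extendDeg n i = n i := by
  simp [extendDeg]

/-- The coefficients of Schur functions are Kostka numbers. -/
lemma coeff_schur (μ : YoungDiagram) (n : Fin d →₀ ℕ) :
    MvPowerSeries.coeff n (schur d μ) = tabCount d (extendDeg n) μ := by
  change ((Nat.card _ : ℕ) : ℤ) = _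
  congr 1
  refine Nat.card_congr (Equiv.subtypeEquivRight fun T => and_congr_right fun _ => ?_)
  constructor
  · intro h a ha
    rw [h ⟨a, ha⟩, extendDeg, dif_pos ha]
  · intro h a
    rw [h a a.2, extendDeg_apply]

/-- The power series `∑ a(μ) S_μ(t_1, …, t_d)`. -/
def schurSeries (d : ℕ) (a : YoungDiagram → ℤ) : MvPowerSeries (Fin d) ℤ :=
  fun n => schurSum d (extendDeg n) a

lemma coeff_schurSeries (a : YoungDiagram → ℤ) (n : Fin d →₀ ℕ) :
    MvPowerSeries.coeff n (schurSeries d a) = schurSum d (extendDeg n) a := rfl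

lemma schurSeries_add (a b : YoungDiagram → ℤ) :
    schurSeries d (a + b) = schurSeries d a + schurSeries d b := by
  ext n
  rw [map_add, coeff_schurSeries, coeff_schurSeries, coeff_schurSeries, schurSum_add]

lemma schurSeries_smul (k : ℤ) (a : YoungDiagram → ℤ) :
    schurSeries d (k • a) = k • schurSeries d a := by
  ext n
  rw [map_smul, coeff_schurSeries, coeff_schurSeries, schurSum_smul]

lemma hasSum_schurSeries (a : YoungDiagram → ℕ) :
    HasSum (fun μ => a μ • schur d μ) (schurSeries d fun μ => (a μ : ℤ)) := by
  rw [MvPowerSeries.WithPiTopology.hasSum_iff_hasSum_coeff]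
  intro n
  rw [coeff_schurSeries, ← sum_mul_tabCount]
  have h : (fun μ => MvPowerSeries.coeff n (a μ • schur d μ)) =
      fun μ => (a μ : ℤ) * tabCount d (extendDeg n) μ := by
    funext μ
    rw [map_nsmul, coeff_schur, nsmul_eq_mul]
  rw [h]
  refine hasSum_sum_of_ne_finset_zero fun μ hμ => ?_
  rw [mem_diagrams] at hμ
  rw [tabCount_eq_zero hμ, Nat.cast_zero, mul_zero]

lemma schurSeries_of_eigen {a : YoungDiagram → ℤ} {γ : ℕ → ℤ} (h : ∀ r, skew r a = γ r • a)
    (h0 : a ⊥ = 1) : schurSeries d a = prodSeries fun _ => γ := by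
  ext n
  rw [coeff_schurSeries, coeff_prodSeries, schurSum_of_eigen h h0, Finset.prod_range]
  exact Finset.prod_congr rfl fun i _ => by rw [extendDeg_apply]

/-- Multiplication by `S_(1)` adds a box to the diagrams: the simplest Pieri rule. -/
lemma schurSeries_lower (a : YoungDiagram → ℤ) :
    schurSeries d (lower a) = (∑ i, MvPowerSeries.X i) * schurSeries d a := by
  classical
  ext n
  rw [coeff_schurSeries, schurSum_lower, Finset.sum_range, Finset.sum_mul, map_sum]
  refine Finset.sum_congr rfl fun i _ => ?_
  rw [extendDeg_apply, MvPowerSeries.X, MvPowerSeries.coeff_monomial_mul]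
  have hle : Finsupp.single i 1 ≤ n ↔ n i ≠ 0 := by
    rw [Finsupp.single_le_iff, Nat.one_le_iff_ne_zero]
  split_ifs with h1 h2 h2
  · exact absurd h1 (hle.1 h2)
  · rfl
  · rw [one_mul, coeff_schurSeries]
    refine schurSum_congr (fun k hk => ?_) a
    by_cases hki : k = i
    · subst hki
      rw [Function.update_self, extendDeg_apply]
      simp
    · rw [Function.update_of_ne hki]
      have hne : i ≠ ⟨k, hk⟩ := fun h => hki (by rw [h])
      rw [extendDeg, extendDeg, dif_pos hk, dif_pos hk, Finsupp.tsub_apply,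
        Finsupp.single_eq_of_ne hne.symm, Nat.sub_zero]
  · exact absurd (hle.2 h1) h2

/-- The indicator of the empty diagram. -/
def vEmpty (a b : ℕ) : ℤ := if a = 0 ∧ b = 0 then 1 else 0

lemma schurSeries_vEmpty : schurSeries d (hookFun vEmpty) = 1 := by
  rw [schurSeries_of_eigen (γ := linSeq 0), prodSeries_linSeq_zero]
  · intro r
    funext ν
    rw [skew_hookFun, Pi.smul_apply, hookFun]
    have h0 := ν.colLen_anti 0 1 (by omega)
    split_ifs with h1
    · simp only [Finset.sum_product, Finset.sum_range_succ, Finset.sum_range_zero, zero_add,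
        add_zero, vEmpty, linSeq, smul_eq_mul]
      grind
    · rw [smul_zero]
  · simp [hookFun_bot, vEmpty]

open Classical in
lemma lower_vEmpty (μ : YoungDiagram) :
    lower (hookFun vEmpty) μ = if μ = oneBox then 1 else 0 := by
  have hbox : oneBox.rowLens = List.replicate 1 1 :=
    YoungDiagram.rowLens_ofRowLens_eq_self (by simp)
  have h2 := colLen_of_ones hbox
  have h3 := oneBox.colLen_anti 1 2 (by omega)
  have h10 := μ.colLen_anti 0 1 (by omega)
  have h21 := μ.colLen_anti 1 2 (by omega)
  have hiff : μ = oneBox ↔ μ.colLen 0 = 1 ∧ μ.colLen 1 = 0 := by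
    constructor
    · rintro rfl
      exact h2
    · rintro ⟨h4, h5⟩
      have h6 : μ.colLen 2 ≤ 1 := by omega
      have h7 : oneBox.colLen 2 ≤ 1 := by omega
      have h8 := card_fatHook h6
      have h9 := card_fatHook h7
      have := one_le_colLen_one (μ := μ)
      have := one_le_colLen_one (μ := oneBox)
      exact fatHook_ext h6 h7 (by omega) (by omega) (by omega)
  rw [if_congr hiff rfl rfl]
  have h11 := one_le_colLen_one (μ := μ)
  by_cases hμ : μ.colLen 2 ≤ 1
  · rw [lower_hookFun_of_le _ hμ]
    simp only [vEmpty]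
    grind
  · rw [lower_hookFun_of_lt _ (by omega)]
    simp only [vEmpty]
    grind

lemma schur_oneBox : schur d oneBox = ∑ i, MvPowerSeries.X i := by
  classical
  rw [← mul_one (∑ i, MvPowerSeries.X i), ← schurSeries_vEmpty, ← schurSeries_lower]
  ext n
  rw [coeff_schur, coeff_schurSeries, ← sum_mul_tabCount]
  simp only [lower_vEmpty, ite_mul, one_mul, zero_mul]
  rw [Finset.sum_ite_eq']
  split_ifs with h
  · rfl
  · rw [mem_diagrams] at h
    rw [tabCount_eq_zero h, Nat.cast_zero]

end SchurExpansion

/-! ### The proper Hilbert series of the Grassmann algebra and of its triangular matrices -/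

section ProperHilbert

variable (F : Type*) [Field F] [CharZero F] (d : ℕ)

/-- Twice the sum of the elementary symmetric polynomials of even degree is
`∏ (1 + t_i) + ∏ (1 - t_i)`. -/
lemma two_smul_properHilbert_grassmann :
    (2 : ℤ) • properHilbert F (Grassmann F) d =
      prodSeries (fun _ => linSeq 1) + prodSeries (fun _ => linSeq (-1)) := by
  classical
  ext n
  rw [map_smul, map_add, coeff_properHilbert_grassmann, coeff_prodSeries, coeff_prodSeries]
  by_cases h : ∀ i, n i ≤ 1
  · have h1 : ∀ c : ℤ, ∏ i, linSeq c (n i) = c ^ ∑ i, n i := by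
      intro c
      rw [← Finset.prod_pow_eq_pow_sum]
      refine Finset.prod_congr rfl fun i _ => ?_
      have := h i
      interval_cases n i <;> simp [linSeq]
    rw [h1, h1, one_pow]
    by_cases he : Even (∑ i, n i)
    · rw [if_pos ⟨h, he⟩, he.neg_one_pow]
      rfl
    · rw [if_neg fun h => he h.2, (Nat.not_even_iff_odd.1 he).neg_one_pow]
      rfl
  · rw [if_neg fun h' => h h'.1]
    push Not at h
    obtain ⟨i, hi⟩ := h
    have h1 : ∀ c : ℤ, ∏ i, linSeq c (n i) = 0 := by
      intro c
      refine Finset.prod_eq_zero (Finset.mem_univ i) ?_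
      rw [linSeq, if_neg (by omega), if_neg (by omega)]
    rw [h1, h1]
    rfl

lemma schurSeries_vCol : schurSeries d (hookFun vCol) = prodSeries fun _ => linSeq 1 := by
  refine schurSeries_of_eigen (fun r => ?_) (by simp [hookFun_bot, vCol])
  rw [skew_vCol]
  congr 1
  simp only [linSeq]
  split_ifs <;> omega

lemma schurSeries_vSign : schurSeries d (hookFun vSign) = prodSeries fun _ => linSeq (-1) := by
  refine schurSeries_of_eigen (fun r => ?_) (by simp [hookFun_bot, vSign])
  rw [skew_vSign]
  congr 1
  match r with
  | 0 => simp [linSeq]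
  | 1 => simp [linSeq]
  | r + 2 => simp [linSeq]

lemma schurSeries_vTriple : schurSeries d (hookFun vTriple) =
    invProd d * (prodSeries fun _ => linSeq 1) ^ 2 := by
  rw [schurSeries_of_eigen skew_vTriple (by simp [hookFun_bot, vTriple]), invProd_eq_prodSeries,
    sq, mul_comm, mul_assoc, prodSeries_mul, prodSeries_mul]
  congr 1
  funext i k
  simp only [sum_antidiagonal_linSeq_mul 1 fun _ => 1]
  rw [sum_antidiagonal_linSeq_mul 1 fun j => 1 + if j = 0 then 0 else 1 * 1]
  split_ifs <;> omega

/-- Expanding the square of `∏ (1 + t_i) + ∏ (1 - t_i)`, the factor `1 / ∏ (1 - t_i)` cancels in all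
terms but the first. -/
lemma schurSeries_vSquare : schurSeries d (hookFun vSquare) =
    (4 : ℤ) • (invProd d * properHilbert F (Grassmann F) d ^ 2) := by
  have h1 := two_smul_properHilbert_grassmann F d
  have h2 : invProd d * prodSeries (fun _ => linSeq (-1)) = 1 := by
    rw [← prod_one_sub_X_eq_prodSeries, invProd_mul_prod]
  have h3 : (4 : ℤ) • (invProd d * properHilbert F (Grassmann F) d ^ 2) =
      invProd d * ((2 : ℤ) • properHilbert F (Grassmann F) d) ^ 2 := by
    simp only [zsmul_eq_mul]
    push_cast
    ring
  rw [h3, h1, vSquare, hookFun_add, hookFun_add, hookFun_smul, schurSeries_add, schurSeries_add,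
    schurSeries_smul, schurSeries_vCol, schurSeries_vSign, schurSeries_vTriple, zsmul_eq_mul]
  push_cast
  linear_combination (-2 * prodSeries (fun _ => linSeq 1) - prodSeries fun _ => linSeq (-1)) * h2

/-- The proper Hilbert series of `UT_2(E)` in terms of that of `E`. -/
theorem properHilbert_ut2_grassmann : properHilbert F (UT2 F (Grassmann F)) d =
    2 * properHilbert F (Grassmann F) d +
      (schur d oneBox - 1) * invProd d * properHilbert F (Grassmann F) d ^ 2 := by
  have h1 := hilbSeries_ut2 (F := F) (d := d) (exists_grassmann_tensor F)
  have h2 : (∏ i : Fin d, (1 - MvPowerSeries.X i)) * hilbSeries F d (Grassmann F) =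
    properHilbert F (Grassmann F) d := prod_one_sub_X_mul_hilbSeries
  have h3 : (∏ i : Fin d, (1 - MvPowerSeries.X i)) * hilbSeries F d (UT2 F (Grassmann F)) =
    properHilbert F (UT2 F (Grassmann F)) d := prod_one_sub_X_mul_hilbSeries
  have h4 := invProd_mul_prod (d := d)
  rw [← h3, h1, schur_oneBox, ← h2]
  linear_combination (-(∑ i, MvPowerSeries.X i - 1) * hilbSeries F d (Grassmann F) ^ 2 *
    ∏ i : Fin d, (1 - MvPowerSeries.X i)) * h4

/-- The Schur expansion of the proper Hilbert series of `UT_2(E)`. -/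
theorem properHilbert_ut2_eq_schurSeries :
    properHilbert F (UT2 F (Grassmann F)) d = schurSeries d fun μ => (mult μ : ℤ) := by
  have h1 : (4 : ℤ) • (schurSeries d fun μ => (mult μ : ℤ)) =
      (4 : ℤ) • properHilbert F (UT2 F (Grassmann F)) d := by
    have h2 : (4 : ℤ) • (fun μ => (mult μ : ℤ)) = fun μ => 4 * (mult μ : ℤ) := rfl
    rw [← schurSeries_smul, h2, four_mul_mult, hookFun_add, schurSeries_add, schurSeries_add,
      schurSeries_smul, schurSeries_smul, schurSeries_lower, schurSeries_vSquare F,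
      schurSeries_add, schurSeries_vCol, schurSeries_vSign, ← two_smul_properHilbert_grassmann F,
      properHilbert_ut2_grassmann, schur_oneBox]
    simp only [zsmul_eq_mul]
    push_cast
    ring
  ext n
  have h2 := congrArg (MvPowerSeries.coeff n) h1
  rw [map_smul, map_smul, smul_eq_mul, smul_eq_mul] at h2
  omega

end ProperHilbert

end PropPI

end

theorem proposition6p1 (F : Type*) [Field F] [CharZero F] :
    (∀ d : ℕ,
      PropPI.properHilbert F (PropPI.UT2 F (PropPI.Grassmann F)) d =
        2 * PropPI.properHilbert F (PropPI.Grassmann F) d +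
          (PropPI.schur d PropPI.oneBox - 1) * PropPI.invProd d *
            PropPI.properHilbert F (PropPI.Grassmann F) d ^ 2) ∧
    ∃ mult : YoungDiagram → ℕ,
      -- the expansion, in every number of variables
      (∀ d : ℕ, HasSum (fun μ : YoungDiagram => mult μ • PropPI.schur d μ)
        (PropPI.properHilbert F (PropPI.UT2 F (PropPI.Grassmann F)) d)) ∧
      -- only the shapes `(k, 2^m, 1^l)`, `(1^l)` and `(k, 3, 2^m, 1^l)` occur
      (∀ μ : YoungDiagram, mult μ ≠ 0 →
        (∃ k m l : ℕ, 2 ≤ k ∧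
          μ.rowLens = k :: (List.replicate m 2 ++ List.replicate l 1)) ∨
        (∃ l : ℕ, μ.rowLens = List.replicate l 1) ∨
        (∃ k m l : ℕ, 3 ≤ k ∧
          μ.rowLens = k :: 3 :: (List.replicate m 2 ++ List.replicate l 1))) ∧
      -- the shapes `(k, 2^m, 1^l)` with `k ≥ 3` and `m ≥ 1`
      (∀ (μ : YoungDiagram) (k m l : ℕ), 3 ≤ k → 1 ≤ m →
        μ.rowLens = k :: (List.replicate m 2 ++ List.replicate l 1) →
        mult μ = 2 * (l + 1)) ∧
      -- the shapes `(2^m, 1^l)` with `m ≥ 2`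
      (∀ (μ : YoungDiagram) (m l : ℕ), 2 ≤ m →
        μ.rowLens = List.replicate m 2 ++ List.replicate l 1 →
        mult μ = l + 1) ∧
      -- the shapes `(k, 1^l)` with `k ≥ 3`
      (∀ (μ : YoungDiagram) (k l : ℕ), 3 ≤ k →
        μ.rowLens = k :: List.replicate l 1 →
        mult μ = l) ∧
      -- the shapes `(1^l)`
      (∀ (μ : YoungDiagram) (l : ℕ), μ.rowLens = List.replicate l 1 →
        (Even l → mult μ = 1) ∧ (Odd l → mult μ = 0)) ∧
      -- the shapes `(2, 1^l)`
      (∀ (μ : YoungDiagram) (l : ℕ), μ.rowLens = 2 :: List.replicate l 1 →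
        (Even l → mult μ = l / 2) ∧ (Odd l → mult μ = (l + 1) / 2)) ∧
      -- the shapes `(k, 3, 2^m, 1^l)` with `k ≥ 3`
      (∀ (μ : YoungDiagram) (k m l : ℕ), 3 ≤ k →
        μ.rowLens = k :: 3 :: (List.replicate m 2 ++ List.replicate l 1) →
        mult μ = l + 1) := by
  refine ⟨PropPI.properHilbert_ut2_grassmann F, PropPI.mult, fun d => ?_,
    fun μ => PropPI.shape_of_mult_ne_zero, fun μ k m l hk hm h => PropPI.mult_hook hk hm h,
    fun μ m l hm h => PropPI.mult_twos_ones hm h, fun μ k l hk h => PropPI.mult_row_ones hk h,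
    fun μ l h => ?_, fun μ l h => ?_, fun μ k m l hk h => PropPI.mult_three hk h⟩
  · rw [PropPI.properHilbert_ut2_eq_schurSeries]
    exact PropPI.hasSum_schurSeries PropPI.mult
  · rw [PropPI.mult_ones h]
    exact ⟨fun he => if_pos he, fun ho => if_neg (Nat.not_even_iff_odd.2 ho)⟩
  · rw [PropPI.mult_two_ones h]
    refine ⟨fun he => ?_, fun _ => rfl⟩
    obtain ⟨k, rfl⟩ := he
    omega
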